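/- Let $P$ be a simple polygon in the Euclidean plane, i.e. the closed region bounded by a closed polygonal curve with at least three vertices whose edges are nondegenerate, whose consecutive edges meet only in their common vertex and whose non-consecutive edges are disjoint. A \emph{maximal empty circle} (MEC) of $P$ is a closed disk of radius $r\ge 0$ that is contained in $P$ and in no other closed disk contained in $P$ (radius $0$ occurs only at convex vertices). The \emph{medial axis} $M$ of $P$ is the set of centres of all MECs of $P$; for $x\in M$ let $\mathrm{MEC}_x$ be the MEC centred at $x$. For $q\in P$ let $M^q\subseteq M$ be the set of centres of all MECs that contain $q$. An \emph{arc} is the image of a compact interval (possibly a single point) under a continuous injective map, and a \emph{tree} is a nonempty set that is a union of finitely many arcs and in which any two points are joined by exactly one arc. Then: (0) A closed disk of positive radius is a MEC if and only if it is contained in $P$ and its bounding circle meets the boundary of $P$ in at least two points; and $M$ is a tree. (1) For every $q\in P$, the set $M^q$ is a connected subtree of $M$, i.e. a nonempty connected subset of $M$ that is itself a tree. (2) If $q\in P$ and $v\in M$ is such that $\mathrm{MEC}_v$ does not contain $q$, then $M^q$ is contained in a single connected component of $M\setminus\{v\}$. (3) If $u,v\in M$ and $\alpha\in \mathrm{MEC}_u\cap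 \mathrm{MEC}_v$, then $\alpha\in\mathrm{MEC}_x$ for every $x$ on the path (arc) in $M$ from $v$ to $u$. -/

import Mathlib

namespace MedialAxis

/-- The Euclidean plane. -/
abbrev Plane : Type := EuclideanSpace ℝ (Fin 2)

/-- A polygon with vertices `P 0, …, P (n-1)` is simple if it has at least three vertices, its
edges are nondegenerate, consecutive edges share only their common vertex, and non-consecutive
edges are disjoint. (Straight angles at vertices are allowed.) -/
structure IsSimple {n : ℕ} (P : Polygon Plane n) : Prop where
  three_le : 3 ≤ n
  nondegenerate : P.HasNondegenerateEdges
  adjacent : ∀ i : Fin n,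
    P.edgeSet ℝ i ∩ P.edgeSet ℝ (finRotate n i) = {P (finRotate n i)}
  nonadjacent : ∀ i j : Fin n, i ≠ j → j ≠ finRotate n i → i ≠ finRotate n j →
    Disjoint (P.edgeSet ℝ i) (P.edgeSet ℝ j)

/-- The closed region bounded by the polygon: the boundary curve together with the bounded
connected components of its complement. -/
def region {n : ℕ} (P : Polygon Plane n) : Set Plane :=
  P.boundary ℝ ∪
    {x | x ∉ P.boundary ℝ ∧ Bornology.IsBounded (connectedComponentIn (P.boundary ℝ)ᶜ x)}

/-- The closed disk with centre `x` and radius `r ≥ 0` is a maximal empty circle of `P`: it lies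
in the region of `P` and in no larger closed disk that lies in the region. Radius `0` is allowed;
it occurs at the convex vertices, which are the leaves of the medial axis. -/
def IsMEC {n : ℕ} (P : Polygon Plane n) (x : Plane) (r : ℝ) : Prop :=
  0 ≤ r ∧ Metric.closedBall x r ⊆ region P ∧
    ∀ (y : Plane) (s : ℝ), 0 ≤ s → Metric.closedBall y s ⊆ region P →
      Metric.closedBall x r ⊆ Metric.closedBall y s → y = x ∧ s = r

/-- The medial axis: the locus of the centres of all maximal empty circles. -/
def medialAxis {n : ℕ} (P : Polygon Plane n) : Set Plane :=
  {x | ∃ r : ℝ, IsMEC P x r}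

/-- The locus `M^q` of the centres of all maximal empty circles that enclose `q`. -/
def enclosingCentres {n : ℕ} (P : Polygon Plane n) (q : Plane) : Set Plane :=
  {x | ∃ r : ℝ, IsMEC P x r ∧ q ∈ Metric.closedBall x r}

/-- `A` is an arc (simple path) from `u` to `v`: the image of a compact interval under a
continuous injective map. The one-point arc, from a point to itself, is `L = 0`. -/
def IsArc {X : Type*} [TopologicalSpace X] (A : Set X) (u v : X) : Prop :=
  ∃ (L : ℝ) (f : ℝ → X), 0 ≤ L ∧ ContinuousOn f (Set.Icc 0 L) ∧ Set.InjOn f (Set.Icc 0 L) ∧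
    f 0 = u ∧ f L = v ∧ f '' Set.Icc 0 L = A

/-- `S` is a (finite, geometric) tree: it is nonempty, it is a union of finitely many arcs, and
any two of its points are joined by exactly one arc in it. -/
structure IsTree {X : Type*} [TopologicalSpace X] (S : Set X) : Prop where
  nonempty : S.Nonempty
  finite_arcs : ∃ F : Set (Set X), F.Finite ∧ (∀ A ∈ F, ∃ u v : X, IsArc A u v) ∧ ⋃₀ F = S
  unique_arc : ∀ u ∈ S, ∀ v ∈ S, ∃! A : Set X, A ⊆ S ∧ IsArc A u v

/-- `N` is a subtree of `M`: a subset of the tree `M` that is itself a tree. As a tree, `N` is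
nonempty and connected and contains the arc of `M` between any two of its points. -/
def IsSubtree {X : Type*} [TopologicalSpace X] (N M : Set X) : Prop :=
  N ⊆ M ∧ IsTree M ∧ IsTree N

end MedialAxis

/-! Let `B` be the boundary, `Ω` the interior and d the distance to `B`. A disk about x lies in the
region exactly when x does and the radius is at most d(x), and the disk of radius d(x) about x lies
in that about y exactly when |x - y| + d(x) ≤ d(y). So the medial axis is the set `axis Ω B` of
maximal points for this order.

Below every claim lies a retraction. If the disk of z ∈ Ω touches `B` at p, then every disk of the
region containing it also touches `B` at p and has its centre on the ray from p through z. Hence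
exactly one maximal disk contains it; call its centre ρ(z). The relation defining ρ is closed and
the axis is compact, so ρ is continuous, and the axis is connected (`exists_retraction`,
`isPreconnected_axis`).

A maximal disk is determined by a contact point and the inward normal there. As the contact runs
along an edge, or the normal turns at a reflex vertex, the centre moves along an arc. Finitely many
such arcs cover the axis (`exists_finite_arcs`).

Arcs are unique because a maximal disk of positive radius touches `B` at two points. The radii to
them form a crosscut, which disconnects `Ω` by a winding number argument, and crosscuts through
different centres are disjoint. If two arcs had the same ends and one were not contained in the
other, there would be a cycle; deleting any one of uncountably many of its points c leaves it
connected, so it stays on one side of the crosscut at c. The sides it avoids would be uncountably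
many disjoint nonempty open sets (`exists_dead_side`, `arc_subset_arc`).

Suppose now that α lies in the maximal disks about u and w but not in the one about x. Along the
segments from u and w to α, the disk of every point contains α, so ρ never takes the value x. The
image joins u to w in the axis without x, hence so does an arc, and by uniqueness x is not on the
arc from u to w. This is (3). It says that M^q is arc-convex; being closed and nonempty it is a
subtree, and (1) and (2) follow.

The local and global facts about `Ω` are collected in `IsPolygonInterior`, and are supplied by a
proof of the Jordan curve theorem for simple polygons. -/

namespace MedialAxis

open Set Filter Topology Metric

local notation "⟪" x "," y "⟫" => inner ℝ x y

/-! ### Arcs, finite unions of arcs, and trees -/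

section Arcs

variable {X : Type*} [TopologicalSpace X]

theorem isArc_image_Icc {f : ℝ → X} {a b : ℝ} (hab : a ≤ b) (hf : ContinuousOn f (Icc a b))
    (hi : InjOn f (Icc a b)) : IsArc (f '' Icc a b) (f a) (f b) := by
  have hmaps : MapsTo (fun t => t + a) (Icc 0 (b - a)) (Icc a b) := fun t ht =>
    ⟨by linarith [ht.1], by linarith [ht.2]⟩
  refine ⟨b - a, fun t => f (t + a), by linarith, hf.comp (by fun_prop) hmaps, ?_, by simp,
    by simp, ?_⟩
  · intro s hs t ht h
    simpa using hi (hmaps hs) (hmaps ht) h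
  · rw [← image_image f (fun t => t + a)]
    simp

theorem IsArc.symm {A : Set X} {u v : X} (h : IsArc A u v) : IsArc A v u := by
  obtain ⟨L, f, hL, hf, hi, h0, h1, rfl⟩ := h
  have hmaps : MapsTo (fun t => L - t) (Icc 0 L) (Icc 0 L) := fun t ht =>
    ⟨by linarith [ht.2], by linarith [ht.1]⟩
  refine ⟨L, fun t => f (L - t), hL, hf.comp (by fun_prop) hmaps, ?_, by simpa, by simpa, ?_⟩
  · intro s hs t ht h
    simpa using hi (hmaps hs) (hmaps ht) h
  · rw [← image_image f (fun t => L - t)]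
    simp

theorem IsArc.isCompact {A : Set X} {u v : X} (h : IsArc A u v) : IsCompact A := by
  obtain ⟨L, f, hL, hf, hi, h0, h1, rfl⟩ := h
  exact isCompact_Icc.image_of_continuousOn hf

theorem IsArc.isPreconnected {A : Set X} {u v : X} (h : IsArc A u v) : IsPreconnected A := by
  obtain ⟨L, f, hL, hf, hi, h0, h1, rfl⟩ := h
  exact isPreconnected_Icc.image _ hf

theorem IsArc.left_mem {A : Set X} {u v : X} (h : IsArc A u v) : u ∈ A := by
  obtain ⟨L, f, hL, hf, hi, h0, h1, rfl⟩ := h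
  exact ⟨0, ⟨le_rfl, hL⟩, h0⟩

theorem IsArc.right_mem {A : Set X} {u v : X} (h : IsArc A u v) : v ∈ A := h.symm.left_mem

theorem isArc_singleton (u : X) : IsArc {u} u u :=
  ⟨0, fun _ => u, le_rfl, continuousOn_const, by simp [InjOn], rfl, rfl, by simp⟩

theorem exists_isArc_of_image {f : ℝ → X} {I : Set ℝ} (hI : I.OrdConnected)
    (hf : ContinuousOn f I) (hi : InjOn f I) {y z : X} (hy : y ∈ f '' I) (hz : z ∈ f '' I) :
    ∃ A ⊆ f '' I, IsArc A y z := by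
  obtain ⟨s, hs, rfl⟩ := hy
  obtain ⟨t, ht, rfl⟩ := hz
  rcases le_total s t with h | h
  · exact ⟨_, image_mono (hI.out hs ht),
      isArc_image_Icc h (hf.mono (hI.out hs ht)) (hi.mono (hI.out hs ht))⟩
  · exact ⟨_, image_mono (hI.out ht hs),
      (isArc_image_Icc h (hf.mono (hI.out ht hs)) (hi.mono (hI.out ht hs))).symm⟩

/-- Plain concatenation need not be injective. Instead follow `A` only up to its first point on
`A'`, then continue along `A'`. -/
theorem IsArc.trans [T2Space X] {A A' : Set X} {u v w : X} (h : IsArc A u v)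
    (h' : IsArc A' v w) : ∃ C ⊆ A ∪ A', IsArc C u w := by
  have hA'c := h'.isCompact.isClosed
  have hvA' := h'.left_mem
  obtain ⟨L, f, hL, hf, hi, rfl, rfl, rfl⟩ := h
  obtain ⟨L', g, hL', hg, hgi, hg0, rfl, hgA⟩ := h'
  have hScl : IsCompact (Icc 0 L ∩ f ⁻¹' A') :=
    isCompact_Icc.of_isClosed_subset (hf.preimage_isClosed_of_isClosed isClosed_Icc hA'c)
      inter_subset_left
  obtain ⟨t₀, ⟨ht₀, hft₀⟩, hmin⟩ := hScl.exists_isLeast ⟨L, ⟨hL, le_rfl⟩, hvA'⟩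
  rw [mem_preimage, ← hgA] at hft₀
  obtain ⟨s₀, hs₀, hgs₀⟩ := hft₀
  set T := t₀ + (L' - s₀) with hT
  let k : ℝ → X := fun t => if t ≤ t₀ then f t else g (s₀ + (t - t₀))
  have hk1 : ∀ t, t ≤ t₀ → k t = f t := fun t ht => if_pos ht
  have hk2 : ∀ t, t₀ ≤ t → k t = g (s₀ + (t - t₀)) := by
    intro t ht
    rcases ht.eq_or_lt with rfl | ht
    · rw [hk1 _ le_rfl]; simp [hgs₀]
    · exact if_neg (not_le.2 ht)
  have hm1 : Icc 0 t₀ ⊆ Icc 0 L := Icc_subset_Icc_right ht₀.2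
  have hm2 : MapsTo (fun t => s₀ + (t - t₀)) (Icc t₀ T) (Icc 0 L') := fun t ht =>
    ⟨by linarith [ht.1, hs₀.1], by linarith [ht.2]⟩
  have hunion : Icc 0 t₀ ∪ Icc t₀ T = Icc 0 T :=
    Icc_union_Icc_eq_Icc ht₀.1 (by linarith [hs₀.2])
  have hc1 : ContinuousOn k (Icc 0 t₀) := (hf.mono hm1).congr fun t ht => hk1 t ht.2
  have hc2 : ContinuousOn k (Icc t₀ T) :=
    (hg.comp (by fun_prop) hm2).congr fun t ht => hk2 t ht.1
  have hlt : ∀ s ∈ Icc (0 : ℝ) T, ∀ t ∈ Icc (0 : ℝ) T, s ≤ t → k s = k t → s = t := by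
    intro s hs t ht hst hkk
    rcases le_or_gt t t₀ with h1 | h1
    · rw [hk1 _ h1, hk1 _ (hst.trans h1)] at hkk
      exact hi (hm1 ⟨hs.1, hst.trans h1⟩) (hm1 ⟨ht.1, h1⟩) hkk
    rcases lt_or_ge s t₀ with h2 | h2
    · rw [hk1 _ h2.le, hk2 _ h1.le] at hkk
      have : s ∈ Icc 0 L ∩ f ⁻¹' A' := by
        refine ⟨hm1 ⟨hs.1, h2.le⟩, ?_⟩
        rw [mem_preimage, hkk, ← hgA]
        exact mem_image_of_mem _ (hm2 ⟨h1.le, ht.2⟩)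
      exact absurd (hmin this) (not_le.2 h2)
    · rw [hk2 _ h2, hk2 _ h1.le] at hkk
      have := hgi (hm2 ⟨h2, hs.2⟩) (hm2 ⟨h1.le, ht.2⟩) hkk
      linarith
  refine ⟨k '' Icc 0 T, ?_, T, k, by linarith [hs₀.2, ht₀.1], ?_, ?_, hk1 0 ht₀.1, ?_, rfl⟩
  · rw [← hunion, image_union]
    apply union_subset_union
    · rintro _ ⟨t, ht, rfl⟩
      exact ⟨t, hm1 ht, (hk1 t ht.2).symm⟩
    · rintro _ ⟨t, ht, rfl⟩
      rw [← hgA]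
      exact ⟨_, hm2 ht, (hk2 t ht.1).symm⟩
  · rw [← hunion]
    exact hc1.union_of_isClosed hc2 isClosed_Icc isClosed_Icc
  · intro s hs t ht hkk
    rcases le_total s t with h | h
    · exact hlt s hs t ht h hkk
    · exact (hlt t ht s hs h hkk.symm).symm
  · rw [hk2 _ (by linarith [hs₀.2])]
    congr 1
    rw [hT]; ring

/-- A set covered by finitely many relatively closed, arc-connected pieces is arc-connected along
each of its preconnected subsets. -/
theorem exists_isArc_of_finite_cover [T2Space X] {S : Set X} {F : Set (Set X)} (hF : F.Finite)
    (hS : S ⊆ ⋃₀ F) (hFS : ∀ C ∈ F, C ⊆ S) (hcl : ∀ C ∈ F, closure C ∩ S ⊆ C)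
    (harc : ∀ C ∈ F, ∀ y ∈ C, ∀ z ∈ C, ∃ A ⊆ C, IsArc A y z)
    {T : Set X} (hTS : T ⊆ S) (hT : IsPreconnected T) {u v : X} (hu : u ∈ T) (hv : v ∈ T) :
    ∃ A ⊆ S, IsArc A u v := by
  by_contra hcon
  -- Being reachable from `u` is constant on each piece. If `v` is not reachable, the closures of
  -- the reachable and of the unreachable pieces are two closed sets that cover `T` and meet there;
  -- relative closedness puts the common point into a piece of each kind.
  let R : X → Prop := fun y => ∃ A ⊆ S, IsArc A u y
  have hRC : ∀ C ∈ F, ∀ y ∈ C, ∀ z ∈ C, R y → R z := by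
    rintro C hC y hy z hz ⟨A, hA, hAa⟩
    obtain ⟨A', hA', hAa'⟩ := harc C hC y hy z hz
    obtain ⟨A'', hA'', h⟩ := hAa.trans hAa'
    exact ⟨A'', hA''.trans (union_subset hA (hA'.trans (hFS C hC))), h⟩
  let F1 := {C ∈ F | ∃ y ∈ C, R y}
  let F2 := {C ∈ F | ∃ y ∈ C, ¬ R y}
  have hcl1 : IsClosed (⋃ C ∈ F1, closure C) :=
    (hF.subset (sep_subset _ _)).isClosed_biUnion fun _ _ => isClosed_closure
  have hcl2 : IsClosed (⋃ C ∈ F2, closure C) :=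
    (hF.subset (sep_subset _ _)).isClosed_biUnion fun _ _ => isClosed_closure
  have hmem : ∀ y ∈ T, ∃ C ∈ F, y ∈ C := fun y hy => hS (hTS hy)
  have hRu : R u := ⟨{u}, by simpa using hTS hu, isArc_singleton u⟩
  obtain ⟨x, hxT, hx1, hx2⟩ := isPreconnected_closed_iff.1 hT _ _ hcl1 hcl2
    (fun y hy => by
      obtain ⟨C, hC, hyC⟩ := hmem y hy
      by_cases hR : R y
      · exact Or.inl (mem_biUnion (show C ∈ F1 from ⟨hC, y, hyC, hR⟩) (subset_closure hyC))
      · exact Or.inr (mem_biUnion (show C ∈ F2 from ⟨hC, y, hyC, hR⟩) (subset_closure hyC)))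
    (by
      obtain ⟨C, hC, hyC⟩ := hmem u hu
      exact ⟨u, hu, mem_biUnion (show C ∈ F1 from ⟨hC, u, hyC, hRu⟩) (subset_closure hyC)⟩)
    (by
      obtain ⟨C, hC, hyC⟩ := hmem v hv
      exact ⟨v, hv, mem_biUnion (show C ∈ F2 from ⟨hC, v, hyC, hcon⟩) (subset_closure hyC)⟩)
  simp only [mem_iUnion] at hx1 hx2
  obtain ⟨C, ⟨hC, y, hy, hRy⟩, hxC⟩ := hx1
  obtain ⟨D, ⟨hD, z, hz, hRz⟩, hxD⟩ := hx2
  have hxC' := hcl C hC ⟨hxC, hTS hxT⟩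
  have hxD' := hcl D hD ⟨hxD, hTS hxT⟩
  exact hRz (hRC D hD x hxD' z hz (hRC C hC y hy x hxC' hRy))

theorem IsArc.exists_isArc_of_mem {A : Set X} {u v y z : X} (h : IsArc A u v) (hy : y ∈ A)
    (hz : z ∈ A) : ∃ A' ⊆ A, IsArc A' y z := by
  obtain ⟨L, f, hL, hf, hi, h0, h1, rfl⟩ := h
  exact exists_isArc_of_image ordConnected_Icc hf hi hy hz

theorem exists_isArc_of_isPreconnected [T2Space X] {M : Set X} {F : Set (Set X)} (hF : F.Finite)
    (harc : ∀ A ∈ F, ∃ u v : X, IsArc A u v) (hM : ⋃₀ F = M) (hc : IsPreconnected M)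
    {u v : X} (hu : u ∈ M) (hv : v ∈ M) : ∃ A ⊆ M, IsArc A u v := by
  subst hM
  refine exists_isArc_of_finite_cover hF subset_rfl (fun C hC => subset_sUnion_of_mem hC)
    (fun C hC => ?_) (fun C hC y hy z hz => ?_) subset_rfl hc hu hv
  · obtain ⟨a, b, h⟩ := harc C hC
    rw [h.isCompact.isClosed.closure_eq]
    exact inter_subset_left
  · obtain ⟨a, b, h⟩ := harc C hC
    exact h.exists_isArc_of_mem hy hz

/-- Removing a point from an arc leaves at most two arc-connected pieces, closed away from the
point. -/
theorem IsArc.exists_diff_eq_union [T2Space X] {A : Set X} {u v : X} (h : IsArc A u v) (x : X) :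
    ∃ C D : Set X, A \ {x} = C ∪ D ∧ closure C \ {x} ⊆ C ∧ closure D \ {x} ⊆ D ∧
      (∀ y ∈ C, ∀ z ∈ C, ∃ A' ⊆ C, IsArc A' y z) ∧
      (∀ y ∈ D, ∀ z ∈ D, ∃ A' ⊆ D, IsArc A' y z) := by
  by_cases hx : x ∈ A
  · obtain ⟨L, f, hL, hf, hi, h0, h1, rfl⟩ := h
    obtain ⟨t, ht, rfl⟩ := hx
    have h1 : Icc 0 t ⊆ Icc 0 L := Icc_subset_Icc_right ht.2
    have h2 : Icc t L ⊆ Icc 0 L := Icc_subset_Icc_left ht.1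
    have e1 : f '' Icc 0 t \ {f t} ⊆ f '' Ico 0 t := by
      rintro _ ⟨⟨s, hs, rfl⟩, hne⟩
      exact ⟨s, ⟨hs.1, hs.2.lt_of_ne fun h => hne (by simp [h])⟩, rfl⟩
    have e2 : f '' Icc t L \ {f t} ⊆ f '' Ioc t L := by
      rintro _ ⟨⟨s, hs, rfl⟩, hne⟩
      exact ⟨s, ⟨hs.1.lt_of_ne fun h => hne (by simp [h]), hs.2⟩, rfl⟩
    have k1 : IsClosed (f '' Icc 0 t) :=
      (isCompact_Icc.image_of_continuousOn (hf.mono h1)).isClosed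
    have k2 : IsClosed (f '' Icc t L) :=
      (isCompact_Icc.image_of_continuousOn (hf.mono h2)).isClosed
    refine ⟨f '' Ico 0 t, f '' Ioc t L, ?_, ?_, ?_, ?_, ?_⟩
    · apply subset_antisymm
      · rw [← Icc_union_Icc_eq_Icc ht.1 ht.2, image_union, union_sdiff_distrib]
        exact union_subset_union e1 e2
      · rintro _ (⟨s, hs, rfl⟩ | ⟨s, hs, rfl⟩)
        · exact ⟨mem_image_of_mem _ (h1 (Ico_subset_Icc_self hs)), fun h =>
            hs.2.ne (hi (h1 (Ico_subset_Icc_self hs)) ht h)⟩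
        · exact ⟨mem_image_of_mem _ (h2 (Ioc_subset_Icc_self hs)), fun h =>
            hs.1.ne' (hi (h2 (Ioc_subset_Icc_self hs)) ht h)⟩
    · exact (sdiff_subset_sdiff_left
        (closure_minimal (image_mono Ico_subset_Icc_self) k1)).trans e1
    · exact (sdiff_subset_sdiff_left
        (closure_minimal (image_mono Ioc_subset_Icc_self) k2)).trans e2
    · exact fun y hy z hz => exists_isArc_of_image ordConnected_Ico
        (hf.mono (Ico_subset_Icc_self.trans h1)) (hi.mono (Ico_subset_Icc_self.trans h1)) hy hz
    · exact fun y hy z hz => exists_isArc_of_image ordConnected_Ioc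
        (hf.mono (Ioc_subset_Icc_self.trans h2)) (hi.mono (Ioc_subset_Icc_self.trans h2)) hy hz
  · refine ⟨A, ∅, by simp [hx], ?_, by simp, fun y hy z hz => h.exists_isArc_of_mem hy hz,
      by simp⟩
    rw [h.isCompact.isClosed.closure_eq]
    exact sdiff_subset

/-- Converts a connected set that avoids `x` into an arc that avoids `x`: cut each covering arc at
`x`, and the resulting pieces still satisfy `exists_isArc_of_finite_cover`. -/
theorem exists_isArc_diff_singleton [T2Space X] {M : Set X} {F : Set (Set X)} (hF : F.Finite)
    (harc : ∀ A ∈ F, ∃ u v : X, IsArc A u v) (hM : ⋃₀ F = M) (x : X)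
    {T : Set X} (hTM : T ⊆ M \ {x}) (hT : IsPreconnected T) {u v : X} (hu : u ∈ T) (hv : v ∈ T) :
    ∃ A ⊆ M \ {x}, IsArc A u v := by
  subst hM
  have key : ∀ A : F, ∃ C D : Set X, A.1 \ {x} = C ∪ D ∧ closure C \ {x} ⊆ C ∧
      closure D \ {x} ⊆ D ∧ (∀ y ∈ C, ∀ z ∈ C, ∃ A' ⊆ C, IsArc A' y z) ∧
      (∀ y ∈ D, ∀ z ∈ D, ∃ A' ⊆ D, IsArc A' y z) := by
    rintro ⟨A, hA⟩
    obtain ⟨a, b, h⟩ := harc A hA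
    exact h.exists_diff_eq_union x
  choose C D hCD hC hD hCa hDa using key
  have := hF.to_subtype
  refine exists_isArc_of_finite_cover (F := range C ∪ range D)
    ((finite_range C).union (finite_range D)) ?_ ?_ ?_ ?_ hTM hT hu hv
  · rintro y ⟨⟨A, hA, hyA⟩, hyx⟩
    have : y ∈ A \ {x} := ⟨hyA, hyx⟩
    rw [hCD ⟨A, hA⟩] at this
    rcases this with h | h
    · exact ⟨_, Or.inl ⟨_, rfl⟩, h⟩
    · exact ⟨_, Or.inr ⟨_, rfl⟩, h⟩
  · rintro _ (⟨A, rfl⟩ | ⟨A, rfl⟩)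
    · exact (subset_union_left.trans (hCD A).superset).trans
        (sdiff_subset_sdiff_left (subset_sUnion_of_mem A.2))
    · exact (subset_union_right.trans (hCD A).superset).trans
        (sdiff_subset_sdiff_left (subset_sUnion_of_mem A.2))
  · rintro _ (⟨A, rfl⟩ | ⟨A, rfl⟩)
    · exact fun y hy => hC A ⟨hy.1, hy.2.2⟩
    · exact fun y hy => hD A ⟨hy.1, hy.2.2⟩
  · rintro _ (⟨A, rfl⟩ | ⟨A, rfl⟩)
    · exact hCa A
    · exact hDa A

/-- An arc that leaves a closed connected set containing both its ends bypasses that set along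
an open subarc, no point of which disconnects the union. -/
theorem IsArc.exists_bypass [T2Space X] {A A' : Set X} {u v : X} (h : IsArc A u v)
    (hA' : IsClosed A') (hc : IsPreconnected A') (hu : u ∈ A') (hv : v ∈ A') (hne : ¬ A ⊆ A') :
    ∃ (f : ℝ → X) (s t : ℝ), s < t ∧ InjOn f (Icc s t) ∧ f '' Icc s t ⊆ A ∧
      ∀ r ∈ Ioo s t, IsPreconnected ((f '' Icc s t ∪ A') \ {f r}) := by
  obtain ⟨L, f, hL, hf, hi, rfl, rfl, rfl⟩ := h
  rw [image_subset_iff, not_subset] at hne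
  obtain ⟨m, hm, hmA⟩ := hne
  have hcomp : IsCompact (Icc 0 L ∩ f ⁻¹' A') :=
    isCompact_Icc.of_isClosed_subset (hf.preimage_isClosed_of_isClosed isClosed_Icc hA')
      inter_subset_left
  -- At time `m` the arc is off `A'`; `s` is the last time in `A'` before `m`, and `t` the first one
  -- after it.
  obtain ⟨s, ⟨⟨hs, hfs⟩, hsm⟩, hsmax⟩ := (hcomp.inter_right (isClosed_Iic (a := m))).exists_isGreatest
    ⟨0, ⟨⟨le_rfl, hL⟩, hu⟩, hm.1⟩
  obtain ⟨t, ⟨⟨ht, hft⟩, htm⟩, htmin⟩ := (hcomp.inter_right (isClosed_Ici (a := m))).exists_isLeast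
    ⟨L, ⟨⟨hL, le_rfl⟩, hv⟩, hm.2⟩
  have hsm' : s < m := lt_of_le_of_ne hsm fun h => hmA (h ▸ hfs)
  have htm' : m < t := lt_of_le_of_ne htm fun h => hmA (h ▸ hft)
  have hsub : Icc s t ⊆ Icc 0 L := Icc_subset_Icc hs.1 ht.2
  refine ⟨f, s, t, hsm'.trans htm', hi.mono hsub, image_mono hsub, fun r hr => ?_⟩
  have hrI := hsub (Ioo_subset_Icc_self hr)
  have hrA : f r ∉ A' := by
    intro hrA
    rcases le_total r m with h | h
    · exact absurd (hsmax ⟨⟨hrI, hrA⟩, h⟩) (not_le.2 hr.1)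
    · exact absurd (htmin ⟨⟨hrI, hrA⟩, h⟩) (not_le.2 hr.2)
  have heq : (f '' Icc s t ∪ A') \ {f r} = (f '' Ico s r ∪ A') ∪ f '' Ioc r t := by
    apply subset_antisymm
    · rintro y ⟨⟨q, hq, rfl⟩ | hy, hyr⟩
      · rcases lt_trichotomy q r with h | h | h
        · exact Or.inl (Or.inl ⟨q, ⟨hq.1, h⟩, rfl⟩)
        · exact absurd (by simp [h]) hyr
        · exact Or.inr ⟨q, ⟨h, hq.2⟩, rfl⟩
      · exact Or.inl (Or.inr hy)
    · rintro _ ((⟨q, hq, rfl⟩ | hy) | ⟨q, hq, rfl⟩)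
      · have hq' : q ∈ Icc s t := ⟨hq.1, hq.2.le.trans hr.2.le⟩
        exact ⟨Or.inl ⟨q, hq', rfl⟩, fun h => hq.2.ne (hi (hsub hq') hrI h)⟩
      · exact ⟨Or.inr hy, fun h => hrA (h ▸ hy)⟩
      · have hq' : q ∈ Icc s t := ⟨hr.1.le.trans hq.1.le, hq.2⟩
        exact ⟨Or.inl ⟨q, hq', rfl⟩, fun h => hq.1.ne' (hi (hsub hq') hrI h)⟩
  rw [heq]
  have p1 : IsPreconnected (f '' Ico s r) := isPreconnected_Ico.image _
    (hf.mono fun q hq => hsub ⟨hq.1, hq.2.le.trans hr.2.le⟩)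
  have p2 : IsPreconnected (f '' Ioc r t) := isPreconnected_Ioc.image _
    (hf.mono fun q hq => hsub ⟨hr.1.le.trans hq.1.le, hq.2⟩)
  exact IsPreconnected.union (f t) (Or.inr hft) ⟨t, ⟨hr.2, le_rfl⟩, rfl⟩
    (IsPreconnected.union (f s) ⟨s, ⟨le_rfl, hr.1⟩, rfl⟩ hfs p1 hc) p2

/-- A nonempty closed arc-convex subset of a tree is a tree. -/
theorem IsTree.of_arcConvex [T2Space X] {M N : Set X} (hM : IsTree M) (hNM : N ⊆ M)
    (hne : N.Nonempty) (hcl : IsClosed N)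
    (hconv : ∀ u ∈ N, ∀ v ∈ N, ∀ A ⊆ M, IsArc A u v → A ⊆ N) : IsTree N := by
  refine ⟨hne, ?_, ?_⟩
  · obtain ⟨F, hF, harc, hU⟩ := hM.finite_arcs
    refine ⟨(fun A => A ∩ N) '' {A ∈ F | (A ∩ N).Nonempty},
      (hF.subset (sep_subset _ _)).image _, ?_, ?_⟩
    · rintro _ ⟨A, ⟨hA, hAN⟩, rfl⟩
      obtain ⟨a, b, L, f, hL, hf, hi, h0, h1, rfl⟩ := harc A hA
      have hAM : f '' Icc 0 L ⊆ M := hU ▸ subset_sUnion_of_mem hA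
      have hcomp : IsCompact (Icc 0 L ∩ f ⁻¹' N) :=
        isCompact_Icc.of_isClosed_subset (hf.preimage_isClosed_of_isClosed isClosed_Icc hcl)
          inter_subset_left
      have hne' : (Icc 0 L ∩ f ⁻¹' N).Nonempty := by
        obtain ⟨_, ⟨t, ht, rfl⟩, h⟩ := hAN
        exact ⟨t, ht, h⟩
      -- Arc-convexity makes the intersection with `N` exactly the subarc between the first and the
      -- last time in `N`.
      obtain ⟨s, ⟨hs, hfs⟩, hsl⟩ := hcomp.exists_isLeast hne'
      obtain ⟨t, ⟨ht, hft⟩, htg⟩ := hcomp.exists_isGreatest hne'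
      have hst : s ≤ t := hsl ⟨ht, hft⟩
      have hsub : Icc s t ⊆ Icc 0 L := Icc_subset_Icc hs.1 ht.2
      have harc' := isArc_image_Icc hst (hf.mono hsub) (hi.mono hsub)
      have : f '' Icc 0 L ∩ N = f '' Icc s t := by
        apply subset_antisymm
        · rintro _ ⟨⟨q, hq, rfl⟩, hqN⟩
          exact ⟨q, ⟨hsl ⟨hq, hqN⟩, htg ⟨hq, hqN⟩⟩, rfl⟩
        · exact subset_inter (image_mono hsub)
            (hconv _ hfs _ hft _ ((image_mono hsub).trans hAM) harc')
      exact ⟨f s, f t, by simpa only [this] using harc'⟩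
    · apply subset_antisymm
      · rintro y ⟨_, ⟨A, -, rfl⟩, hy⟩
        exact hy.2
      · intro y hy
        obtain ⟨A, hA, hyA⟩ : y ∈ ⋃₀ F := hU ▸ hNM hy
        exact ⟨A ∩ N, ⟨A, ⟨hA, y, hyA, hy⟩, rfl⟩, hyA, hy⟩
  · intro u hu v hv
    obtain ⟨A, ⟨hA, hAa⟩, huniq⟩ := hM.unique_arc u (hNM hu) v (hNM hv)
    exact ⟨A, ⟨hconv u hu v hv A hA hAa, hAa⟩, fun A' h => huniq A' ⟨h.1.trans hNM, h.2⟩⟩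

theorem IsTree.isConnected {N : Set X} (hN : IsTree N) : IsConnected N := by
  refine ⟨hN.nonempty, isPreconnected_of_forall_pair fun x hx y hy => ?_⟩
  obtain ⟨A, ⟨hA, h⟩, -⟩ := hN.unique_arc x hx y hy
  exact ⟨A, hA, h.left_mem, h.right_mem, h.isPreconnected⟩

end Arcs

/-! ### Winding numbers of closed polylines -/

section Winding

/-- The identification of the plane with the complex numbers. -/
noncomputable def toComplex : Plane →L[ℝ] ℂ :=
  ((EuclideanSpace.proj (𝕜 := ℝ) (0 : Fin 2)).smulRight (1 : ℂ)) +
    ((EuclideanSpace.proj (𝕜 := ℝ) (1 : Fin 2)).smulRight Complex.I)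

@[simp] theorem toComplex_re (z : Plane) : (toComplex z).re = z 0 := by simp [toComplex]

@[simp] theorem toComplex_im (z : Plane) : (toComplex z).im = z 1 := by simp [toComplex]

theorem toComplex_injective : Function.Injective toComplex := by
  intro x y h
  ext i
  have h0 := congrArg Complex.re h
  have h1 := congrArg Complex.im h
  rw [toComplex_re, toComplex_re] at h0
  rw [toComplex_im, toComplex_im] at h1
  fin_cases i
  · exact h0
  · exact h1

/-- Rotation of the plane by a right angle, counterclockwise. -/
noncomputable def rot (u : Plane) : Plane := !₂[-u 1, u 0]

@[simp] theorem rot_zero_coord (u : Plane) : rot u 0 = -u 1 := rfl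

@[simp] theorem rot_one_coord (u : Plane) : rot u 1 = u 0 := rfl

theorem inner_coord (x y : Plane) : inner ℝ x y = x 0 * y 0 + x 1 * y 1 := by
  simp [PiLp.inner_apply, Fin.sum_univ_two, mul_comm]

theorem toComplex_rot (u : Plane) : toComplex (rot u) = Complex.I * toComplex u := by
  apply Complex.ext <;> simp

/-- The angle, in `(-π, π]`, under which the directed segment from `x` to `y` is seen from `z`. -/
noncomputable def viewAngle (x y z : Plane) : ℝ :=
  Complex.arg (toComplex (y - z) / toComplex (x - z))

/-- A ratio on the nonpositive real axis would put `z` between `x` and `y`. Off the segment the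
viewing angle therefore avoids the branch cut of `arg`. -/
theorem div_mem_slitPlane {x y z : Plane} (hz : z ∉ segment ℝ x y) :
    toComplex (y - z) / toComplex (x - z) ∈ Complex.slitPlane := by
  have ha : toComplex (x - z) ≠ 0 := by
    intro h
    have : x - z = 0 := toComplex_injective (by simpa using h)
    exact hz (by rw [← sub_eq_zero.1 this]; exact left_mem_segment ℝ x y)
  by_contra hcon
  rw [Complex.mem_slitPlane_iff] at hcon
  push Not at hcon
  set w := toComplex (y - z) / toComplex (x - z) with hw
  have hb : y - z = w.re • (x - z) := by
    apply toComplex_injective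
    have h1 : toComplex (y - z) = w * toComplex (x - z) := by rw [hw, div_mul_cancel₀ _ ha]
    have h2 : w = (w.re : ℂ) := Complex.ext rfl (by simpa using hcon.2)
    rw [h1, h2, map_smul]
    simp
  have hpos : 0 < 1 - w.re := by linarith [hcon.1]
  refine hz ⟨(-w.re) / (1 - w.re), 1 / (1 - w.re), div_nonneg (by linarith [hcon.1]) hpos.le,
    by positivity, ?_, ?_⟩
  · field_simp; ring
  · have : y = z + w.re • (x - z) := by rw [← hb]; abel
    rw [this]
    ext i
    simp
    field_simp
    ring

theorem continuousAt_viewAngle {x y z : Plane} (hz : z ∉ segment ℝ x y) :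
    ContinuousAt (viewAngle x y) z := by
  have ha : toComplex (x - z) ≠ 0 := by
    intro h
    have : x - z = 0 := toComplex_injective (by simpa using h)
    exact hz (by rw [← sub_eq_zero.1 this]; exact left_mem_segment ℝ x y)
  unfold viewAngle
  refine ContinuousAt.comp (f := fun z => toComplex (y - z) / toComplex (x - z))
    (Complex.continuousAt_arg (div_mem_slitPlane hz)) ?_
  exact ContinuousAt.div (by fun_prop) (by fun_prop) ha

/-- The total angle swept by a closed polyline, seen from a point. -/
noncomputable def totalAngle (N : ℕ) (q : ℕ → Plane) (z : Plane) : ℝ :=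
  ∑ k ∈ Finset.range N, viewAngle (q k) (q (k + 1)) z

/-- The ratios of consecutive vertex positions telescope to 1 around a closed polyline, so exp(i ·
total angle) = 1. -/
theorem exists_totalAngle_eq {N : ℕ} {q : ℕ → Plane} (hq : q N = q 0) {z : Plane}
    (hz : ∀ k < N, z ∉ segment ℝ (q k) (q (k + 1))) :
    ∃ m : ℤ, totalAngle N q z = m * (2 * Real.pi) := by
  rcases Nat.eq_zero_or_pos N with rfl | hN
  · exact ⟨0, by simp [totalAngle]⟩
  have hne : ∀ k ≤ N, toComplex (q k - z) ≠ 0 := by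
    have : ∀ k < N, toComplex (q k - z) ≠ 0 := by
      intro k hk h
      have : q k - z = 0 := toComplex_injective (by simpa using h)
      exact hz k hk (by rw [← sub_eq_zero.1 this]; exact left_mem_segment ℝ _ _)
    intro k hk
    rcases hk.lt_or_eq with h | rfl
    · exact this k h
    · rw [hq]; exact this 0 hN
  -- The telescoped product for the first `M` edges, with the denominators cleared.
  have hexp : ∀ M ≤ N, (‖toComplex (q M - z)‖ : ℂ) *
      Complex.exp ((totalAngle M q z : ℝ) * Complex.I) * toComplex (q 0 - z) =
        ‖toComplex (q 0 - z)‖ * toComplex (q M - z) := by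
    intro M
    induction M with
    | zero => intro _; simp [totalAngle]
    | succ M ih =>
      intro hM
      have ih := ih (by omega)
      have h1 := hne M (by omega)
      have h2 := Complex.norm_mul_exp_arg_mul_I (toComplex (q (M + 1) - z) / toComplex (q M - z))
      rw [totalAngle, Finset.sum_range_succ, ← totalAngle, Complex.ofReal_add, add_mul,
        Complex.exp_add]
      unfold viewAngle
      have h3 : (‖toComplex (q M - z)‖ : ℂ) ≠ 0 := by simpa using h1
      rw [norm_div, Complex.ofReal_div] at h2
      field_simp at h2
      have h4 : toComplex (q M - z) * (‖toComplex (q M - z)‖ : ℂ) ≠ 0 := mul_ne_zero h1 h3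
      apply mul_left_cancel₀ h4
      linear_combination (‖toComplex (q M - z)‖ : ℂ) *
        Complex.exp ((totalAngle M q z : ℝ) * Complex.I) * toComplex (q 0 - z) * h2 +
        toComplex (q (M + 1) - z) * ‖toComplex (q M - z)‖ * ih
  have h := hexp N le_rfl
  rw [hq] at h
  have h0 := hne 0 (Nat.zero_le _)
  have h3 : (‖toComplex (q 0 - z)‖ : ℂ) ≠ 0 := by simpa using h0
  have h1 : Complex.exp ((totalAngle N q z : ℝ) * Complex.I) = 1 := by
    apply mul_left_cancel₀ (mul_ne_zero h3 h0)
    linear_combination h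
  obtain ⟨m, hm⟩ := Complex.exp_eq_one_iff.1 h1
  refine ⟨m, ?_⟩
  have : ((totalAngle N q z : ℝ) : ℂ) = ((m * (2 * Real.pi) : ℝ) : ℂ) := by
    apply mul_right_cancel₀ Complex.I_ne_zero
    rw [hm]; push_cast; ring
  exact_mod_cast this

/-- A continuous function on a connected set with values in 2πℤ is constant: two different values
would force an intermediate value of the form (m + 1/2) · 2π. -/
theorem totalAngle_eq_of_isPreconnected {N : ℕ} {q : ℕ → Plane} (hq : q N = q 0)
    {T : Set Plane} (hT : IsPreconnected T)
    (hTq : ∀ z ∈ T, ∀ k < N, z ∉ segment ℝ (q k) (q (k + 1))) {z z' : Plane} (hz : z ∈ T)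
    (hz' : z' ∈ T) : totalAngle N q z = totalAngle N q z' := by
  have hcont : ContinuousOn (totalAngle N q) T := by
    intro y hy
    apply ContinuousAt.continuousWithinAt
    unfold totalAngle
    exact tendsto_finsetSum _ fun k hk =>
      continuousAt_viewAngle (hTq y hy k (Finset.mem_range.1 hk))
  by_contra hne
  wlog hlt : totalAngle N q z < totalAngle N q z' generalizing z z'
  · exact this hz' hz (Ne.symm hne) (lt_of_le_of_ne (not_lt.1 hlt) (Ne.symm hne))
  obtain ⟨m, hm⟩ := exists_totalAngle_eq hq (hTq z hz)
  obtain ⟨m', hm'⟩ := exists_totalAngle_eq hq (hTq z' hz')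
  have hmm : m < m' := by
    rw [hm, hm'] at hlt
    exact_mod_cast lt_of_mul_lt_mul_right hlt (by positivity)
  have hle : (m : ℝ) + 1 ≤ m' := by exact_mod_cast hmm
  have hpi := Real.pi_pos
  obtain ⟨y, hy, hyv⟩ := hT.intermediate_value hz hz' hcont
    (show (m + 1 / 2 : ℝ) * (2 * Real.pi) ∈ Icc _ _ by
      rw [hm, hm']; constructor <;> nlinarith)
  obtain ⟨l, hl⟩ := exists_totalAngle_eq hq (hTq y hy)
  rw [hl] at hyv
  have : (l : ℝ) = m + 1 / 2 := mul_right_cancel₀ (by positivity) hyv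
  have h2 : ((2 * l : ℤ) : ℝ) = ((2 * m + 1 : ℤ) : ℝ) := by push_cast; linarith
  have : 2 * l = 2 * m + 1 := by exact_mod_cast h2
  omega

/-- With m = (1 - b)x + by, the ratio seen from m + τ · `rot (y - x)` is (1 - b - iτ)/(-b - iτ). It
tends to a negative real number, and its imaginary part has the sign of τ, so `arg` tends to π from
one side and to -π from the other. -/
theorem tendsto_viewAngle_sides {x y m : Plane} (hxy : x ≠ y) (hm : m ∈ openSegment ℝ x y) :
    Tendsto (fun τ : ℝ => viewAngle x y (m + τ • rot (y - x))) (𝓝[>] 0) (𝓝 Real.pi) ∧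
    Tendsto (fun τ : ℝ => viewAngle x y (m - τ • rot (y - x))) (𝓝[>] 0) (𝓝 (-Real.pi)) := by
  obtain ⟨a, b, ha, hb, hab, rfl⟩ := hm
  obtain rfl : a = 1 - b := by linarith
  have he : toComplex (y - x) ≠ 0 := by
    intro h
    have : y - x = 0 := toComplex_injective (by simpa using h)
    exact hxy (sub_eq_zero.1 this).symm
  have hform : ∀ τ : ℝ, toComplex (y - ((1 - b) • x + b • y + τ • rot (y - x))) /
      toComplex (x - ((1 - b) • x + b • y + τ • rot (y - x))) =
      ((1 - b : ℝ) - τ * Complex.I) / (-(b : ℝ) - τ * Complex.I) := by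
    intro τ
    have h1 : toComplex (y - ((1 - b) • x + b • y + τ • rot (y - x))) =
      ((1 - b : ℝ) - τ * Complex.I) * toComplex (y - x) := by
      simp only [map_sub, map_add, map_smul, toComplex_rot, Complex.real_smul]
      push_cast; ring
    have h2 : toComplex (x - ((1 - b) • x + b • y + τ • rot (y - x))) =
      (-(b : ℝ) - τ * Complex.I) * toComplex (y - x) := by
      simp only [map_sub, map_add, map_smul, toComplex_rot, Complex.real_smul]
      push_cast; ring
    rw [h1, h2, mul_div_mul_right _ _ he]
  have hden : ∀ τ : ℝ, (-(b : ℝ) - τ * Complex.I : ℂ) ≠ 0 := by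
    intro τ h
    have := congrArg Complex.re h
    simp at this
    exact hb.ne' this
  have hre : ∀ τ : ℝ, (((1 - b : ℝ) - τ * Complex.I) / (-(b : ℝ) - τ * Complex.I) : ℂ).im =
      τ / (b ^ 2 + τ ^ 2) := by
    intro τ
    rw [Complex.div_im]
    have : Complex.normSq (-(b : ℝ) - τ * Complex.I) = b ^ 2 + τ ^ 2 := by
      rw [Complex.normSq_apply]; simp; ring
    rw [this]
    simp
    field_simp
    ring
  have hcont : Tendsto (fun τ : ℝ => (((1 - b : ℝ) - τ * Complex.I) / (-(b : ℝ) - τ * Complex.I) : ℂ))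
      (𝓝 0) (𝓝 ((-((1 - b) / b) : ℝ) : ℂ)) := by
    have : ContinuousAt (fun τ : ℝ =>
        (((1 - b : ℝ) - τ * Complex.I) / (-(b : ℝ) - τ * Complex.I) : ℂ)) 0 :=
      ContinuousAt.div (by fun_prop) (by fun_prop) (hden 0)
    convert this.tendsto using 2
    push_cast
    simp [div_neg]
  have hneg : ((-((1 - b) / b) : ℝ) : ℂ).re < 0 := by
    simp only [Complex.ofReal_re, neg_lt_zero]
    positivity
  constructor
  · simp only [viewAngle, hform]
    refine (Complex.tendsto_arg_nhdsWithin_im_nonneg_of_re_neg_of_im_zero hneg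
      (Complex.ofReal_im _)).comp (tendsto_nhdsWithin_iff.2 ⟨hcont.mono_left nhdsWithin_le_nhds, ?_⟩)
    filter_upwards [self_mem_nhdsWithin] with τ hτ
    have : (0 : ℝ) < τ := hτ
    change 0 ≤ Complex.im _
    rw [hre]
    positivity
  · have hform' : ∀ τ : ℝ, viewAngle x y ((1 - b) • x + b • y - τ • rot (y - x)) =
      Complex.arg (((1 - b : ℝ) - (-τ : ℝ) * Complex.I) / (-(b : ℝ) - (-τ : ℝ) * Complex.I)) := by
      intro τ
      rw [← hform, viewAngle, neg_smul, sub_eq_add_neg _ (τ • rot (y - x))]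
    simp only [hform']
    have hn : Tendsto (fun τ : ℝ => -τ) (𝓝[>] 0) (𝓝 0) := by
      have : Tendsto (fun τ : ℝ => -τ) (𝓝 0) (𝓝 (-0)) := continuous_neg.tendsto 0
      rw [neg_zero] at this
      exact this.mono_left nhdsWithin_le_nhds
    refine (Complex.tendsto_arg_nhdsWithin_im_neg_of_re_neg_of_im_zero hneg
      (Complex.ofReal_im _)).comp (tendsto_nhdsWithin_iff.2 ⟨hcont.comp hn, ?_⟩)
    filter_upwards [self_mem_nhdsWithin] with τ hτ
    have : (0 : ℝ) < τ := hτ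
    change Complex.im _ < 0
    rw [hre]
    apply div_neg_of_neg_of_pos <;> [linarith; positivity]

/-- The two sides of an edge of a closed polyline, near a point of the edge that lies on no other
edge, are not connected in the complement of the polyline. -/
theorem eventually_not_isPreconnected {N : ℕ} {q : ℕ → Plane} (hq : q N = q 0) {k : ℕ}
    (hk : k < N) (hne : q k ≠ q (k + 1)) {m : Plane} (hm : m ∈ openSegment ℝ (q k) (q (k + 1)))
    (hother : ∀ j < N, j ≠ k → m ∉ segment ℝ (q j) (q (j + 1))) :
    ∀ᶠ τ : ℝ in 𝓝[>] 0, ∀ T : Set Plane, IsPreconnected T →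
      (∀ z ∈ T, ∀ j < N, z ∉ segment ℝ (q j) (q (j + 1))) →
      m + τ • rot (q (k + 1) - q k) ∈ T → m - τ • rot (q (k + 1) - q k) ∉ T := by
  obtain ⟨h1, h2⟩ := tendsto_viewAngle_sides hne hm
  set e := rot (q (k + 1) - q k)
  have hc1 : Tendsto (fun τ : ℝ => m + τ • e) (𝓝[>] 0) (𝓝 m) := by
    have : Tendsto (fun τ : ℝ => m + τ • e) (𝓝 0) (𝓝 (m + (0 : ℝ) • e)) :=
      Continuous.tendsto (by fun_prop) 0
    simpa using this.mono_left nhdsWithin_le_nhds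
  have hc2 : Tendsto (fun τ : ℝ => m - τ • e) (𝓝[>] 0) (𝓝 m) := by
    have : Tendsto (fun τ : ℝ => m - τ • e) (𝓝 0) (𝓝 (m - (0 : ℝ) • e)) :=
      Continuous.tendsto (by fun_prop) 0
    simpa using this.mono_left nhdsWithin_le_nhds
  have hrest : ∀ j ∈ (Finset.range N).erase k,
      ContinuousAt (viewAngle (q j) (q (j + 1))) m := fun j hj =>
    continuousAt_viewAngle (hother j (Finset.mem_range.1 (Finset.mem_of_mem_erase hj))
      (Finset.ne_of_mem_erase hj))
  have hsplit : ∀ z, totalAngle N q z = viewAngle (q k) (q (k + 1)) z +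
      ∑ j ∈ (Finset.range N).erase k, viewAngle (q j) (q (j + 1)) z := fun z =>
    (Finset.add_sum_erase _ _ (Finset.mem_range.2 hk)).symm
  -- Only edge `k` jumps, by 2π; the other edges contribute angles continuous at `m`, which cancel
  -- in the limit.
  have hlim : Tendsto (fun τ : ℝ => totalAngle N q (m + τ • e) - totalAngle N q (m - τ • e))
      (𝓝[>] 0) (𝓝 (2 * Real.pi)) := by
    simp only [hsplit]
    have r1 := tendsto_finsetSum _ fun j hj => (hrest j hj).tendsto.comp hc1
    have r2 := tendsto_finsetSum _ fun j hj => (hrest j hj).tendsto.comp hc2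
    have h := (h1.add r1).sub (h2.add r2)
    rwa [add_sub_add_right_eq_sub, sub_neg_eq_add, ← two_mul] at h
  filter_upwards [hlim.eventually (lt_mem_nhds (show (0 : ℝ) < 2 * Real.pi by positivity))]
    with τ hτ T hT hTq hz hz'
  rw [totalAngle_eq_of_isPreconnected hq hT hTq hz hz', sub_self] at hτ
  exact lt_irrefl _ hτ

end Winding

/-! ### Local shape of the domain, and maximal disks through the distance function -/

section Domain

/-- Near `p`, the open set `Ω` with boundary `B` is the wedge cut out by both of the half-planes
with inward normals `a` and `b`. -/
def ConvexAt (Ω B : Set Plane) (p a b : Plane) : Prop :=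
  ∃ ε > 0, ∀ x ∈ ball p ε, (x ∈ Ω ↔ 0 < ⟪a, x - p⟫ ∧ 0 < ⟪b, x - p⟫) ∧
    (x ∈ Ω ∪ B ↔ 0 ≤ ⟪a, x - p⟫ ∧ 0 ≤ ⟪b, x - p⟫)

/-- Near `p`, the open set `Ω` with boundary `B` is the union of the half-planes with inward
normals `a` and `b`. -/
def ReflexAt (Ω B : Set Plane) (p a b : Plane) : Prop :=
  ∃ ε > 0, ∀ x ∈ ball p ε, (x ∈ Ω ↔ 0 < ⟪a, x - p⟫ ∨ 0 < ⟪b, x - p⟫) ∧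
    (x ∈ Ω ∪ B ↔ 0 ≤ ⟪a, x - p⟫ ∨ 0 ≤ ⟪b, x - p⟫)

/-- `Ω` is the interior of a simple polygon with vertices `v i` and boundary `B`, whose edge from
`v i` to the next vertex has the inward unit normal `ν i`. -/
structure IsPolygonInterior {n : ℕ} (Ω B : Set Plane) (v ν : Fin n → Plane) : Prop where
  isOpen : IsOpen Ω
  nonempty : Ω.Nonempty
  isPreconnected : IsPreconnected Ω
  disjoint : Disjoint Ω B
  isCompact : IsCompact (Ω ∪ B)
  boundary_eq : B = ⋃ i, segment ℝ (v i) (v (finRotate n i))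
  boundary_nonempty : B.Nonempty
  norm_normal : ∀ i, ‖ν i‖ = 1
  vertex_ne : ∀ i, v i ≠ v (finRotate n i)
  edge : ∀ i, ∀ p ∈ openSegment ℝ (v i) (v (finRotate n i)), ReflexAt Ω B p (ν i) (ν i)
  normal_add : ∀ i, ν i + ν (finRotate n i) ≠ 0
  -- A straight vertex falls under the second alternative, with equal normals.
  vertex : ∀ i, (ν i ≠ ν (finRotate n i) ∧
      ConvexAt Ω B (v (finRotate n i)) (ν i) (ν (finRotate n i))) ∨
    ReflexAt Ω B (v (finRotate n i)) (ν i) (ν (finRotate n i))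
  -- This plays the part of simple connectivity: it is what rules out cycles in the axis.
  crosscut : ∀ c ∈ Ω, ∀ p ∈ B, ∀ p' ∈ B, openSegment ℝ c p ⊆ Ω → openSegment ℝ c p' ⊆ Ω →
    Disjoint (openSegment ℝ c p) (openSegment ℝ c p') →
    ¬ IsPreconnected (Ω \ (segment ℝ c p ∪ segment ℝ c p'))

/-- Unit vectors that are not opposite have inner product greater than -1. At a boundary point with
normals `a` and `b`, the direction `a + b` then leads into the domain and its negative leads out. -/
theorem inner_add_pos {a b : Plane} (ha : ‖a‖ = 1) (hb : ‖b‖ = 1) (hab : a + b ≠ 0) :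
    0 < ⟪a, a + b⟫ ∧ 0 < ⟪b, a + b⟫ := by
  have h : 0 < ‖a + b‖ ^ 2 := by positivity
  rw [norm_add_sq_real, ha, hb] at h
  rw [inner_add_right, inner_add_right, real_inner_self_eq_norm_sq, real_inner_self_eq_norm_sq,
    ha, hb, real_inner_comm a b]
  constructor <;> linarith

theorem tendsto_add_smul (p w : Plane) : Tendsto (fun t : ℝ => p + t • w) (𝓝[>] 0) (𝓝 p) := by
  have : Tendsto (fun t : ℝ => p + t • w) (𝓝 0) (𝓝 (p + (0 : ℝ) • w)) :=
    Continuous.tendsto (by fun_prop) 0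
  simpa using this.mono_left nhdsWithin_le_nhds

namespace IsPolygonInterior

variable {n : ℕ} {Ω B : Set Plane} {v ν : Fin n → Plane}

theorem shape (D : IsPolygonInterior Ω B v ν) {p : Plane} (hp : p ∈ B) :
    ∃ a b, ‖a‖ = 1 ∧ ‖b‖ = 1 ∧ a + b ≠ 0 ∧ (a ≠ b ∧ ConvexAt Ω B p a b ∨ ReflexAt Ω B p a b) := by
  rw [D.boundary_eq, mem_iUnion] at hp
  obtain ⟨i, hi⟩ := hp
  have hv : ∀ j, ∃ a b, ‖a‖ = 1 ∧ ‖b‖ = 1 ∧ a + b ≠ 0 ∧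
      (a ≠ b ∧ ConvexAt Ω B (v (finRotate n j)) a b ∨ ReflexAt Ω B (v (finRotate n j)) a b) :=
    fun j => ⟨_, _, D.norm_normal _, D.norm_normal _, D.normal_add j, D.vertex j⟩
  rw [← insert_endpoints_openSegment] at hi
  rcases hi with rfl | rfl | hi
  · have h := hv ((finRotate n).symm i)
    rwa [Equiv.apply_symm_apply] at h
  · exact hv i
  · refine ⟨ν i, ν i, D.norm_normal i, D.norm_normal i, ?_, Or.inr (D.edge i p hi)⟩
    intro h
    have h2 : (2 : ℝ) • ν i = 0 := by rw [two_smul]; exact h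
    have := D.norm_normal i
    simp_all

theorem isCompact_boundary (D : IsPolygonInterior Ω B v ν) : IsCompact B := by
  rw [D.boundary_eq]
  refine isCompact_iUnion fun i => ?_
  rw [segment_eq_image_lineMap]
  exact isCompact_Icc.image (by fun_prop)

/-- Off `B` the plane is the union of two disjoint open sets, `Ω` and the complement of `Ω ∪ B`. -/
theorem subset_of_isPreconnected (D : IsPolygonInterior Ω B v ν) {T : Set Plane}
    (hT : IsPreconnected T) (hTB : Disjoint T B) (hne : (T ∩ Ω).Nonempty) : T ⊆ Ω := by
  have := hT.subset_left_of_subset_union D.isOpen D.isCompact.isClosed.isOpen_compl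
    (disjoint_compl_right.mono_left subset_union_left) (fun x hx => ?_) hne
  · exact this
  · by_cases h : x ∈ Ω
    · exact Or.inl h
    · exact Or.inr fun h' => h'.elim h (disjoint_left.1 hTB hx)

theorem infDist_pos (D : IsPolygonInterior Ω B v ν) {x : Plane} (hx : x ∈ Ω) :
    0 < infDist x B :=
  (D.isCompact_boundary.isClosed.notMem_iff_infDist_pos D.boundary_nonempty).1
    (disjoint_left.1 D.disjoint hx)

theorem mem_of_infDist_pos {x : Plane} (hx : x ∈ Ω ∪ B)
    (h : 0 < infDist x B) : x ∈ Ω :=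
  hx.resolve_right fun hB => h.ne' (infDist_zero_of_mem hB)

theorem exists_nearest (D : IsPolygonInterior Ω B v ν) (x : Plane) :
    ∃ p ∈ B, dist x p = infDist x B := by
  obtain ⟨p, hp, h⟩ := D.isCompact_boundary.exists_infDist_eq_dist D.boundary_nonempty x
  exact ⟨p, hp, h.symm⟩

theorem ball_subset (D : IsPolygonInterior Ω B v ν) {x : Plane} (hx : x ∈ Ω) :
    ball x (infDist x B) ⊆ Ω :=
  D.subset_of_isPreconnected (convex_ball x _).isPreconnected disjoint_ball_infDist
    ⟨x, mem_ball_self (D.infDist_pos hx), hx⟩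

theorem eventually_mem_and_notMem (D : IsPolygonInterior Ω B v ν) {p : Plane} (hp : p ∈ B) :
    ∃ w, ∀ᶠ t : ℝ in 𝓝[>] 0, p + t • w ∈ Ω ∧ p - t • w ∉ Ω ∪ B := by
  obtain ⟨a, b, ha, hb, hab, h⟩ := D.shape hp
  obtain ⟨h1, h2⟩ := inner_add_pos ha hb hab
  refine ⟨a + b, ?_⟩
  have e2 : Tendsto (fun t : ℝ => p - t • (a + b)) (𝓝[>] 0) (𝓝 p) := by
    simpa only [smul_neg, ← sub_eq_add_neg] using tendsto_add_smul p (-(a + b))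
  have key : ∀ ε > 0, ∀ᶠ t : ℝ in 𝓝[>] 0, 0 < t ∧ p + t • (a + b) ∈ ball p ε ∧
      p - t • (a + b) ∈ ball p ε := fun ε hε =>
    (eventually_mem_nhdsWithin).and (((tendsto_add_smul p (a + b)).eventually
      (ball_mem_nhds p hε)).and (e2.eventually (ball_mem_nhds p hε)))
  rcases h with ⟨-, ε, hε, h⟩ | ⟨ε, hε, h⟩
  · filter_upwards [key ε hε] with t ⟨ht, h3, h4⟩
    rw [(h _ h3).1, (h _ h4).2]
    have := mul_pos ht h1
    have := mul_pos ht h2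
    simp only [add_sub_cancel_left, sub_sub_cancel_left, inner_neg_right, inner_smul_right]
    refine ⟨⟨by positivity, by positivity⟩, fun h => ?_⟩
    linarith [h.1]
  · filter_upwards [key ε hε] with t ⟨ht, h3, h4⟩
    rw [(h _ h3).1, (h _ h4).2]
    have := mul_pos ht h1
    have := mul_pos ht h2
    simp only [add_sub_cancel_left, sub_sub_cancel_left, inner_neg_right, inner_smul_right]
    refine ⟨Or.inl (by positivity), fun h => ?_⟩
    rcases h with h | h <;> linarith

theorem boundary_subset_closure (D : IsPolygonInterior Ω B v ν) : B ⊆ closure Ω := by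
  intro p hp
  obtain ⟨w, hw⟩ := D.eventually_mem_and_notMem hp
  exact mem_closure_of_tendsto (tendsto_add_smul p w) (hw.mono fun t h => h.1)

theorem boundary_subset_closure_compl (D : IsPolygonInterior Ω B v ν) :
    B ⊆ closure (Ω ∪ B)ᶜ := by
  intro p hp
  obtain ⟨w, hw⟩ := D.eventually_mem_and_notMem hp
  have : Tendsto (fun t : ℝ => p - t • w) (𝓝[>] 0) (𝓝 p) := by
    simpa only [smul_neg, ← sub_eq_add_neg] using tendsto_add_smul p (-w)
  exact mem_closure_of_tendsto this (hw.mono fun t h => h.2)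

/-- A radius exceeding the distance to `B` puts a boundary point into the open disk, and exterior
points accumulate at every boundary point. -/
theorem closedBall_subset_iff (D : IsPolygonInterior Ω B v ν) {y : Plane} {s : ℝ} (hs : 0 ≤ s) :
    closedBall y s ⊆ Ω ∪ B ↔ y ∈ Ω ∪ B ∧ s ≤ infDist y B := by
  constructor
  · intro h
    refine ⟨h (mem_closedBall_self hs), ?_⟩
    by_contra! hlt
    obtain ⟨p, hp, hd⟩ := (infDist_lt_iff D.boundary_nonempty).1 hlt
    obtain ⟨z, hz, hzK⟩ := mem_closure_iff_nhds.1 (D.boundary_subset_closure_compl hp) (ball y s)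
      (isOpen_ball.mem_nhds (by rwa [mem_ball']))
    exact hzK (h (ball_subset_closedBall hz))
  · rintro ⟨hy, hsd⟩
    rcases hy with hy | hy
    · have hpos := D.infDist_pos hy
      refine (closedBall_subset_closedBall hsd).trans ?_
      rw [← closure_ball y hpos.ne']
      exact closure_minimal ((D.ball_subset hy).trans subset_union_left) D.isCompact.isClosed
    · rw [infDist_zero_of_mem hy] at hsd
      obtain rfl : s = 0 := le_antisymm hsd hs
      simpa using Or.inr hy

end IsPolygonInterior

/-- Test the inclusion on the point of the smaller disk farthest from `y`; for equal centres any
direction will do. -/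
theorem dist_add_le_of_closedBall_subset {x y : Plane} {r s : ℝ} (hr : 0 ≤ r)
    (h : closedBall x r ⊆ closedBall y s) : dist x y + r ≤ s := by
  rcases eq_or_ne x y with rfl | hxy
  · have : x + EuclideanSpace.single (0 : Fin 2) r ∈ closedBall x s :=
      h (by simp [abs_of_nonneg hr])
    rw [mem_closedBall, dist_self_add_left, PiLp.norm_single, Real.norm_eq_abs,
      abs_of_nonneg hr] at this
    simpa
  · have hpos : 0 < ‖x - y‖ := norm_pos_iff.2 (sub_ne_zero.2 hxy)
    have hmem : x + (r / ‖x - y‖) • (x - y) ∈ closedBall y s := by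
      apply h
      rw [mem_closedBall, dist_self_add_left, norm_smul, Real.norm_eq_abs, abs_of_nonneg
        (by positivity), div_mul_cancel₀ _ hpos.ne']
    rw [mem_closedBall, dist_eq_norm] at hmem
    have e : x + (r / ‖x - y‖) • (x - y) - y = (1 + r / ‖x - y‖) • (x - y) := by
      rw [add_smul, one_smul]; abel
    rw [e, norm_smul, Real.norm_eq_abs, abs_of_nonneg (by positivity), add_mul, one_mul,
      div_mul_cancel₀ _ hpos.ne'] at hmem
    rwa [dist_eq_norm]

theorem closedBall_subset_closedBall_iff {x y : Plane} {r s : ℝ} (hr : 0 ≤ r) :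
    closedBall x r ⊆ closedBall y s ↔ dist x y + r ≤ s :=
  ⟨dist_add_le_of_closedBall_subset hr, fun h => closedBall_subset_closedBall' (by linarith)⟩

/-- The centres of the maximal disks in `Ω ∪ B`, described by the distance to `B`. -/
def axis (Ω B : Set Plane) : Set Plane :=
  {x ∈ Ω ∪ B | ∀ y ∈ Ω ∪ B, dist x y + infDist x B ≤ infDist y B → y = x}

theorem eq_add_smul_of_dist_add_dist {y z p : Plane} (h : dist y z + dist z p = dist y p)
    (hz : z ≠ p) : y = p + (dist y p / dist z p) • (z - p) := by
  rw [dist_add_dist_eq_iff] at h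
  obtain ⟨t, ⟨ht0, ht1⟩, rfl⟩ := h
  rw [AffineMap.lineMap_apply_module'] at *
  have e : t • (p - y) + y - p = (1 - t) • (y - p) := by module
  have ht : t ≠ 1 := by rintro rfl; simp at hz
  have hpos : 0 < 1 - t := sub_pos.2 (lt_of_le_of_ne ht1 ht)
  have hyp : y - p ≠ 0 := by
    intro h0
    apply hz
    rw [← sub_eq_zero, e, h0, smul_zero]
  have hn := norm_pos_iff.2 hyp
  rw [dist_eq_norm y p, dist_eq_norm _ p, e, norm_smul, Real.norm_eq_abs, abs_of_pos hpos,
    smul_smul]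
  have : ‖y - p‖ / ((1 - t) * ‖y - p‖) * (1 - t) = 1 := by field_simp
  rw [this, one_smul]
  abel

namespace IsPolygonInterior

variable {n : ℕ} {Ω B : Set Plane} {v ν : Fin n → Plane}

/-- Among the compactly many centres whose disks contain that of `z`, take one of largest radius. A
disk containing it has no larger radius, so it has the same centre. -/
theorem exists_mem_axis (D : IsPolygonInterior Ω B v ν) {z : Plane} (hz : z ∈ Ω ∪ B) :
    ∃ y ∈ axis Ω B, dist z y + infDist z B ≤ infDist y B := by
  have hc : IsCompact {y ∈ Ω ∪ B | dist z y + infDist z B ≤ infDist y B} :=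
    D.isCompact.inter_right (isClosed_le (by fun_prop) (continuous_infDist_pt B))
  obtain ⟨y, ⟨hyK, hy⟩, hmax⟩ := hc.exists_isMaxOn ⟨z, hz, by simp⟩
    (continuous_infDist_pt B).continuousOn
  refine ⟨y, ⟨hyK, fun w hw hyw => ?_⟩, hy⟩
  have : infDist w B ≤ infDist y B := hmax ⟨hw, by
    have := dist_triangle z y w
    linarith⟩
  have : dist y w ≤ 0 := by linarith
  exact (dist_le_zero.1 this).symm

/-- Disks whose centres lie on one ray from `p` and which all pass through `p` are nested, so at
most one of them is maximal. -/
theorem eq_of_ray {p z y y' : Plane} (hy : y ∈ axis Ω B)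
    (hy' : y' ∈ axis Ω B) {t t' : ℝ} (hyt : y = p + t • (z - p)) (hyt' : y' = p + t' • (z - p))
    (ht : infDist y B = t * dist z p) (ht' : infDist y' B = t' * dist z p) : y = y' := by
  wlog hle : t ≤ t' generalizing y y' t t'
  · exact (this hy' hy hyt' hyt ht' ht (le_of_not_ge hle)).symm
  refine (hy.2 y' hy'.1 ?_).symm
  have : dist y y' = (t' - t) * dist z p := by
    rw [hyt, hyt', dist_add_left, dist_eq_norm, ← sub_smul, norm_smul, Real.norm_eq_abs,
      abs_sub_comm, abs_of_nonneg (sub_nonneg.2 hle), dist_eq_norm]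
  rw [this, ht, ht']
  linarith

/-- The contact point `p` of the smaller disk lies on `B`, so it cannot be inside the larger one.
This forces equality in the triangle inequality for `y`, `z`, `p`. -/
theorem eq_ray_of_dist_le {z y p : Plane} (hp : p ∈ B) (hpz : dist z p = infDist z B)
    (hz : z ≠ p) (h : dist z y + infDist z B ≤ infDist y B) :
    y = p + (infDist y B / dist z p) • (z - p) ∧ dist y p = infDist y B := by
  have h1 : infDist y B ≤ dist y p := infDist_le_dist_of_mem hp
  have h2 := dist_triangle y z p
  rw [dist_comm z y] at h
  have h3 : dist y p = infDist y B := by linarith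
  refine ⟨?_, h3⟩
  rw [← h3]
  exact eq_add_smul_of_dist_add_dist (by linarith) hz

/-- Makes the retraction well defined. It also keeps the crosscuts through different centres
disjoint. -/
theorem axis_unique (D : IsPolygonInterior Ω B v ν) {z y y' : Plane} (hz : z ∈ Ω)
    (hy : y ∈ axis Ω B) (hy' : y' ∈ axis Ω B) (h : dist z y + infDist z B ≤ infDist y B)
    (h' : dist z y' + infDist z B ≤ infDist y' B) : y = y' := by
  obtain ⟨p, hp, hpz⟩ := D.exists_nearest z
  have hpos := D.infDist_pos hz
  have hzp : z ≠ p := fun h => by rw [← hpz, h, dist_self] at hpos; exact lt_irrefl _ hpos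
  have hd : dist z p ≠ 0 := dist_ne_zero.2 hzp
  exact eq_of_ray hy hy' (eq_ray_of_dist_le hp hpz hzp h).1 (eq_ray_of_dist_le hp hpz hzp h').1
    (div_mul_cancel₀ _ hd).symm (div_mul_cancel₀ _ hd).symm

/-- A larger disk would still touch at both `p` and `q`, so its centre and `x` would lie on a ray
from each, with equal distances. That determines the starting point of the ray, so `p = q`. -/
theorem mem_axis_of_two_nearest {x p q : Plane} (hx : x ∈ Ω ∪ B)
    (hp : p ∈ B) (hq : q ∈ B) (hpq : p ≠ q) (hxp : dist x p = infDist x B)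
    (hxq : dist x q = infDist x B) : x ∈ axis Ω B := by
  refine ⟨hx, fun y hy h => ?_⟩
  by_contra hne
  have h1 : dist p x + dist x y = dist p y := by
    have a1 : infDist y B ≤ dist y p := infDist_le_dist_of_mem hp
    have a2 := dist_triangle p x y
    rw [dist_comm p x, dist_comm p y] at *
    linarith
  have h2 : dist q x + dist x y = dist q y := by
    have a1 : infDist y B ≤ dist y q := infDist_le_dist_of_mem hq
    have a2 := dist_triangle q x y
    rw [dist_comm q x, dist_comm q y] at *
    linarith
  have e1 := eq_add_smul_of_dist_add_dist h1 (Ne.symm hne)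
  have e2 := eq_add_smul_of_dist_add_dist h2 (Ne.symm hne)
  have : dist p y = dist q y := by
    rw [← h1, ← h2, dist_comm p, dist_comm q, hxp, hxq]
  rw [this] at e1
  exact hpq (e1.trans e2.symm)

end IsPolygonInterior

end Domain

/-! ### Contact points of maximal disks -/

section Touching

theorem eq_smul_of_inner_pos {a e : Plane} (ha : ‖a‖ = 1)
    (h : ∀ w, 0 < ⟪w, e⟫ → 0 < ⟪a, w⟫) : e = ‖e‖ • a := by
  by_contra hne
  have h1 : ⟪a, e⟫ < ‖e‖ := by
    have := real_inner_le_norm a e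
    rw [ha, one_mul] at this
    refine lt_of_le_of_ne this fun heq => hne ?_
    have h2 := (inner_eq_norm_mul_iff_real (x := a) (y := e)).1 (by rw [heq, ha, one_mul])
    rw [ha, one_smul] at h2
    exact h2.symm
  have he : 0 < ‖e‖ := by
    rw [norm_pos_iff]; rintro rfl; simp at hne
  -- If `e` is not a nonnegative multiple of `a`, this vector is in the open half-plane of `e` but
  -- has negative inner product with `a`.
  have := h (e - ‖e‖ • a) (by
    rw [inner_sub_left, real_inner_self_eq_norm_sq, inner_smul_left]
    simp only [conj_trivial]
    nlinarith)
  rw [inner_sub_right, inner_smul_right, real_inner_self_eq_norm_sq, ha] at this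
  linarith

namespace IsPolygonInterior

variable {n : ℕ} {Ω B : Set Plane} {v ν : Fin n → Plane}

/-- A direction at `p` making an acute angle with the radius enters the disk at once. -/
theorem eventually_mem_of_inner_pos (D : IsPolygonInterior Ω B v ν) {z p w : Plane} (hz : z ∈ Ω)
    (hzp : dist z p = infDist z B) (hw : 0 < ⟪w, z - p⟫) :
    ∀ᶠ t : ℝ in 𝓝[>] 0, p + t • w ∈ Ω := by
  have h1 : Tendsto (fun t : ℝ => t * ‖w‖ ^ 2) (𝓝[>] 0) (𝓝 0) := by
    have : Tendsto (fun t : ℝ => t * ‖w‖ ^ 2) (𝓝 0) (𝓝 (0 * ‖w‖ ^ 2)) :=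
      Continuous.tendsto (by fun_prop) 0
    rw [zero_mul] at this
    exact this.mono_left nhdsWithin_le_nhds
  filter_upwards [self_mem_nhdsWithin, h1.eventually (gt_mem_nhds (show 0 < 2 * ⟪w, z - p⟫ by
    positivity))] with t ht h
  apply D.ball_subset hz
  have ht : 0 < t := ht
  rw [mem_ball, ← hzp, dist_eq_norm, dist_eq_norm]
  apply lt_of_pow_lt_pow_left₀ 2 (norm_nonneg _)
  have e : p + t • w - z = t • w - (z - p) := by abel
  rw [e, norm_sub_sq_real, norm_smul, inner_smul_left, Real.norm_eq_abs, mul_pow, sq_abs]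
  simp only [conj_trivial]
  nlinarith

/-- A touching disk fills an open half-plane of directions at `p`, which does not fit into a wedge
with two distinct normals. -/
theorem not_convexAt_of_nearest (D : IsPolygonInterior Ω B v ν) {z p a b : Plane} (hz : z ∈ Ω)
    (hzp : dist z p = infDist z B) (ha : ‖a‖ = 1) (hb : ‖b‖ = 1) (hab : a ≠ b) :
    ¬ ConvexAt Ω B p a b := by
  rintro ⟨ε, hε, h⟩
  have key : ∀ w, 0 < ⟪w, z - p⟫ → 0 < ⟪a, w⟫ ∧ 0 < ⟪b, w⟫ := by
    intro w hw
    obtain ⟨t, ⟨hΩ, ht⟩, hball⟩ := (((D.eventually_mem_of_inner_pos hz hzp hw).and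
      (eventually_mem_nhdsWithin)).and ((tendsto_add_smul p w).eventually
        (ball_mem_nhds p hε))).exists
    have ht : 0 < t := ht
    rw [(h _ hball).1, add_sub_cancel_left, inner_smul_right, inner_smul_right] at hΩ
    exact ⟨pos_of_mul_pos_right hΩ.1 ht.le, pos_of_mul_pos_right hΩ.2 ht.le⟩
  have h1 := eq_smul_of_inner_pos ha fun w hw => (key w hw).1
  have h2 := eq_smul_of_inner_pos hb fun w hw => (key w hw).2
  have hpos : 0 < ‖z - p‖ := by
    rw [← dist_eq_norm, hzp]; exact D.infDist_pos hz
  rw [h1] at h2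
  rw [norm_smul, ha, mul_one, norm_norm] at h2
  exact hab (smul_right_injective _ hpos.ne' h2)

theorem inner_pos_of_nearest (D : IsPolygonInterior Ω B v ν) {z p a b : Plane} (hz : z ∈ Ω)
    (hzp : dist z p = infDist z B) (h : ReflexAt Ω B p a b) (w : Plane) (hw : 0 < ⟪w, z - p⟫) :
    0 < ⟪a, w⟫ ∨ 0 < ⟪b, w⟫ := by
  obtain ⟨ε, hε, h⟩ := h
  obtain ⟨t, ⟨hΩ, ht⟩, hball⟩ := (((D.eventually_mem_of_inner_pos hz hzp hw).and
    (eventually_mem_nhdsWithin)).and ((tendsto_add_smul p w).eventually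
      (ball_mem_nhds p hε))).exists
  have ht : 0 < t := ht
  rw [(h _ hball).1, add_sub_cancel_left, inner_smul_right, inner_smul_right] at hΩ
  exact hΩ.imp (fun h => pos_of_mul_pos_right h ht.le) fun h => pos_of_mul_pos_right h ht.le

theorem reflexAt_of_nearest (D : IsPolygonInterior Ω B v ν) {z p : Plane} (hz : z ∈ Ω)
    (hp : p ∈ B) (hzp : dist z p = infDist z B) : ∃ a b, ReflexAt Ω B p a b := by
  obtain ⟨a, b, ha, hb, -, h⟩ := D.shape hp
  rcases h with ⟨hab, h⟩ | h
  · exact absurd h (D.not_convexAt_of_nearest hz hzp ha hb hab)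
  · exact ⟨a, b, h⟩

/-- Near a reflex or flat boundary point, a disk in the domain touches the boundary at most
once. -/
theorem nearest_unique_near (D : IsPolygonInterior Ω B v ν) {p a b : Plane}
    (h : ReflexAt Ω B p a b) : ∃ ε > 0, ∀ z ∈ Ω, ∀ p₁ ∈ B, ∀ p₂ ∈ B, p₁ ∈ ball p ε →
      p₂ ∈ ball p ε → dist z p₁ = infDist z B → dist z p₂ = infDist z B → p₁ = p₂ := by
  obtain ⟨ε, hε, h⟩ := h
  refine ⟨ε, hε, fun z hz p₁ h₁ p₂ h₂ hb₁ hb₂ hd₁ hd₂ => ?_⟩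
  by_contra hne
  have hm : midpoint ℝ p₁ p₂ ∈ ball p ε :=
    (convex_ball p ε).segment_subset hb₁ hb₂ (midpoint_mem_segment p₁ p₂)
  -- Strict convexity of the disk puts the midpoint of two contacts into `Ω`, whereas the complement
  -- of a union of two open half-planes is convex and contains both contacts.
  have hmΩ : midpoint ℝ p₁ p₂ ∈ Ω := by
    apply D.ball_subset hz
    have h₁' : p₁ ∈ closedBall z (infDist z B) := by rw [mem_closedBall', hd₁]
    have h₂' : p₂ ∈ closedBall z (infDist z B) := by rw [mem_closedBall', hd₂]
    have := (strictConvex_closedBall ℝ z (infDist z B)) h₁' h₂' hne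
      (show (0 : ℝ) < 1 / 2 by norm_num) (show (0 : ℝ) < 1 / 2 by norm_num) (by norm_num)
    rw [interior_closedBall _ (D.infDist_pos hz).ne'] at this
    convert this using 1
    rw [midpoint_eq_smul_add, smul_add]
    norm_num
  have k₁ : ¬ (0 < ⟪a, p₁ - p⟫ ∨ 0 < ⟪b, p₁ - p⟫) := fun hc =>
    disjoint_left.1 D.disjoint ((h _ hb₁).1.2 hc) h₁
  have k₂ : ¬ (0 < ⟪a, p₂ - p⟫ ∨ 0 < ⟪b, p₂ - p⟫) := fun hc =>
    disjoint_left.1 D.disjoint ((h _ hb₂).1.2 hc) h₂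
  push Not at k₁ k₂
  have e : midpoint ℝ p₁ p₂ - p = (2⁻¹ : ℝ) • (p₁ - p) + (2⁻¹ : ℝ) • (p₂ - p) := by
    rw [midpoint_eq_smul_add, invOf_eq_inv]; module
  rw [(h _ hm).1, e, inner_add_right, inner_add_right, inner_smul_right, inner_smul_right,
    inner_smul_right, inner_smul_right] at hmΩ
  rcases hmΩ with h | h <;> linarith [k₁.1, k₁.2, k₂.1, k₂.2]

/-- `hcone` says that the local complement of the domain lies behind the line through `p` normal to
`N`. A small disk in front of that line touching it at `p` therefore meets no nearby boundary. -/
theorem exists_push_of_reflexAt (D : IsPolygonInterior Ω B v ν) {p a b N : Plane} (hp : p ∈ B)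
    (h : ReflexAt Ω B p a b) (hN : ‖N‖ = 1)
    (hcone : ∀ w, ⟪a, w⟫ ≤ 0 → ⟪b, w⟫ ≤ 0 → ⟪N, w⟫ ≤ 0) (hpos : 0 < ⟪a, N⟫ ∨ 0 < ⟪b, N⟫) :
    ∃ t > 0, p + t • N ∈ Ω ∧ infDist (p + t • N) B = t := by
  obtain ⟨ε, hε, h⟩ := h
  -- With radius ε/3, boundary points outside the ball about `p` are at distance at least 2ε/3 from
  -- the centre.
  have hd : dist (p + (ε / 3) • N) p = ε / 3 := by
    rw [dist_self_add_left, norm_smul, hN, mul_one, Real.norm_eq_abs, abs_of_pos (by positivity)]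
  refine ⟨ε / 3, by positivity, ?_, le_antisymm ?_ ?_⟩
  · rw [(h _ (by rw [mem_ball, hd]; linarith)).1, add_sub_cancel_left, inner_smul_right,
      inner_smul_right]
    exact hpos.imp (fun h => by positivity) fun h => by positivity
  · exact (infDist_le_dist_of_mem hp).trans hd.le
  · rw [le_infDist D.boundary_nonempty]
    intro x hx
    by_cases hxε : x ∈ ball p ε
    · have k : ¬ (0 < ⟪a, x - p⟫ ∨ 0 < ⟪b, x - p⟫) := fun hc =>
        disjoint_left.1 D.disjoint ((h _ hxε).1.2 hc) hx
      push Not at k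
      have hle := hcone _ k.1 k.2
      rw [dist_eq_norm]
      apply le_of_sq_le_sq _ (norm_nonneg _)
      have e : p + (ε / 3) • N - x = (ε / 3) • N - (x - p) := by abel
      rw [e, norm_sub_sq_real, norm_smul, hN, mul_one, inner_smul_left, Real.norm_eq_abs, sq_abs]
      simp only [conj_trivial]
      nlinarith [sq_nonneg ‖x - p‖]
    · rw [mem_ball, not_lt] at hxε
      have := dist_triangle_left x p (p + (ε / 3) • N)
      rw [hd] at this
      linarith

/-- The maximal disk around a disk touching at `p` still touches at `p`, with the same normal. -/
theorem exists_axis_ray (D : IsPolygonInterior Ω B v ν) {p N : Plane} (hp : p ∈ B)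
    (hN : ‖N‖ = 1) (h : ∃ t > 0, p + t • N ∈ Ω ∧ infDist (p + t • N) B = t) :
    ∃ y ∈ axis Ω B, y ∈ Ω ∧ y = p + infDist y B • N := by
  obtain ⟨t, ht, hΩ, hd⟩ := h
  obtain ⟨y, hy, hyd⟩ := D.exists_mem_axis (Or.inl hΩ)
  have hdp : dist (p + t • N) p = t := by
    rw [dist_self_add_left, norm_smul, hN, mul_one, Real.norm_eq_abs, abs_of_pos ht]
  have hypos : 0 < infDist y B := by
    have := dist_nonneg (x := p + t • N) (y := y)
    linarith
  refine ⟨y, hy, mem_of_infDist_pos hy.1 hypos, ?_⟩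
  have hne : p + t • N ≠ p := by rw [← dist_ne_zero, hdp]; exact ht.ne'
  have h1 := (eq_ray_of_dist_le hp (hdp.trans hd.symm) hne hyd).1
  rwa [add_sub_cancel_left, hdp, smul_smul, div_mul_cancel₀ _ ht.ne'] at h1

theorem notMem_axis_of_reflexAt (D : IsPolygonInterior Ω B v ν) {p a b : Plane} (hp : p ∈ B)
    (ha : ‖a‖ = 1) (h : ReflexAt Ω B p a b) : p ∉ axis Ω B := by
  obtain ⟨t, ht, hΩ, hd⟩ := D.exists_push_of_reflexAt hp h ha (fun w h1 _ => h1)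
    (Or.inl (by rw [real_inner_self_eq_norm_sq, ha]; norm_num))
  intro hpa
  have := hpa.2 _ (Or.inl hΩ) (by
    rw [hd, infDist_zero_of_mem hp, dist_self_add_right, norm_smul, ha, Real.norm_eq_abs,
      abs_of_pos ht]
    simp)
  rw [this] at hΩ
  exact disjoint_left.1 D.disjoint hΩ hp

theorem mem_axis_of_convexAt (D : IsPolygonInterior Ω B v ν) {p a b : Plane} (hp : p ∈ B)
    (ha : ‖a‖ = 1) (hb : ‖b‖ = 1) (hab : a ≠ b) (h : ConvexAt Ω B p a b) : p ∈ axis Ω B := by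
  refine ⟨Or.inr hp, fun y hy hyd => ?_⟩
  rw [infDist_zero_of_mem hp, add_zero] at hyd
  by_contra hne
  have hpos : 0 < infDist y B := (dist_pos.2 (Ne.symm hne)).trans_le hyd
  refine D.not_convexAt_of_nearest (mem_of_infDist_pos hy hpos) ?_ ha hb hab h
  exact le_antisymm (by rwa [dist_comm]) (infDist_le_dist_of_mem hp)

theorem axis_inter_boundary_subset (D : IsPolygonInterior Ω B v ν) :
    axis Ω B ∩ B ⊆ range v := by
  rintro p ⟨hpa, hpB⟩
  have h := hpB
  rw [D.boundary_eq, mem_iUnion] at h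
  obtain ⟨i, hi⟩ := h
  rw [← insert_endpoints_openSegment] at hi
  rcases hi with rfl | rfl | hi
  · exact ⟨i, rfl⟩
  · exact ⟨_, rfl⟩
  · exact absurd hpa (D.notMem_axis_of_reflexAt hpB (D.norm_normal i) (D.edge i p hi))

/-- With a single contact `p`, the disk could grow by moving its centre straight away from `p`. Near
`p` no boundary point lies strictly on the disk's side of the tangent line, and elsewhere
compactness leaves a gap δ. -/
theorem exists_two_nearest (D : IsPolygonInterior Ω B v ν) {x : Plane} (hx : x ∈ axis Ω B)
    (hxΩ : x ∈ Ω) : ∃ p ∈ B, ∃ q ∈ B, p ≠ q ∧ dist x p = infDist x B ∧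
      dist x q = infDist x B := by
  obtain ⟨p, hp, hxp⟩ := D.exists_nearest x
  by_contra! hcon
  have huniq : ∀ q ∈ B, q ≠ p → infDist x B < dist x q := fun q hq hqp =>
    lt_of_le_of_ne (infDist_le_dist_of_mem hq)
      fun h => hcon p hp q hq (Ne.symm hqp) hxp h.symm
  set r := infDist x B with hr
  have hrpos : 0 < r := D.infDist_pos hxΩ
  obtain ⟨a, b, href⟩ := D.reflexAt_of_nearest hxΩ hp hxp
  have hpos := D.inner_pos_of_nearest hxΩ hxp href
  obtain ⟨ε, hε, h⟩ := href
  obtain ⟨δ, hδ, hδB⟩ : ∃ δ > 0, ∀ q ∈ B, q ∉ ball p ε → r + δ ≤ dist x q := by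
    rcases (B \ ball p ε).eq_empty_or_nonempty with hemp | hne
    · exact ⟨1, one_pos, fun q hq hqb =>
        absurd (show q ∈ B \ ball p ε from ⟨hq, hqb⟩) (by simp [hemp])⟩
    · obtain ⟨q₀, hq₀, hmin⟩ := (D.isCompact_boundary.diff isOpen_ball).exists_isMinOn hne
        (f := fun q => dist x q) (by fun_prop)
      refine ⟨dist x q₀ - r, sub_pos.2 (huniq q₀ hq₀.1 fun h => hq₀.2 (by
        rw [h]; exact mem_ball_self hε)), fun q hq hqb => ?_⟩
      have : dist x q₀ ≤ dist x q := hmin ⟨hq, hqb⟩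
      linarith
  -- Moving the centre by tr costs tr of the gap and the radius has to grow by another tr, hence 2tr
  -- ≤ δ.
  obtain ⟨t, ht, ht1, ht2⟩ : ∃ t : ℝ, 0 < t ∧ t < 1 ∧ 2 * t * r ≤ δ := by
    refine ⟨min (1 / 2) (δ / (2 * r)), by positivity, by
      have := min_le_left (1 / 2 : ℝ) (δ / (2 * r)); linarith, ?_⟩
    have := min_le_right (1 / 2 : ℝ) (δ / (2 * r))
    rw [le_div_iff₀ (by positivity)] at this
    linarith
  have hxpn : ‖x - p‖ = r := by rw [← dist_eq_norm, hxp]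
  set y := x + t • (x - p) with hy
  have hxy : dist x y = t * r := by
    rw [hy, dist_self_add_right, norm_smul, hxpn, Real.norm_eq_abs, abs_of_pos ht]
  have hyp : y - p = (1 + t) • (x - p) := by rw [hy]; module
  have hyΩ : y ∈ Ω := D.ball_subset hxΩ (by rw [mem_ball', hxy, ← hr]; nlinarith)
  have hyd : r + t * r ≤ infDist y B := by
    rw [le_infDist D.boundary_nonempty]
    intro q hq
    by_cases hqb : q ∈ ball p ε
    · by_contra! hlt
      have hin : 0 < ⟪q - p, x - p⟫ := by
        have h1 : dist y q ^ 2 < (r + t * r) ^ 2 := by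
          have := dist_nonneg (x := y) (y := q)
          nlinarith
        have e : y - q = (1 + t) • (x - p) - (q - p) := by rw [← hyp]; abel
        rw [dist_eq_norm, e, norm_sub_sq_real, norm_smul, hxpn, inner_smul_left, Real.norm_eq_abs,
          abs_of_pos (by positivity)] at h1
        simp only [conj_trivial] at h1
        rw [real_inner_comm]
        by_contra! hle
        nlinarith [sq_nonneg ‖q - p‖, mul_nonneg (show 0 ≤ 1 + t by linarith) (neg_nonneg.2 hle)]
      exact disjoint_left.1 D.disjoint ((h q hqb).1.2 (hpos _ hin)) hq
    · have h1 := hδB q hq hqb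
      have h2 := dist_triangle x y q
      linarith
  have := hx.2 y (Or.inl hyΩ) (by rw [hxy, ← hr]; linarith)
  rw [this, dist_self] at hxy
  have := mul_pos ht hrpos
  linarith

/-- Limits of pairs of contacts are contacts, and by `nearest_unique_near` they cannot merge at a
reflex or flat point. A limit of centres on `B` is then a convex vertex, which is itself on the
axis. -/
theorem isClosed_axis (D : IsPolygonInterior Ω B v ν) : IsClosed (axis Ω B) := by
  have hsplit : axis Ω B = (axis Ω B ∩ Ω) ∪ (axis Ω B ∩ B) := by
    rw [← inter_union_distrib_left]
    exact (inter_eq_left.2 fun x hx => hx.1).symm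
  have hfin : IsClosed (axis Ω B ∩ B) :=
    ((finite_range v).subset D.axis_inter_boundary_subset).isClosed
  suffices h : closure (axis Ω B ∩ Ω) ⊆ axis Ω B by
    apply isClosed_of_closure_subset
    conv_lhs => rw [hsplit, closure_union, hfin.closure_eq]
    exact union_subset h inter_subset_left
  intro x hx
  have hxK : x ∈ Ω ∪ B :=
    closure_minimal (fun y hy => hy.1.1) D.isCompact.isClosed hx
  obtain ⟨u, hu, hux⟩ := mem_closure_iff_seq_limit.1 hx
  choose p hp q hq hpq hup huq using fun k => D.exists_two_nearest (hu k).1 (hu k).2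
  rcases hxK with hxΩ | hxB
  · obtain ⟨p', hp', φ, hφ, hpl⟩ := D.isCompact_boundary.tendsto_subseq hp
    obtain ⟨q', hq', ψ, hψ, hql⟩ := D.isCompact_boundary.tendsto_subseq fun k => hq (φ k)
    have hpl' := hpl.comp hψ.tendsto_atTop
    have hul := hux.comp (hφ.comp hψ).tendsto_atTop
    have hdl : Tendsto (fun k => infDist (u (φ (ψ k))) B) atTop (𝓝 (infDist x B)) :=
      ((continuous_infDist_pt B).tendsto x).comp hul
    have e1 : dist x p' = infDist x B :=
      tendsto_nhds_unique ((hul.dist hpl').congr fun k => hup _) hdl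
    have e2 : dist x q' = infDist x B :=
      tendsto_nhds_unique ((hul.dist hql).congr fun k => huq _) hdl
    by_cases hne : p' = q'
    · subst hne
      obtain ⟨a, b, href⟩ := D.reflexAt_of_nearest hxΩ hp' e1
      obtain ⟨ε, hε, hun⟩ := D.nearest_unique_near href
      obtain ⟨k, hk1, hk2⟩ := ((hpl'.eventually (ball_mem_nhds p' hε)).and
        (hql.eventually (ball_mem_nhds p' hε))).exists
      exact absurd (hun _ (hu _).2 _ (hp _) _ (hq _) hk1 hk2 (hup _) (huq _)) (hpq _)
    · exact mem_axis_of_two_nearest (Or.inl hxΩ) hp' hq' hne e1 e2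
  · obtain ⟨a, b, ha, hb, hab, h⟩ := D.shape hxB
    rcases h with ⟨hne, h⟩ | h
    · exact D.mem_axis_of_convexAt hxB ha hb hne h
    · obtain ⟨ε, hε, hun⟩ := D.nearest_unique_near h
      obtain ⟨k, hk⟩ := (hux.eventually (ball_mem_nhds x (half_pos hε))).exists
      have hux' : infDist (u k) B ≤ dist (u k) x := infDist_le_dist_of_mem hxB
      have b1 : p k ∈ ball x ε := by
        rw [mem_ball]
        have := dist_triangle_left (p k) x (u k)
        rw [hup k] at this
        linarith
      have b2 : q k ∈ ball x ε := by
        rw [mem_ball]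
        have := dist_triangle_left (q k) x (u k)
        rw [huq k] at this
        linarith
      exact absurd (hun _ (hu k).2 _ (hp k) _ (hq k) b1 b2 (hup k) (huq k)) (hpq k)

theorem isCompact_axis (D : IsPolygonInterior Ω B v ν) : IsCompact (axis Ω B) :=
  D.isCompact.of_isClosed_subset D.isClosed_axis fun _ hx => hx.1

end IsPolygonInterior

/-- By compactness it suffices to examine cluster values, and each of them satisfies the closed
relation at `x`. Uniqueness is needed only at the limit point, which may lie outside `S`. -/
theorem tendsto_of_isClosed_graph {α β : Type*} [TopologicalSpace α] [TopologicalSpace β]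
    {f : α → β} {S : Set α} {Y : Set β} {G : Set (α × β)} (hY : IsCompact Y) (hG : IsClosed G)
    (hfY : ∀ x ∈ S, f x ∈ Y) (hfG : ∀ x ∈ S, (x, f x) ∈ G) {x : α} {y : β}
    (huniq : ∀ z ∈ Y, (x, z) ∈ G → z = y) : Tendsto f (𝓝[S] x) (𝓝 y) := by
  refine hY.tendsto_nhds_of_unique_mapClusterPt
    (eventually_nhdsWithin_of_forall hfY) fun z hz hzc => huniq z hz ?_
  rw [← hG.closure_eq, mem_closure_iff_nhds]
  intro W hW
  obtain ⟨U, hU, V, hV, hUV⟩ := mem_nhds_prod_iff.1 hW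
  obtain ⟨x', hx'V, hx'U, hx'S⟩ := ((mapClusterPt_iff_frequently.1 hzc V hV).and_eventually
    ((eventually_mem_set.2 (mem_nhdsWithin_of_mem_nhds hU)).and
      (eventually_mem_nhdsWithin (a := x) (s := S)))).exists
  exact ⟨(x', f x'), hUV ⟨hx'U, hx'V⟩, hfG x' hx'S⟩

end Touching

/-! ### The retraction onto the axis -/

section Retraction

theorem convex_halfPlane_inter_ball (p c : Plane) (ε : ℝ) :
    Convex ℝ ({x | 0 < ⟪c, x - p⟫} ∩ ball p ε) := by
  refine Convex.inter ?_ (convex_ball p ε)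
  have : {x : Plane | 0 < ⟪c, x - p⟫} = {x | ⟪c, p⟫ < ⟪c, x⟫} := by
    ext x; simp [inner_sub_right]
  rw [this]
  exact convex_halfSpace_gt (innerSL ℝ c).isLinear _

theorem isPreconnected_wedge_inter (p a b : Plane) (ε : ℝ) :
    IsPreconnected ({x | 0 < ⟪a, x - p⟫ ∧ 0 < ⟪b, x - p⟫} ∩ ball p ε) := by
  have : {x | 0 < ⟪a, x - p⟫ ∧ 0 < ⟪b, x - p⟫} ∩ ball p ε =
      ({x | 0 < ⟪a, x - p⟫} ∩ ball p ε) ∩ ({x | 0 < ⟪b, x - p⟫} ∩ ball p ε) := by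
    rw [← inter_inter_distrib_right]; rfl
  rw [this]
  exact ((convex_halfPlane_inter_ball p a ε).inter
    (convex_halfPlane_inter_ball p b ε)).isPreconnected

theorem isPreconnected_wedge_union {p a b : Plane} (ha : ‖a‖ = 1) (hb : ‖b‖ = 1)
    (hab : a + b ≠ 0) {ε : ℝ} (hε : 0 < ε) :
    IsPreconnected ({x | 0 < ⟪a, x - p⟫ ∨ 0 < ⟪b, x - p⟫} ∩ ball p ε) := by
  have : {x | 0 < ⟪a, x - p⟫ ∨ 0 < ⟪b, x - p⟫} ∩ ball p ε =
      ({x | 0 < ⟪a, x - p⟫} ∩ ball p ε) ∪ ({x | 0 < ⟪b, x - p⟫} ∩ ball p ε) := by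
    rw [← union_inter_distrib_right]; rfl
  rw [this]
  obtain ⟨h1, h2⟩ := inner_add_pos ha hb hab
  obtain ⟨t, ht, htb⟩ := ((eventually_mem_nhdsWithin).and
    ((tendsto_add_smul p (a + b)).eventually (ball_mem_nhds p hε))).exists
  have ht : 0 < t := ht
  refine IsPreconnected.union (p + t • (a + b)) ⟨?_, htb⟩ ⟨?_, htb⟩
    (convex_halfPlane_inter_ball p a ε).isPreconnected
    (convex_halfPlane_inter_ball p b ε).isPreconnected
  · change 0 < ⟪a, p + t • (a + b) - p⟫
    rw [add_sub_cancel_left, inner_smul_right]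
    positivity
  · change 0 < ⟪b, p + t • (a + b) - p⟫
    rw [add_sub_cancel_left, inner_smul_right]
    positivity

namespace IsPolygonInterior

variable {n : ℕ} {Ω B : Set Plane} {v ν : Fin n → Plane}

/-- Sending a point to the centre of the maximal disk around its own maximal disk is a continuous
retraction of the interior onto the axis. -/
theorem exists_retraction (D : IsPolygonInterior Ω B v ν) :
    ∃ ρ : Plane → Plane, ContinuousOn ρ Ω ∧
      (∀ z ∈ Ω, ρ z ∈ axis Ω B ∩ Ω ∧ dist z (ρ z) + infDist z B ≤ infDist (ρ z) B) ∧
      (∀ z ∈ axis Ω B ∩ Ω, ρ z = z) ∧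
      (∀ p ∈ axis Ω B ∩ B, Tendsto ρ (𝓝[Ω] p) (𝓝 p)) := by
  have hex : ∀ z, ∃ y, z ∈ Ω → y ∈ axis Ω B ∧ dist z y + infDist z B ≤ infDist y B := by
    intro z
    by_cases hz : z ∈ Ω
    · obtain ⟨y, hy, h⟩ := D.exists_mem_axis (Or.inl hz)
      exact ⟨y, fun _ => ⟨hy, h⟩⟩
    · exact ⟨z, fun h => absurd h hz⟩
  choose ρ hρ using hex
  have hG : IsClosed {x : Plane × Plane | dist x.1 x.2 + infDist x.1 B ≤ infDist x.2 B} :=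
    isClosed_le (by
      have := continuous_infDist_pt B
      fun_prop) ((continuous_infDist_pt B).comp continuous_snd)
  refine ⟨ρ, fun z hz => ?_, fun z hz => ⟨⟨(hρ z hz).1, ?_⟩, (hρ z hz).2⟩, fun z hz => ?_,
    fun p hp => ?_⟩
  · exact tendsto_of_isClosed_graph D.isCompact_axis hG (fun x hx => (hρ x hx).1)
      (fun x hx => (hρ x hx).2) fun y hy h => D.axis_unique hz hy (hρ z hz).1 h (hρ z hz).2
  · refine mem_of_infDist_pos (hρ z hz).1.1 ?_
    have := D.infDist_pos hz
    have := (hρ z hz).2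
    have := dist_nonneg (x := z) (y := ρ z)
    linarith
  · exact D.axis_unique hz.2 (hρ z hz.2).1 hz.1 (hρ z hz.2).2 (by simp)
  -- At a boundary point `p` of the axis, maximality of the disk of radius 0 leaves `p` as the only
  -- possible limit.
  · exact tendsto_of_isClosed_graph D.isCompact_axis hG (fun x hx => (hρ x hx).1)
      (fun x hx => (hρ x hx).2) fun y hy h => hp.1.2 y hy.1 h

/-- The axis lies between the connected image of `Ω` under the retraction and the closure of that
image. -/
theorem isPreconnected_axis (D : IsPolygonInterior Ω B v ν) : IsPreconnected (axis Ω B) := by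
  obtain ⟨ρ, hc, hmem, hfix, hlim⟩ := D.exists_retraction
  have himg : ρ '' Ω = axis Ω B ∩ Ω := by
    apply subset_antisymm
    · rintro _ ⟨z, hz, rfl⟩
      exact (hmem z hz).1
    · exact fun z hz => ⟨z, hz.2, hfix z hz⟩
  refine (D.isPreconnected.image ρ hc).subset_closure (himg ▸ inter_subset_left) ?_
  intro p hp
  rcases hp.1 with h | h
  · exact subset_closure (himg ▸ ⟨hp, h⟩)
  · have : (𝓝[Ω] p).NeBot := mem_closure_iff_nhdsWithin_neBot.1 (D.boundary_subset_closure h)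
    exact mem_closure_of_tendsto (hlim p ⟨hp, h⟩)
      (eventually_nhdsWithin_of_forall fun z hz => mem_image_of_mem ρ hz)

/-- Small pieces of the interior near a boundary point are connected. -/
theorem exists_isPreconnected_near (D : IsPolygonInterior Ω B v ν) {p : Plane} (hp : p ∈ B)
    {δ : ℝ} (hδ : 0 < δ) : ∃ ε > 0, ε ≤ δ ∧ IsPreconnected (Ω ∩ ball p ε) := by
  obtain ⟨a, b, ha, hb, hab, h⟩ := D.shape hp
  rcases h with ⟨-, ε, hε, h⟩ | ⟨ε, hε, h⟩
  · refine ⟨min ε δ, lt_min hε hδ, min_le_right _ _, ?_⟩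
    convert isPreconnected_wedge_inter p a b (min ε δ) using 1
    ext x
    exact and_congr_left fun hx => (h x (ball_subset_ball (min_le_left _ _) hx)).1
  · refine ⟨min ε δ, lt_min hε hδ, min_le_right _ _, ?_⟩
    convert isPreconnected_wedge_union ha hb hab (lt_min hε hδ) using 1
    ext x
    exact and_congr_left fun hx => (h x (ball_subset_ball (min_le_left _ _) hx)).1

/-- Two maximal disks with a common point outside the disk around `x` have their centres joined
inside the axis without passing through `x`. -/
theorem exists_isPreconnected_avoiding (D : IsPolygonInterior Ω B v ν) {u w x α : Plane}
    (hu : u ∈ axis Ω B) (hw : w ∈ axis Ω B) (hαu : dist α u ≤ infDist u B)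
    (hαw : dist α w ≤ infDist w B) (hx : infDist x B < dist α x) :
    ∃ T ⊆ axis Ω B \ {x}, IsPreconnected T ∧ u ∈ T ∧ w ∈ T := by
  have hxu : x ≠ u := by rintro rfl; exact absurd hαu (not_le.2 hx)
  have hxw : x ≠ w := by rintro rfl; exact absurd hαw (not_le.2 hx)
  -- a boundary point of the axis lies in no other maximal disk
  have hbd : ∀ y ∈ axis Ω B, ∀ z ∈ axis Ω B, dist α y ≤ infDist y B → dist α z ≤ infDist z B →
      y ∈ B → z = y := by
    intro y hy z hz h1 h2 hyB
    rw [infDist_zero_of_mem hyB] at h1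
    obtain rfl := dist_le_zero.1 h1
    exact hy.2 z hz.1 (by rwa [infDist_zero_of_mem hyB, add_zero])
  by_cases huw : u = w
  · subst huw
    exact ⟨{u}, by simpa using ⟨hu, hxu.symm⟩, isPreconnected_singleton, rfl, rfl⟩
  have huΩ : u ∈ Ω := hu.1.resolve_right fun h => huw (hbd u hu w hw hαu hαw h).symm
  have hwΩ : w ∈ Ω := hw.1.resolve_right fun h => huw (hbd w hw u hu hαw hαu h)
  obtain ⟨ρ, hc, hmem, hfix, -⟩ := D.exists_retraction
  have hαK : α ∈ Ω ∪ B :=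
    (D.closedBall_subset_iff infDist_nonneg).2 ⟨hu.1, le_rfl⟩ (mem_closedBall.2 hαu)
  -- along the segment from a centre to the common point
  have hseg : ∀ y ∈ Ω, dist α y ≤ infDist y B → ∀ z ∈ segment ℝ y α,
      dist z α ≤ infDist z B ∧ (z ≠ α → z ∈ Ω) := by
    intro y hy h z hz
    have h1 := dist_add_dist_of_mem_segment hz
    have h2 : infDist y B ≤ infDist z B + dist y z := infDist_le_infDist_add_dist
    rw [dist_comm α y] at h
    have h3 : dist z α ≤ infDist z B := by linarith
    refine ⟨h3, fun hne => mem_of_infDist_pos ?_ ((dist_pos.2 hne).trans_le h3)⟩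
    refine (D.closedBall_subset_iff infDist_nonneg).2 ⟨Or.inl hy, le_rfl⟩ (mem_closedBall.2 ?_)
    rw [dist_comm]
    linarith [dist_nonneg (x := z) (y := α)]
  -- The disk about ρ(z) contains that of `z`, hence `α`; the disk about `x` does not.
  have havoid : ∀ z ∈ Ω, dist z α ≤ infDist z B → ρ z ≠ x := by
    intro z hz hzα hzx
    have h1 := (hmem z hz).2
    rw [hzx] at h1
    have h2 := dist_triangle_left α x z
    linarith
  suffices h : ∃ T ⊆ Ω, IsPreconnected T ∧ u ∈ T ∧ w ∈ T ∧ ∀ z ∈ T, ρ z ≠ x by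
    obtain ⟨T, hTΩ, hT, huT, hwT, hTx⟩ := h
    refine ⟨ρ '' T, ?_, hT.image ρ (hc.mono hTΩ), ⟨u, huT, hfix u ⟨hu, huΩ⟩⟩,
      ⟨w, hwT, hfix w ⟨hw, hwΩ⟩⟩⟩
    rintro _ ⟨z, hz, rfl⟩
    exact ⟨(hmem z (hTΩ hz)).1.1, hTx z hz⟩
  rcases hαK with hαΩ | hαB
  · have hsub : ∀ y ∈ Ω, dist α y ≤ infDist y B → segment ℝ y α ⊆ Ω := by
      intro y hy h z hz
      by_cases hzα : z = α
      · rwa [hzα]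
      · exact (hseg y hy h z hz).2 hzα
    refine ⟨segment ℝ u α ∪ segment ℝ w α, union_subset (hsub u huΩ hαu) (hsub w hwΩ hαw),
      IsPreconnected.union α (right_mem_segment ℝ u α) (right_mem_segment ℝ w α)
        (convex_segment u α).isPreconnected (convex_segment w α).isPreconnected,
      Or.inl (left_mem_segment ℝ u α), Or.inr (left_mem_segment ℝ w α), ?_⟩
    rintro z (hz | hz)
    · exact havoid z (hsub u huΩ hαu hz) (hseg u huΩ hαu z hz).1
    · exact havoid z (hsub w hwΩ hαw hz) (hseg w hwΩ hαw z hz).1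
  -- When `α` is on the boundary, the segments are joined near `α` inside `Ω`. The bound on ε keeps
  -- `x` from being a value of ρ there: a disk about `x` containing such a point `z` would need
  -- `dist z x` at most `infDist x B`.
  · obtain ⟨ε, hε, hεδ, hpre⟩ := D.exists_isPreconnected_near hαB (sub_pos.2 hx)
    have hne : ∀ y ∈ Ω, y ≠ α := fun y hy h => disjoint_left.1 D.disjoint hy (h ▸ hαB)
    have hpres : ∀ y ∈ Ω, dist α y ≤ infDist y B → IsPreconnected (segment ℝ y α \ {α}) ∧
        segment ℝ y α \ {α} ⊆ Ω ∧ ((segment ℝ y α \ {α}) ∩ (Ω ∩ ball α ε)).Nonempty := by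
      intro y hy h
      have heq : segment ℝ y α \ {α} = AffineMap.lineMap y α '' Ico (0 : ℝ) 1 := by
        rw [segment_eq_image_lineMap]
        apply subset_antisymm
        · rintro _ ⟨⟨t, ht, rfl⟩, hne⟩
          exact ⟨t, ⟨ht.1, lt_of_le_of_ne ht.2 fun h => hne (by simp [h])⟩, rfl⟩
        · rintro _ ⟨t, ht, rfl⟩
          refine ⟨⟨t, Ico_subset_Icc_self ht, rfl⟩, fun h => ?_⟩
          have : t = 1 ∨ y = α := by simpa [AffineMap.lineMap_eq_right_iff, or_comm] using h
          exact this.elim ht.2.ne (hne y hy)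
      have hsub : segment ℝ y α \ {α} ⊆ Ω := fun z hz => (hseg y hy h z hz.1).2 hz.2
      refine ⟨?_, hsub, ?_⟩
      · rw [heq]
        exact isPreconnected_Ico.image _ (by fun_prop)
      · have hlim : Tendsto (fun t : ℝ => AffineMap.lineMap y α t) (𝓝[<] 1) (𝓝 α) := by
          have : Tendsto (fun t : ℝ => AffineMap.lineMap y α t) (𝓝 1)
              (𝓝 (AffineMap.lineMap y α (1 : ℝ))) := Continuous.tendsto (by fun_prop) 1
          rw [AffineMap.lineMap_apply_one] at this
          exact this.mono_left nhdsWithin_le_nhds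
        obtain ⟨t, htb, ht⟩ := ((hlim.eventually (ball_mem_nhds α hε)).and
          (Ico_mem_nhdsLT (show (0 : ℝ) < 1 by norm_num))).exists
        have hm : AffineMap.lineMap y α t ∈ segment ℝ y α \ {α} := by
          rw [heq]; exact ⟨t, ht, rfl⟩
        exact ⟨_, hm, hsub hm, htb⟩
    obtain ⟨p1, s1, z1, hz1, hz1'⟩ := hpres u huΩ hαu
    obtain ⟨p2, s2, z2, hz2, hz2'⟩ := hpres w hwΩ hαw
    refine ⟨(segment ℝ u α \ {α} ∪ (Ω ∩ ball α ε)) ∪ segment ℝ w α \ {α},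
      union_subset (union_subset s1 inter_subset_left) s2,
      IsPreconnected.union z2 (Or.inr hz2') hz2 (IsPreconnected.union z1 hz1 hz1' p1 hpre) p2,
      Or.inl (Or.inl ⟨left_mem_segment ℝ u α, hne u huΩ⟩),
      Or.inr ⟨left_mem_segment ℝ w α, hne w hwΩ⟩, ?_⟩
    rintro z ((hz | hz) | hz)
    · exact havoid z (s1 hz) (hseg u huΩ hαu z hz.1).1
    · intro hzx
      have h1 := (hmem z hz.1).2
      rw [hzx] at h1
      have h2 := dist_triangle_left α x z
      have h3 := mem_ball.1 hz.2
      have h4 := infDist_nonneg (x := z) (s := B)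
      linarith
    · exact havoid z (s2 hz) (hseg w hwΩ hαw z hz.1).1

end IsPolygonInterior

end Retraction

/-! ### Crosscuts and uniqueness of arcs -/

section UniqueArcs

namespace IsPolygonInterior

variable {n : ℕ} {Ω B : Set Plane} {v ν : Fin n → Plane}

/-- The disk of a point on a radius to a contact is internally tangent to the disk of `c` at the
contact. So that point lies below `c` in the disk order. -/
theorem mem_segment_nearest (D : IsPolygonInterior Ω B v ν) {c p z : Plane} (hc : c ∈ Ω)
    (hp : p ∈ B) (hcp : dist c p = infDist c B) (hz : z ∈ segment ℝ c p) :
    dist z c + infDist z B ≤ infDist c B ∧ (z ∈ Ω ↔ z ∈ ball c (infDist c B)) := by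
  have h1 := dist_add_dist_of_mem_segment hz
  have h2 : infDist z B ≤ dist z p := infDist_le_dist_of_mem hp
  rw [dist_comm c z] at h1
  refine ⟨by linarith, fun h => ?_, fun h => D.ball_subset hc h⟩
  rw [mem_ball]
  have := D.infDist_pos h
  linarith

theorem inter_segment_eq (D : IsPolygonInterior Ω B v ν) {c p : Plane} (hc : c ∈ Ω)
    (hp : p ∈ B) (hcp : dist c p = infDist c B) :
    Ω ∩ segment ℝ c p = ball c (infDist c B) ∩ segment ℝ c p := by
  ext z
  exact and_congr_left fun hz => (D.mem_segment_nearest hc hp hcp hz).2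

theorem openSegment_subset (D : IsPolygonInterior Ω B v ν) {c p : Plane} (hc : c ∈ Ω)
    (hp : p ∈ B) (hcp : dist c p = infDist c B) : openSegment ℝ c p ⊆ Ω := by
  intro z hz
  have hz' := openSegment_subset_segment ℝ c p hz
  refine (D.mem_segment_nearest hc hp hcp hz').2.2 ?_
  have h1 := dist_add_dist_of_mem_segment hz'
  have hne : z ≠ p := by
    rintro rfl
    rw [right_mem_openSegment_iff] at hz
    exact disjoint_left.1 D.disjoint hc (hz ▸ hp)
  have := dist_pos.2 hne
  rw [mem_ball, dist_comm]
  linarith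

/-- If `T` is a preconnected part of the axis missing `c`, some component of the complement of the
crosscut through `c` misses `T`. -/
theorem exists_dead_side (D : IsPolygonInterior Ω B v ν) {c : Plane} (hc : c ∈ axis Ω B)
    (hcΩ : c ∈ Ω) {T : Set Plane} (hT : IsPreconnected T) (hTa : T ⊆ axis Ω B \ {c}) :
    ∃ Y G : Set Plane, IsOpen Y ∧ Y.Nonempty ∧ IsPreconnected Y ∧ Y ⊆ Ω \ G ∧
      closure Y ∩ Ω ⊆ Y ∪ G ∧ c ∈ G ∧ G ⊆ Ω ∧ IsPreconnected G ∧
      (∀ z ∈ G, dist z c + infDist z B ≤ infDist c B) ∧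
      (∀ H ⊆ Ω \ G, IsPreconnected H → (H ∩ Y).Nonempty → H ⊆ Y) ∧
      (∀ H ⊆ Ω \ G, IsPreconnected H → (H ∩ T).Nonempty → Disjoint H Y) := by
  obtain ⟨p, hp, q, hq, hpq, hcp, hcq⟩ := D.exists_two_nearest hc hcΩ
  set S := segment ℝ c p ∪ segment ℝ c q with hS
  have hScl : IsClosed S := by
    have : ∀ w : Plane, IsClosed (segment ℝ c w) := by
      intro w
      rw [segment_eq_image_lineMap]
      exact (isCompact_Icc.image (by fun_prop)).isClosed
    exact (this p).union (this q)
  have hdisj : Disjoint (openSegment ℝ c p) (openSegment ℝ c q) := by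
    rw [disjoint_left]
    intro z hzp hzq
    have hzc : z ≠ c := by
      rintro rfl
      rw [left_mem_openSegment_iff] at hzp
      exact disjoint_left.1 D.disjoint hcΩ (hzp ▸ hp)
    have e1 := eq_add_smul_of_dist_add_dist (y := p) (z := z) (p := c) (by
      have := dist_add_dist_of_mem_segment (openSegment_subset_segment ℝ c p hzp)
      rw [dist_comm p z, dist_comm z c, dist_comm p c]; linarith) hzc
    have e2 := eq_add_smul_of_dist_add_dist (y := q) (z := z) (p := c) (by
      have := dist_add_dist_of_mem_segment (openSegment_subset_segment ℝ c q hzq)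
      rw [dist_comm q z, dist_comm z c, dist_comm q c]; linarith) hzc
    rw [dist_comm p c, hcp] at e1
    rw [dist_comm q c, hcq] at e2
    exact hpq (e1.trans e2.symm)
  have hcut := D.crosscut c hcΩ p hp q hq (D.openSegment_subset hcΩ hp hcp)
    (D.openSegment_subset hcΩ hq hcq) hdisj
  rw [← hS] at hcut
  have hFo : IsOpen (Ω \ S) := D.isOpen.sdiff hScl
  have hdiff : Ω \ (Ω ∩ S) = Ω \ S := by ext z; simp +contextual
  -- the part of `T` in `Ω` lies in one component
  have hcomp : ∀ x ∈ T, x ∈ Ω → ∀ y ∈ T, y ∈ Ω → y ∈ connectedComponentIn (Ω \ S) x := by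
    -- A point of the crosscut other than `c` is not maximal.
    have hTS : ∀ z ∈ T, z ∉ S := by
      intro z hz hzS
      have hzc : z ≠ c := (hTa hz).2
      have key : ∀ w ∈ B, dist c w = infDist c B → z ∉ segment ℝ c w := by
        intro w hw hcw hzw
        exact hzc ((hTa hz).1.2 c hc.1 (D.mem_segment_nearest hcΩ hw hcw hzw).1).symm
      exact hzS.elim (key p hp hcp) (key q hq hcq)
    intro x hx hxΩ y hy hyΩ
    by_contra hyx
    -- `T` may contain boundary points, which lie in no component of `Ω \ S`. Sort instead by open
    -- sets of the plane whose trace on `Ω` is inside, or disjoint from, the component of `x`; near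
    -- a boundary point off `S` a small ball has connected trace.
    set O₁ := ⋃₀ {V : Set Plane | IsOpen V ∧ V ∩ Ω ⊆ connectedComponentIn (Ω \ S) x}
    set O₂ := ⋃₀ {V : Set Plane | IsOpen V ∧ Disjoint (V ∩ Ω) (connectedComponentIn (Ω \ S) x)}
    have hO₁ : IsOpen O₁ := isOpen_sUnion fun V hV => hV.1
    have hO₂ : IsOpen O₂ := isOpen_sUnion fun V hV => hV.1
    have hdich : ∀ H ⊆ Ω \ S, IsPreconnected H → H ⊆ connectedComponentIn (Ω \ S) x ∨
        Disjoint H (connectedComponentIn (Ω \ S) x) := by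
      intro H hHF hH
      by_cases hd : Disjoint H (connectedComponentIn (Ω \ S) x)
      · exact Or.inr hd
      · obtain ⟨z, hzH, hzx⟩ := not_disjoint_iff.1 hd
        rw [connectedComponentIn_eq hzx]
        exact Or.inl (hH.subset_connectedComponentIn hzH hHF)
    have hself : ∀ z ∈ T, z ∈ Ω → z ∈ connectedComponentIn (Ω \ S) z := fun z hz hzΩ =>
      mem_connectedComponentIn ⟨hzΩ, hTS z hz⟩
    have hcover : T ⊆ O₁ ∪ O₂ := by
      intro z hz
      rcases (hTa hz).1.1 with hzΩ | hzB
      · rcases hdich (connectedComponentIn (Ω \ S) z) (connectedComponentIn_subset _ _)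
          isPreconnected_connectedComponentIn with h | h
        · exact Or.inl ⟨_, ⟨hFo.connectedComponentIn, inter_subset_left.trans h⟩, hself z hz hzΩ⟩
        · exact Or.inr ⟨_, ⟨hFo.connectedComponentIn, h.mono_left inter_subset_left⟩,
            hself z hz hzΩ⟩
      · obtain ⟨δ, hδ, hδS⟩ := Metric.isOpen_iff.1 hScl.isOpen_compl z (hTS z hz)
        obtain ⟨ε, hε, hεδ, hpre⟩ := D.exists_isPreconnected_near hzB hδ
        rw [inter_comm] at hpre
        rcases hdich (ball z ε ∩ Ω) (fun w hw => ⟨hw.2, hδS (ball_subset_ball hεδ hw.1)⟩) hpre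
          with h | h
        · exact Or.inl ⟨_, ⟨isOpen_ball, h⟩, mem_ball_self hε⟩
        · exact Or.inr ⟨_, ⟨isOpen_ball, h⟩, mem_ball_self hε⟩
    have hx₁ : (T ∩ O₁).Nonempty := ⟨x, hx, _, ⟨hFo.connectedComponentIn, inter_subset_left⟩,
      hself x hx hxΩ⟩
    have hy₂ : (T ∩ O₂).Nonempty := by
      refine ⟨y, hy, connectedComponentIn (Ω \ S) y, ⟨hFo.connectedComponentIn, ?_⟩,
        hself y hy hyΩ⟩
      refine Disjoint.mono_left inter_subset_left ?_
      refine (hdich _ (connectedComponentIn_subset _ _)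
        isPreconnected_connectedComponentIn).resolve_left fun h => hyx (h (hself y hy hyΩ))
    obtain ⟨z, hzT, hz₁, hz₂⟩ := hT O₁ O₂ hO₁ hO₂ hcover hx₁ hy₂
    have hzcl : z ∈ closure Ω := by
      rcases (hTa hzT).1.1 with h | h
      · exact subset_closure h
      · exact D.boundary_subset_closure h
    obtain ⟨w, ⟨⟨V₁, hV₁, hw₁⟩, ⟨V₂, hV₂, hw₂⟩⟩, hwΩ⟩ := mem_closure_iff_nhds.1 hzcl (O₁ ∩ O₂)
      ((hO₁.inter hO₂).mem_nhds ⟨hz₁, hz₂⟩)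
    exact disjoint_left.1 hV₂.2 ⟨hw₂, hwΩ⟩ (hV₁.2 ⟨hw₁, hwΩ⟩)
  -- If every component of the cut domain met `T`, there would be only one, against `crosscut`.
  obtain ⟨z, hzF, hzT⟩ : ∃ z ∈ Ω \ S, ∀ x ∈ T, x ∈ Ω → z ∉ connectedComponentIn (Ω \ S) x := by
    by_contra! hcon
    apply hcut
    rcases (T ∩ Ω).eq_empty_or_nonempty with hemp | ⟨x, hxT, hxΩ⟩
    · rcases (Ω \ S).eq_empty_or_nonempty with h | ⟨z, hz⟩
      · rw [h]; exact isPreconnected_empty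
      · obtain ⟨x, hxT, hxΩ, -⟩ := hcon z hz
        exact absurd (show x ∈ T ∩ Ω from ⟨hxT, hxΩ⟩) (by simp [hemp])
    · have : Ω \ S = connectedComponentIn (Ω \ S) x := by
        refine subset_antisymm (fun z hz => ?_) (connectedComponentIn_subset _ _)
        obtain ⟨x', hx'T, hx'Ω, h⟩ := hcon z hz
        rwa [connectedComponentIn_eq (hcomp x hxT hxΩ x' hx'T hx'Ω)]
      rw [this]
      exact isPreconnected_connectedComponentIn
  have hmax : ∀ H ⊆ Ω \ S, IsPreconnected H → (H ∩ connectedComponentIn (Ω \ S) z).Nonempty →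
      H ⊆ connectedComponentIn (Ω \ S) z := by
    rintro H hHF hH ⟨w, hwH, hwz⟩
    rw [connectedComponentIn_eq hwz]
    exact hH.subset_connectedComponentIn hwH hHF
  refine ⟨connectedComponentIn (Ω \ S) z, Ω ∩ S, hFo.connectedComponentIn,
    ⟨z, mem_connectedComponentIn hzF⟩, isPreconnected_connectedComponentIn,
    hdiff ▸ connectedComponentIn_subset _ _, ?_, ⟨hcΩ, Or.inl (left_mem_segment ℝ c p)⟩,
    inter_subset_left, ?_, ?_, ?_, ?_⟩
  · rintro y ⟨hycl, hyΩ⟩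
    by_cases hyS : y ∈ S
    · exact Or.inr ⟨hyΩ, hyS⟩
    · have hyF : y ∈ Ω \ S := ⟨hyΩ, hyS⟩
      left
      obtain ⟨w, hw1, hw2⟩ := mem_closure_iff_nhds.1 hycl (connectedComponentIn (Ω \ S) y)
        (hFo.connectedComponentIn.mem_nhds (mem_connectedComponentIn hyF))
      exact hmax _ (connectedComponentIn_subset _ _) isPreconnected_connectedComponentIn
        ⟨w, hw1, hw2⟩ (mem_connectedComponentIn hyF)
  · rw [hS, inter_union_distrib_left, D.inter_segment_eq hcΩ hp hcp,
      D.inter_segment_eq hcΩ hq hcq]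
    have hcb := mem_ball_self (x := c) (D.infDist_pos hcΩ)
    exact IsPreconnected.union c ⟨hcb, left_mem_segment ℝ c p⟩ ⟨hcb, left_mem_segment ℝ c q⟩
      ((convex_ball c _).inter (convex_segment c p)).isPreconnected
      ((convex_ball c _).inter (convex_segment c q)).isPreconnected
  · rintro y ⟨-, hy | hy⟩
    · exact (D.mem_segment_nearest hcΩ hp hcp hy).1
    · exact (D.mem_segment_nearest hcΩ hq hcq hy).1
  · rw [hdiff]; exact hmax
  · rw [hdiff]
    rintro H hHF hH ⟨x, hxH, hxT⟩
    rw [disjoint_left]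
    intro w hwH hwz
    have h1 := hH.subset_connectedComponentIn hxH hHF hwH
    have h2 : connectedComponentIn (Ω \ S) x = connectedComponentIn (Ω \ S) z :=
      (connectedComponentIn_eq h1).trans (connectedComponentIn_eq hwz).symm
    exact hzT x hxT (hHF hxH).1 (h2 ▸ mem_connectedComponentIn hzF)

/-- A bypass yields a cycle `C` that no interior point of the bypass disconnects. Each such point in
`Ω` has a crosscut with a side avoided by `C`; these sides are disjoint open sets, so they are
countable, while the bypass is uncountable and meets `B` in finitely many points. -/
theorem arc_subset_arc (D : IsPolygonInterior Ω B v ν) {A A' : Set Plane} {u w : Plane}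
    (hA : A ⊆ axis Ω B) (hA' : A' ⊆ axis Ω B) (h : IsArc A u w) (h' : IsArc A' u w) :
    A ⊆ A' := by
  by_contra hne
  obtain ⟨f, s, t, hst, hinj, hfA, hpre⟩ := h.exists_bypass h'.isCompact.isClosed
    h'.isPreconnected h'.left_mem h'.right_mem hne
  set C := f '' Icc s t ∪ A'
  have hCa : C ⊆ axis Ω B := union_subset (hfA.trans hA) hA'
  set I := f '' Ioo s t ∩ Ω
  have hIC : I ⊆ C := fun c hc => Or.inl (image_mono Ioo_subset_Icc_self hc.1)
  have hside : ∀ c : I, _ := fun c => D.exists_dead_side (T := C \ {c.1}) (hCa (hIC c.2)) c.2.2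
    (by obtain ⟨r, hr, hrc⟩ := c.2.1; rw [← hrc]; exact hpre r hr)
    (sdiff_subset_sdiff_left hCa)
  choose Y G hYo hYne hYp hYG hYcl hcG hGΩ hGp hGd hmax hdis using hside
  have hGG : ∀ c c' : I, c ≠ c' → Disjoint (G c) (G c') := by
    intro c c' hcc
    rw [disjoint_left]
    intro z hz hz'
    exact hcc (Subtype.ext (D.axis_unique (hGΩ c hz) (hCa (hIC c.2)) (hCa (hIC c'.2))
      (hGd c z hz) (hGd c' z hz')))
  -- The crosscut at `c'` is connected, misses that at `c` and contains the cycle point `c'`, so it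
  -- lies off the dead side of `c`.
  have hGY : ∀ c c' : I, c ≠ c' → Disjoint (G c') (Y c) := fun c c' hcc =>
    hdis c (G c') (fun z hz => ⟨hGΩ c' hz, disjoint_right.1 (hGG c c' hcc) hz⟩) (hGp c')
      ⟨c', hcG c', hIC c'.2, fun h => hcc (Subtype.ext h).symm⟩
  have hYY : ∀ c c' : I, c ≠ c' → (Y c ∩ Y c').Nonempty → Y c ⊆ Y c' := fun c c' hcc hne =>
    hmax c' (Y c) (fun z hz => ⟨(hYG c hz).1, disjoint_right.1 (hGY c c' hcc) hz⟩) (hYp c) hne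
  -- Dead sides that meet coincide. Their relative boundary then lies in two disjoint crosscuts and
  -- is empty, so the dead side is all of `Ω`, yet it misses its own crosscut.
  have hpd : (univ : Set I).PairwiseDisjoint Y := by
    intro c _ c' _ hcc
    by_contra hd
    obtain ⟨z, hz, hz'⟩ := not_disjoint_iff.1 hd
    have heq : Y c = Y c' := subset_antisymm (hYY c c' hcc ⟨z, hz, hz'⟩)
      (hYY c' c hcc.symm ⟨z, hz', hz⟩)
    have hcl : closure (Y c) ∩ Ω ⊆ Y c := by
      intro y hy
      by_contra hyY
      have h1 := (hYcl c hy).resolve_left hyY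
      have h2 := (hYcl c' (heq ▸ hy)).resolve_left (heq ▸ hyY)
      exact disjoint_left.1 (hGG c c' hcc) h1 h2
    have hΩY : Ω ⊆ Y c := D.isPreconnected.subset_left_of_subset_union (hYo c)
      isClosed_closure.isOpen_compl (disjoint_compl_right.mono_left subset_closure)
      (fun y hy => by
        by_cases h : y ∈ closure (Y c)
        · exact Or.inl (hcl ⟨h, hy⟩)
        · exact Or.inr h)
      ⟨z, (hYG c hz).1, hz⟩
    exact (hYG c (hΩY c.2.2)).2 (hcG c)
  have hIc : I.Countable := by
    have := hpd.countable_of_isOpen (fun c _ => hYo c) fun c _ => hYne c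
    exact countable_univ_iff.1 this
  have hcount : (f '' Ioo s t).Countable := by
    refine (hIc.union ((finite_range v).subset D.axis_inter_boundary_subset).countable).mono ?_
    intro c hc
    have hca : c ∈ axis Ω B := hCa (Or.inl (image_mono Ioo_subset_Icc_self hc))
    exact hca.1.imp (fun h => ⟨hc, h⟩) fun h => ⟨hca, h⟩
  have := countable_of_injective_of_countable_image (hinj.mono Ioo_subset_Icc_self) hcount
  exact Cardinal.Real.Ioo_countable_iff.not.2 (not_le.2 hst) this

theorem axis_nonempty (D : IsPolygonInterior Ω B v ν) : (axis Ω B).Nonempty := by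
  obtain ⟨z, hz⟩ := D.nonempty
  obtain ⟨y, hy, -⟩ := D.exists_mem_axis (Or.inl hz)
  exact ⟨y, hy⟩

end IsPolygonInterior

end UniqueArcs

/-! ### Covering the axis by finitely many arcs -/

section FiniteArcs

namespace IsPolygonInterior

variable {n : ℕ} {Ω B : Set Plane} {v ν : Fin n → Plane}

/-- The centres of the maximal disks touching the boundary at `p s` with inward normal direction
`N s`, as `s` runs over an interval, form an arc. -/
theorem isArc_centres (D : IsPolygonInterior Ω B v ν) {p N : ℝ → Plane} (hp : Continuous p)
    (hN : Continuous N) (hN0 : ∀ s ∈ Icc (0 : ℝ) 1, N s ≠ 0)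
    (hex : ∀ s ∈ Icc (0 : ℝ) 1, ∃ y ∈ axis Ω B, ‖N s‖ • (y - p s) = infDist y B • N s)
    (hinj : ∀ s ∈ Icc (0 : ℝ) 1, ∀ s' ∈ Icc (0 : ℝ) 1, ∀ y ∈ axis Ω B,
      ‖N s‖ • (y - p s) = infDist y B • N s → ‖N s'‖ • (y - p s') = infDist y B • N s' → s = s') :
    ∃ a b, IsArc {y ∈ axis Ω B | ∃ s ∈ Icc (0 : ℝ) 1, ‖N s‖ • (y - p s) = infDist y B • N s}
      a b := by
  have hex' : ∀ s, ∃ y, s ∈ Icc (0 : ℝ) 1 →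
      y ∈ axis Ω B ∧ ‖N s‖ • (y - p s) = infDist y B • N s := by
    intro s
    by_cases hs : s ∈ Icc (0 : ℝ) 1
    · obtain ⟨y, hy⟩ := hex s hs
      exact ⟨y, fun _ => hy⟩
    · exact ⟨p s, fun h => absurd h hs⟩
  choose y hy using hex'
  have huniq : ∀ s ∈ Icc (0 : ℝ) 1, ∀ z ∈ axis Ω B, ‖N s‖ • (z - p s) = infDist z B • N s →
      z = y s := by
    intro s hs z hz hzs
    have hpos : 0 < ‖N s‖ := norm_pos_iff.2 (hN0 s hs)
    -- The auxiliary point at distance 1 from `p s` makes the ray parameter equal to the radius, as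
    -- `eq_of_ray` requires.
    have key : ∀ w, ‖N s‖ • (w - p s) = infDist w B • N s →
        w = p s + infDist w B • ((p s + ‖N s‖⁻¹ • N s) - p s) := by
      intro w hw
      rw [add_sub_cancel_left, smul_comm, ← hw, inv_smul_smul₀ hpos.ne']
      abel
    have hd : dist (p s + ‖N s‖⁻¹ • N s) (p s) = 1 := by
      rw [dist_self_add_left, norm_smul, norm_inv, norm_norm, inv_mul_cancel₀ hpos.ne']
    exact eq_of_ray hz (hy s hs).1 (key z hzs) (key _ (hy s hs).2) (by rw [hd, mul_one])
      (by rw [hd, mul_one])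
  have hG : IsClosed {x : ℝ × Plane | ‖N x.1‖ • (x.2 - p x.1) = infDist x.2 B • N x.1} := by
    have := continuous_infDist_pt B
    exact isClosed_eq (by fun_prop) (by fun_prop)
  have hcont : ContinuousOn y (Icc 0 1) := fun s hs =>
    tendsto_of_isClosed_graph D.isCompact_axis hG (fun x hx => (hy x hx).1)
      (fun x hx => (hy x hx).2) fun z hz h => huniq s hs z hz h
  have himg : {y ∈ axis Ω B | ∃ s ∈ Icc (0 : ℝ) 1, ‖N s‖ • (y - p s) = infDist y B • N s} =
      y '' Icc 0 1 := by
    apply subset_antisymm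
    · rintro z ⟨hz, s, hs, h⟩
      exact ⟨s, hs, (huniq s hs z hz h).symm⟩
    · rintro _ ⟨s, hs, rfl⟩
      exact ⟨(hy s hs).1, s, hs, (hy s hs).2⟩
  rw [himg]
  refine ⟨_, _, isArc_image_Icc zero_le_one hcont fun s hs s' hs' h => ?_⟩
  exact hinj s hs s' hs' (y s) (hy s hs).1 (hy s hs).2 (by rw [h]; exact (hy s' hs').2)

theorem vertex_mem (D : IsPolygonInterior Ω B v ν) (i : Fin n) : v i ∈ B := by
  rw [D.boundary_eq]
  exact mem_iUnion.2 ⟨i, left_mem_segment ℝ _ _⟩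

/-- The centres of the maximal disks touching the closed edge `i` orthogonally. -/
def edgeCentres (Ω B : Set Plane) (v ν : Fin n → Plane) (i : Fin n) : Set Plane :=
  {y ∈ axis Ω B | ∃ s ∈ Icc (0 : ℝ) 1,
    ‖ν i‖ • (y - AffineMap.lineMap (v i) (v (finRotate n i)) s) = infDist y B • ν i}

/-- The centres of the maximal disks touching the vertex after the edge `i` from within the cone
of inward normals. -/
def fanCentres (Ω B : Set Plane) (v ν : Fin n → Plane) (i : Fin n) : Set Plane :=
  {y ∈ axis Ω B | ∃ s ∈ Icc (0 : ℝ) 1,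
    ‖(1 - s) • ν i + s • ν (finRotate n i)‖ • (y - v (finRotate n i)) =
      infDist y B • ((1 - s) • ν i + s • ν (finRotate n i))}

/-- Every point of the closed edge, ends included, is a contact with normal `ν i` for exactly one
maximal disk. At a convex end this is the disk of radius 0, whose contact equation holds trivially.
-/
theorem isArc_edgeCentres (D : IsPolygonInterior Ω B v ν) (i : Fin n) :
    ∃ a b, IsArc (edgeCentres Ω B v ν i) a b := by
  have hpush : ∀ p ∈ B, ∀ a b, (a = ν i ∨ b = ν i) → ReflexAt Ω B p a b →
      ∃ y ∈ axis Ω B, ‖ν i‖ • (y - p) = infDist y B • ν i := by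
    intro p hp a b hab h
    obtain ⟨y, hy, -, hyp⟩ := D.exists_axis_ray hp (D.norm_normal i)
      (D.exists_push_of_reflexAt hp h (D.norm_normal i)
        (fun w h1 h2 => by rcases hab with rfl | rfl <;> assumption)
        (by
          have : 0 < ⟪ν i, ν i⟫ := by
            rw [real_inner_self_eq_norm_sq, D.norm_normal i]; norm_num
          rcases hab with rfl | rfl
          · exact Or.inl this
          · exact Or.inr this))
    refine ⟨y, hy, ?_⟩
    rw [D.norm_normal i, one_smul, sub_eq_iff_eq_add']
    exact hyp
  have hvert : ∀ j, (ν j = ν i ∨ ν (finRotate n j) = ν i) →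
      ∃ y ∈ axis Ω B, ‖ν i‖ • (y - v (finRotate n j)) = infDist y B • ν i := by
    intro j hj
    rcases D.vertex j with ⟨hne, h⟩ | h
    · refine ⟨v (finRotate n j), D.mem_axis_of_convexAt (D.vertex_mem _) (D.norm_normal _)
        (D.norm_normal _) hne h, ?_⟩
      rw [infDist_zero_of_mem (D.vertex_mem _)]
      simp
    · exact hpush _ (D.vertex_mem _) _ _ hj h
  refine D.isArc_centres (p := fun s => AffineMap.lineMap (v i) (v (finRotate n i)) s)
    (N := fun _ => ν i) (by fun_prop) continuous_const
    (fun s _ h => by simpa [h] using D.norm_normal i) (fun s hs => ?_) ?_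
  · rcases hs.1.eq_or_lt with rfl | h0
    · have := hvert ((finRotate n).symm i) (Or.inr (by rw [Equiv.apply_symm_apply]))
      rw [Equiv.apply_symm_apply] at this
      simpa only [AffineMap.lineMap_apply_zero] using this
    rcases hs.2.eq_or_lt with rfl | h1
    · simpa only [AffineMap.lineMap_apply_one] using hvert i (Or.inl rfl)
    have hmem : AffineMap.lineMap (v i) (v (finRotate n i)) s ∈
        openSegment ℝ (v i) (v (finRotate n i)) := by
      rw [openSegment_eq_image_lineMap]
      exact ⟨s, ⟨h0, h1⟩, rfl⟩
    refine hpush _ ?_ _ _ (Or.inl rfl) (D.edge i _ hmem)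
    rw [D.boundary_eq]
    exact mem_iUnion.2 ⟨i, openSegment_subset_segment ℝ _ _ hmem⟩
  · intro s _ s' _ y _ h h'
    have h2 : AffineMap.lineMap (v i) (v (finRotate n i)) s =
        AffineMap.lineMap (v i) (v (finRotate n i)) s' := by
      have := h.trans h'.symm
      simp only [D.norm_normal i, one_smul] at this
      exact sub_right_injective this
    exact AffineMap.lineMap_injective ℝ (D.vertex_ne i) h2

/-- At a reflex vertex the possible normals fill the cone between the two edge normals, and linear
interpolation runs through their directions once. -/
theorem isArc_fanCentres (D : IsPolygonInterior Ω B v ν) (i : Fin n)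
    (hne : ν i ≠ ν (finRotate n i))
    (h : ReflexAt Ω B (v (finRotate n i)) (ν i) (ν (finRotate n i))) :
    ∃ a b, IsArc (fanCentres Ω B v ν i) a b := by
  set a := ν i
  set b := ν (finRotate n i)
  set p := v (finRotate n i)
  have ha : ‖a‖ = 1 := D.norm_normal _
  have hb : ‖b‖ = 1 := D.norm_normal _
  have haa : ⟪a, a⟫ = 1 := by rw [real_inner_self_eq_norm_sq, ha]; norm_num
  have hbb : ⟪b, b⟫ = 1 := by rw [real_inner_self_eq_norm_sq, hb]; norm_num
  have hab := D.normal_add i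
  obtain ⟨h1, h2⟩ := inner_add_pos ha hb hab
  rw [inner_add_right, haa] at h1
  have hlt : ⟪a, b⟫ < 1 := by
    have := inner_lt_one_iff_real_of_norm_eq_one ha hb
    exact this.2 hne
  have hba : ⟪b, a⟫ = ⟪a, b⟫ := real_inner_comm _ _
  have hpB : p ∈ B := D.vertex_mem _
  have hN0 : ∀ s ∈ Icc (0 : ℝ) 1, (1 - s) • a + s • b ≠ 0 := by
    intro s hs h0
    have e1 : ⟪a, (1 - s) • a + s • b⟫ = 0 := by rw [h0, inner_zero_right]
    have e2 : ⟪b, (1 - s) • a + s • b⟫ = 0 := by rw [h0, inner_zero_right]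
    simp only [inner_add_right, inner_smul_right, haa, hbb, hba] at e1 e2
    nlinarith
  refine D.isArc_centres (p := fun _ => p) (N := fun s => (1 - s) • a + s • b) continuous_const
    (by fun_prop) hN0 (fun s hs => ?_) ?_
  · set N := (1 - s) • a + s • b with hNdef
    have hpos : 0 < ‖N‖ := norm_pos_iff.2 (hN0 s hs)
    have hN1 : ‖‖N‖⁻¹ • N‖ = 1 := by
      rw [norm_smul, norm_inv, norm_norm, inv_mul_cancel₀ hpos.ne']
    obtain ⟨y, hy, -, hyp⟩ := D.exists_axis_ray hpB hN1 (D.exists_push_of_reflexAt hpB h hN1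
      (fun w hw1 hw2 => by
        rw [inner_smul_left, hNdef, inner_add_left, inner_smul_left, inner_smul_left]
        simp only [conj_trivial]
        have e1 := mul_nonpos_of_nonneg_of_nonpos (sub_nonneg.2 hs.2) hw1
        have e2 := mul_nonpos_of_nonneg_of_nonpos hs.1 hw2
        exact mul_nonpos_of_nonneg_of_nonpos (by positivity) (by linarith))
      (by
        by_contra! hcon
        obtain ⟨c1, c2⟩ := hcon
        rw [inner_smul_right] at c1 c2
        have d1 := nonpos_of_mul_nonpos_right c1 (inv_pos.2 hpos)
        have d2 := nonpos_of_mul_nonpos_right c2 (inv_pos.2 hpos)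
        rw [hNdef] at d1 d2
        simp only [inner_add_right, inner_smul_right, haa, hbb, hba] at d1 d2
        nlinarith))
    refine ⟨y, hy, ?_⟩
    have e : y - p = infDist y B • ‖N‖⁻¹ • N := by
      rw [sub_eq_iff_eq_add']
      exact hyp
    rw [e, smul_comm (infDist y B), smul_inv_smul₀ hpos.ne']
  · intro s hs s' hs' y hy hys hys'
    have hyp : y ≠ p := by
      rintro rfl
      exact D.notMem_axis_of_reflexAt hpB ha h hy
    have hd : infDist y B ≠ 0 := by
      intro h0
      rw [h0, zero_smul, smul_eq_zero, sub_eq_zero] at hys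
      exact hys.elim (fun h => hN0 s hs (norm_eq_zero.1 h)) hyp
    set N := (1 - s) • a + s • b with hNdef
    set N' := (1 - s') • a + s' • b with hNdef'
    have key : ‖N'‖ • N = ‖N‖ • N' := by
      apply smul_right_injective _ hd
      change infDist y B • ‖N'‖ • N = infDist y B • ‖N‖ • N'
      rw [smul_comm, ← hys, smul_comm (infDist y B), ← hys', smul_comm]
    have e1 : ‖N'‖ * ⟪a, N⟫ = ‖N‖ * ⟪a, N'⟫ := by
      rw [← inner_smul_right, key, inner_smul_right]
    have e2 : ‖N'‖ * ⟪b, N⟫ = ‖N‖ * ⟪b, N'⟫ := by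
      rw [← inner_smul_right, key, inner_smul_right]
    rw [hNdef, hNdef'] at e1 e2
    simp only [inner_add_right, inner_smul_right, haa, hbb, hba] at e1 e2
    rw [← hNdef, ← hNdef'] at e1 e2
    have hg : 0 < 1 - ⟪a, b⟫ := by linarith
    -- ⟪a, N⟫ + ⟪b, N⟫ = 1 + ⟪a, b⟫ does not depend on s, so parallel normals have equal norm; then
    -- ⟪a, N⟫ = 1 - s(1 - ⟪a, b⟫) determines s.
    have f1 : ‖N'‖ = ‖N‖ := by
      have : ‖N'‖ * (1 + ⟪a, b⟫) = ‖N‖ * (1 + ⟪a, b⟫) := by linarith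
      exact mul_right_cancel₀ h1.ne' this
    have hpos : 0 < ‖N‖ := norm_pos_iff.2 (hN0 s hs)
    rw [f1] at e1
    have f2 := mul_left_cancel₀ hpos.ne' e1
    have f3 : s * (1 - ⟪a, b⟫) = s' * (1 - ⟪a, b⟫) := by linarith
    exact mul_right_cancel₀ hg.ne' f3

/-- Farkas' lemma in the plane. Cramer's rule gives the coefficients, and a negative one is refuted
by a vector orthogonal to the other generator. -/
theorem exists_cone_of_inner_pos {a b e : Plane} (ha : ‖a‖ = 1) (hb : ‖b‖ = 1) (hab : a + b ≠ 0)
    (hne : a ≠ b) (h : ∀ w, 0 < ⟪w, e⟫ → 0 < ⟪a, w⟫ ∨ 0 < ⟪b, w⟫) :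
    ∃ α β : ℝ, 0 ≤ α ∧ 0 ≤ β ∧ e = α • a + β • b := by
  have ha' : a 0 * a 0 + a 1 * a 1 = 1 := by
    rw [← inner_coord, real_inner_self_eq_norm_sq, ha]; norm_num
  have hb' : b 0 * b 0 + b 1 * b 1 = 1 := by
    rw [← inner_coord, real_inner_self_eq_norm_sq, hb]; norm_num
  set k := a 0 * b 1 - a 1 * b 0 with hk
  have hk0 : k ≠ 0 := by
    intro h0
    have hpos := (inner_add_pos ha hb hab).1
    rw [inner_add_right, real_inner_self_eq_norm_sq, ha] at hpos
    have hlt := (inner_lt_one_iff_real_of_norm_eq_one ha hb).2 hne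
    rw [inner_coord] at hpos hlt
    have : k ^ 2 + (a 0 * b 0 + a 1 * b 1) ^ 2 = 1 := by
      rw [hk]
      calc _ = (a 0 * a 0 + a 1 * a 1) * (b 0 * b 0 + b 1 * b 1) := by ring
        _ = 1 := by rw [ha', hb']; norm_num
    rw [h0] at this
    nlinarith
  refine ⟨(e 0 * b 1 - e 1 * b 0) / k, (a 0 * e 1 - a 1 * e 0) / k, ?_, ?_, ?_⟩
  · by_contra! hneg
    -- This vector has inner product -1 with `a`, 0 with `b`, and minus the first coefficient with
    -- `e`.
    have := h (k⁻¹ • rot b) (by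
      rw [inner_coord]
      simp only [PiLp.smul_apply, rot_zero_coord, rot_one_coord, smul_eq_mul]
      have : k⁻¹ * -b 1 * e 0 + k⁻¹ * b 0 * e 1 = -((e 0 * b 1 - e 1 * b 0) / k) := by
        field_simp; ring
      linarith)
    simp only [inner_coord, PiLp.smul_apply, rot_zero_coord, rot_one_coord, smul_eq_mul] at this
    have e1 : a 0 * (k⁻¹ * -b 1) + a 1 * (k⁻¹ * b 0) = -1 := by
      have : a 0 * (k⁻¹ * -b 1) + a 1 * (k⁻¹ * b 0) = -(k⁻¹ * k) := by rw [hk]; ring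
      rw [this, inv_mul_cancel₀ hk0]
    have e2 : b 0 * (k⁻¹ * -b 1) + b 1 * (k⁻¹ * b 0) = 0 := by ring
    rw [e1, e2] at this
    norm_num at this
  · by_contra! hneg
    have := h (-k⁻¹ • rot a) (by
      rw [inner_coord]
      simp only [PiLp.smul_apply, rot_zero_coord, rot_one_coord, smul_eq_mul]
      have : -k⁻¹ * -a 1 * e 0 + -k⁻¹ * a 0 * e 1 = -((a 0 * e 1 - a 1 * e 0) / k) := by
        field_simp; ring
      linarith)
    simp only [inner_coord, PiLp.smul_apply, rot_zero_coord, rot_one_coord, smul_eq_mul] at this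
    have e1 : b 0 * (-k⁻¹ * -a 1) + b 1 * (-k⁻¹ * a 0) = -1 := by
      have : b 0 * (-k⁻¹ * -a 1) + b 1 * (-k⁻¹ * a 0) = -(k⁻¹ * k) := by rw [hk]; ring
      rw [this, inv_mul_cancel₀ hk0]
    have e2 : a 0 * (-k⁻¹ * -a 1) + a 1 * (-k⁻¹ * a 0) = 0 := by ring
    rw [e1, e2] at this
    norm_num at this
  · ext j
    fin_cases j
    · simp only [PiLp.add_apply, PiLp.smul_apply, smul_eq_mul, Fin.zero_eta, Fin.isValue]
      field_simp
      rw [hk]; ring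
    · simp only [PiLp.add_apply, PiLp.smul_apply, smul_eq_mul, Fin.mk_one, Fin.isValue]
      field_simp
      rw [hk]; ring

theorem mem_centres_of_nearest_vertex (D : IsPolygonInterior Ω B v ν) {y : Plane}
    (hy : y ∈ axis Ω B) (hyΩ : y ∈ Ω) {i : Fin n}
    (hd : dist y (v (finRotate n i)) = infDist y B) :
    ReflexAt Ω B (v (finRotate n i)) (ν i) (ν (finRotate n i)) ∧
      (ν i = ν (finRotate n i) ∧ y ∈ edgeCentres Ω B v ν i ∨
        ν i ≠ ν (finRotate n i) ∧ y ∈ fanCentres Ω B v ν i) := by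
  have href : ReflexAt Ω B (v (finRotate n i)) (ν i) (ν (finRotate n i)) :=
    (D.vertex i).resolve_left fun h =>
      D.not_convexAt_of_nearest hyΩ hd (D.norm_normal _) (D.norm_normal _) h.1 h.2
  have hin := D.inner_pos_of_nearest hyΩ hd href
  rw [dist_eq_norm] at hd
  refine ⟨href, ?_⟩
  by_cases hne : ν i = ν (finRotate n i)
  · refine Or.inl ⟨hne, hy, 1, ⟨zero_le_one, le_rfl⟩, ?_⟩
    have := eq_smul_of_inner_pos (D.norm_normal i) fun w hw => (hin w hw).elim id fun h => by
      rw [hne]; exact h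
    rw [AffineMap.lineMap_apply_one, D.norm_normal i, one_smul, ← hd]
    exact this
  · refine Or.inr ⟨hne, hy, ?_⟩
    obtain ⟨α, β, hα, hβ, he⟩ := exists_cone_of_inner_pos (D.norm_normal i) (D.norm_normal _)
      (D.normal_add i) hne hin
    have hsum : 0 < α + β := by
      refine lt_of_le_of_ne (by positivity) fun h0 => ?_
      obtain rfl : α = 0 := by linarith
      obtain rfl : β = 0 := by linarith
      rw [zero_smul, zero_smul, add_zero] at he
      have := D.infDist_pos hyΩ
      rw [← hd, he, norm_zero] at this
      exact lt_irrefl _ this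
    have e1 : 1 - β / (α + β) = α / (α + β) := by field_simp; ring
    refine ⟨β / (α + β), ⟨by positivity, by rw [div_le_one hsum]; linarith⟩, ?_⟩
    have e2 : y - v (finRotate n i) = (α + β) •
        ((1 - β / (α + β)) • ν i + (β / (α + β)) • ν (finRotate n i)) := by
      rw [he, e1, smul_add, smul_smul, smul_smul, mul_div_cancel₀ _ hsum.ne',
        mul_div_cancel₀ _ hsum.ne']
    rw [← hd, e2, norm_smul, Real.norm_eq_abs, abs_of_pos hsum, smul_smul, mul_comm]

theorem exists_finite_arcs (D : IsPolygonInterior Ω B v ν) :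
    ∃ F : Set (Set Plane), F.Finite ∧ (∀ A ∈ F, ∃ a b, IsArc A a b) ∧ ⋃₀ F = axis Ω B := by
  refine ⟨range (edgeCentres Ω B v ν) ∪ fanCentres Ω B v ν '' {i | ν i ≠ ν (finRotate n i) ∧
    ReflexAt Ω B (v (finRotate n i)) (ν i) (ν (finRotate n i))},
    (finite_range _).union ((toFinite _).image _), ?_, ?_⟩
  · rintro _ (⟨i, rfl⟩ | ⟨i, hi, rfl⟩)
    · exact D.isArc_edgeCentres i
    · exact D.isArc_fanCentres i hi.1 hi.2
  · apply subset_antisymm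
    · rintro y ⟨_, ⟨i, rfl⟩ | ⟨i, hi, rfl⟩, hy⟩
      · exact hy.1
      · exact hy.1
    · intro y hy
      rcases hy.1 with hyΩ | hyB
      · obtain ⟨p, hp, hyp⟩ := D.exists_nearest y
        have hvert : ∀ i, p = v (finRotate n i) → y ∈ ⋃₀ (range (edgeCentres Ω B v ν) ∪
            fanCentres Ω B v ν '' {i | ν i ≠ ν (finRotate n i) ∧
              ReflexAt Ω B (v (finRotate n i)) (ν i) (ν (finRotate n i))}) := by
          rintro i rfl
          obtain ⟨href, ⟨-, h⟩ | ⟨hne, h⟩⟩ := D.mem_centres_of_nearest_vertex hy hyΩ hyp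
          · exact ⟨_, Or.inl ⟨i, rfl⟩, h⟩
          · exact ⟨_, Or.inr ⟨i, ⟨hne, href⟩, rfl⟩, h⟩
        rw [D.boundary_eq, mem_iUnion] at hp
        obtain ⟨i, hi⟩ := hp
        rw [← insert_endpoints_openSegment] at hi
        rcases hi with rfl | rfl | hi
        · exact hvert ((finRotate n).symm i) (by rw [Equiv.apply_symm_apply])
        · exact hvert i rfl
        · refine ⟨_, Or.inl ⟨i, rfl⟩, hy, ?_⟩
          have hin := D.inner_pos_of_nearest hyΩ hyp (D.edge i p hi)
          have := eq_smul_of_inner_pos (D.norm_normal i) fun w hw => (hin w hw).elim id id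
          rw [openSegment_eq_image_lineMap] at hi
          obtain ⟨s, hs, rfl⟩ := hi
          refine ⟨s, Ioo_subset_Icc_self hs, ?_⟩
          rw [D.norm_normal i, one_smul, ← hyp, dist_eq_norm]
          exact this
      -- A disk of radius 0 sits at a vertex, and is counted at parameter 0 of the edge starting
      -- there.
      · obtain ⟨i, rfl⟩ := D.axis_inter_boundary_subset ⟨hy, hyB⟩
        refine ⟨_, Or.inl ⟨i, rfl⟩, hy, 0, ⟨le_rfl, zero_le_one⟩, ?_⟩
        rw [infDist_zero_of_mem hyB]
        simp

theorem isTree_axis (D : IsPolygonInterior Ω B v ν) : IsTree (axis Ω B) := by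
  obtain ⟨F, hF, harc, hU⟩ := D.exists_finite_arcs
  refine ⟨D.axis_nonempty, ⟨F, hF, harc, hU⟩, fun u hu w hw => ?_⟩
  obtain ⟨A, hA, h⟩ := exists_isArc_of_isPreconnected hF harc hU D.isPreconnected_axis hu hw
  exact ⟨A, ⟨hA, h⟩, fun A' h' => subset_antisymm (D.arc_subset_arc h'.1 hA h'.2 h)
    (D.arc_subset_arc hA h'.1 h h'.2)⟩

/-- A point common to two maximal disks lies in all those centred on the arc between them. -/
theorem dist_le_of_mem_arc (D : IsPolygonInterior Ω B v ν) {u w x α : Plane} {A : Set Plane}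
    (hA : A ⊆ axis Ω B) (h : IsArc A u w) (hαu : dist α u ≤ infDist u B)
    (hαw : dist α w ≤ infDist w B) (hx : x ∈ A) : dist α x ≤ infDist x B := by
  by_contra! hlt
  obtain ⟨F, hF, harc, hU⟩ := D.exists_finite_arcs
  obtain ⟨T, hTx, hT, huT, hwT⟩ :=
    D.exists_isPreconnected_avoiding (hA h.left_mem) (hA h.right_mem) hαu hαw hlt
  obtain ⟨A', hA', h'⟩ := exists_isArc_diff_singleton hF harc hU x hTx hT huT hwT
  exact (hA' (D.arc_subset_arc hA (hA'.trans sdiff_subset) h h' hx)).2 rfl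

end IsPolygonInterior

end FiniteArcs

/-! ### The two sides of a corner -/

section Sides

@[simp] theorem rot_smul (c : ℝ) (u : Plane) : rot (c • u) = c • rot u := by
  ext j; fin_cases j <;> simp

theorem inner_rot_rot (u w : Plane) : ⟪rot u, rot w⟫ = ⟪u, w⟫ := by
  simp only [inner_coord, rot_zero_coord, rot_one_coord]; ring

theorem inner_rot_self (u : Plane) : ⟪rot u, u⟫ = 0 := by
  simp only [inner_coord, rot_zero_coord, rot_one_coord]; ring

theorem inner_rot_swap (u w : Plane) : ⟪rot u, w⟫ = -⟪rot w, u⟫ := by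
  simp only [inner_coord, rot_zero_coord, rot_one_coord]; ring

theorem norm_rot (u : Plane) : ‖rot u‖ = ‖u‖ := by
  rw [← sq_eq_sq₀ (norm_nonneg _) (norm_nonneg _), ← real_inner_self_eq_norm_sq,
    ← real_inner_self_eq_norm_sq, inner_rot_rot]

theorem rot_add (u w : Plane) : rot (u + w) = rot u + rot w := by
  ext j; fin_cases j
  · simp; ring
  · simp

theorem rot_eq_zero {u : Plane} : rot u = 0 ↔ u = 0 := by
  rw [← norm_eq_zero, norm_rot, norm_eq_zero]

/-- The left side (`σ = 1`) or the right side (`σ = -1`) of the path that arrives at the origin in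
direction `u` and leaves it in direction `u'`. -/
def Side (σ : ℝ) (u u' x : Plane) : Prop :=
  -- The path turns towards the side σ exactly when this is positive; that side is then the sector
  -- of angle less than π. A straight path takes the union, of two equal half-planes.
  if 0 < σ * ⟪rot u, u'⟫ then 0 < ⟪σ • rot u, x⟫ ∧ 0 < ⟪σ • rot u', x⟫
  else 0 < ⟪σ • rot u, x⟫ ∨ 0 < ⟪σ • rot u', x⟫

theorem eq_of_inner_rot_eq_zero {u u' : Plane} (hu : ‖u‖ = 1) (hu' : ‖u'‖ = 1) (hne : u + u' ≠ 0)
    (h : ⟪rot u, u'⟫ = 0) : u' = u := by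
  have h1 : ⟪u, u'⟫ ^ 2 + ⟪rot u, u'⟫ ^ 2 = ⟪u, u⟫ * ⟪u', u'⟫ := by
    simp only [inner_coord, rot_zero_coord, rot_one_coord]; ring
  rw [h, real_inner_self_eq_norm_sq, real_inner_self_eq_norm_sq, hu, hu'] at h1
  have h2 := (inner_add_pos hu hu' hne).1
  rw [inner_add_right, real_inner_self_eq_norm_sq, hu] at h2
  have h3 : ⟪u, u'⟫ = 1 := by nlinarith
  exact ((inner_eq_one_iff_of_norm_eq_one hu hu').1 h3).symm

/-- Negation reverses the inequalities and swaps conjunction with disjunction, as does the sign test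
in `Side`. On a straight path both sides use the disjunction, which is harmless because `u' = u`. -/
theorem not_side_neg_iff {σ : ℝ} (hσ : σ = 1 ∨ σ = -1) {u u' : Plane} (hu : ‖u‖ = 1)
    (hu' : ‖u'‖ = 1) (hne : u + u' ≠ 0) (x : Plane) :
    ¬ Side (-σ) u u' x ↔ if 0 < σ * ⟪rot u, u'⟫ then 0 ≤ ⟪σ • rot u, x⟫ ∧ 0 ≤ ⟪σ • rot u', x⟫
      else 0 ≤ ⟪σ • rot u, x⟫ ∨ 0 ≤ ⟪σ • rot u', x⟫ := by
  unfold Side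
  simp only [neg_smul, inner_neg_left, neg_mul, Left.neg_pos_iff]
  have hσ0 : σ ≠ 0 := by rcases hσ with rfl | rfl <;> norm_num
  rcases lt_trichotomy (σ * ⟪rot u, u'⟫) 0 with h | h | h
  · rw [if_pos h, if_neg h.le.not_gt]
    push Not
    constructor
    · intro h'
      by_contra! hc
      exact absurd (h' hc.1) (not_le.2 hc.2)
    · rintro (h' | h') h''
      · exact absurd h' (not_le.2 h'')
      · exact h'
  · rw [if_neg (by rw [h]; exact lt_irrefl _), if_neg (by rw [h]; exact lt_irrefl _)]
    obtain rfl := eq_of_inner_rot_eq_zero hu hu' hne ((mul_eq_zero.1 h).resolve_left hσ0)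
    simp
  · rw [if_neg h.le.not_gt, if_pos h]
    push Not
    rfl

theorem not_side_and_side {σ : ℝ} (hσ : σ = 1 ∨ σ = -1) {u u' : Plane} (hu : ‖u‖ = 1)
    (hu' : ‖u'‖ = 1) (hne : u + u' ≠ 0) {x : Plane} (h : Side σ u u' x) : ¬ Side (-σ) u u' x := by
  rw [not_side_neg_iff hσ hu hu' hne]
  unfold Side at h
  split_ifs at h ⊢
  · exact ⟨h.1.le, h.2.le⟩
  · exact h.imp le_of_lt le_of_lt

/-- A corner splits the plane into its two rays and its two sides. The coefficients of `x` in the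
basis `u`, `u'` are, up to the factor κ, the inner products that define the sides. -/
theorem ray_iff_not_side {u u' : Plane} (hu : ‖u‖ = 1) (hu' : ‖u'‖ = 1) (hne : u + u' ≠ 0)
    (x : Plane) : ((∃ s ≥ (0 : ℝ), x = -(s • u)) ∨ ∃ s ≥ (0 : ℝ), x = s • u') ↔
      ¬ Side 1 u u' x ∧ ¬ Side (-1) u u' x := by
  rw [not_side_neg_iff (Or.inl rfl) hu hu' hne]
  unfold Side
  simp only [one_smul, one_mul]
  set κ := ⟪rot u, u'⟫ with hκ
  by_cases hκ0 : κ = 0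
  · obtain rfl := eq_of_inner_rot_eq_zero hu hu' hne hκ0
    simp only [hκ0, lt_irrefl, if_false, or_self, not_lt]
    have hrep : x = ⟪u', x⟫ • u' + ⟪rot u', x⟫ • rot u' := by
      have h1 : u' 0 * u' 0 + u' 1 * u' 1 = 1 := by
        rw [← inner_coord, real_inner_self_eq_norm_sq, hu]; norm_num
      ext j
      fin_cases j
      · simp [inner_coord]
        linear_combination (-x 0) * h1
      · simp [inner_coord]
        linear_combination (-x 1) * h1
    constructor
    · rintro (⟨s, -, rfl⟩ | ⟨s, -, rfl⟩) <;> simp [inner_rot_self, inner_smul_right]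
    · rintro ⟨h1, h2⟩
      have h0 := le_antisymm h1 h2
      rw [h0, zero_smul, add_zero] at hrep
      rcases le_total 0 ⟪u', x⟫ with h | h
      · exact Or.inr ⟨_, h, hrep⟩
      · exact Or.inl ⟨-⟪u', x⟫, by linarith, by rw [neg_smul, neg_neg]; exact hrep⟩
  · have hrep : κ • x = (-⟪rot u', x⟫) • u + ⟪rot u, x⟫ • u' := by
      rw [hκ]
      ext j
      fin_cases j <;> simp [inner_coord] <;> ring
    have hx : ∀ α β : ℝ, ⟪rot u', x⟫ = -(κ * α) → ⟪rot u, x⟫ = κ * β → x = α • u + β • u' := by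
      intro α β h1 h2
      apply smul_right_injective _ hκ0
      change κ • x = κ • (α • u + β • u')
      rw [hrep, h1, h2, neg_neg, smul_add, smul_smul, smul_smul]
    have hswap : ⟪rot u', u⟫ = -κ := by rw [inner_rot_swap]
    constructor
    · rintro (⟨s, hs, rfl⟩ | ⟨s, hs, rfl⟩)
      · simp only [inner_neg_right, inner_smul_right, inner_rot_self, hswap]
        rcases lt_or_gt_of_ne hκ0 with h | h
        · rw [if_neg h.le.not_gt, if_neg h.le.not_gt]
          have := mul_nonneg hs (neg_nonneg.2 h.le)
          refine ⟨?_, Or.inl (by simp)⟩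
          rintro (h' | h') <;> linarith
        · rw [if_pos h, if_pos h]
          have := mul_nonneg hs h.le
          exact ⟨fun h' => by linarith [h'.1], by simp, by linarith⟩
      · simp only [inner_smul_right, inner_rot_self, ← hκ]
        rcases lt_or_gt_of_ne hκ0 with h | h
        · rw [if_neg h.le.not_gt, if_neg h.le.not_gt]
          have := mul_nonneg hs (neg_nonneg.2 h.le)
          refine ⟨?_, Or.inr (by simp)⟩
          rintro (h' | h') <;> linarith
        · rw [if_pos h, if_pos h]
          have := mul_nonneg hs h.le
          exact ⟨fun h' => by linarith [h'.2], by linarith, by simp⟩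
    · have hfin : ∀ c c' : ℝ, ⟪rot u, x⟫ = c → ⟪rot u', x⟫ = c' → (c = 0 ∧ 0 ≤ c' / κ) ∨
          (c' = 0 ∧ 0 ≤ c / κ) → (∃ s ≥ (0 : ℝ), x = -(s • u)) ∨ ∃ s ≥ (0 : ℝ), x = s • u' := by
        rintro c c' hc hc' (⟨rfl, h⟩ | ⟨rfl, h⟩)
        · refine Or.inl ⟨c' / κ, h, ?_⟩
          have := hx (-(c' / κ)) 0 (by rw [hc']; field_simp) (by rw [hc, mul_zero])
          rw [this]; module
        · refine Or.inr ⟨c / κ, h, ?_⟩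
          have := hx 0 (c / κ) (by rw [hc', mul_zero, neg_zero]) (by rw [hc]; field_simp)
          rw [this]; module
      rcases lt_or_gt_of_ne hκ0 with h | h
      · rw [if_neg h.le.not_gt, if_neg h.le.not_gt]
        rintro ⟨h1, h2⟩
        push Not at h1
        refine hfin _ _ rfl rfl ?_
        rcases h2 with h2 | h2
        · exact Or.inl ⟨le_antisymm h1.1 h2, div_nonneg_of_nonpos h1.2 h.le⟩
        · exact Or.inr ⟨le_antisymm h1.2 h2, div_nonneg_of_nonpos h1.1 h.le⟩
      · rw [if_pos h, if_pos h]
        rintro ⟨h1, h2, h3⟩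
        push Not at h1
        refine hfin _ _ rfl rfl ?_
        rcases h2.eq_or_lt with h0 | h0
        · exact Or.inl ⟨h0.symm, div_nonneg h3 h.le⟩
        · exact Or.inr ⟨le_antisymm (h1 h0) h3, div_nonneg h2 h.le⟩

theorem isPreconnected_side {σ : ℝ} (hσ : σ = 1 ∨ σ = -1) {u u' : Plane} (hu : ‖u‖ = 1)
    (hu' : ‖u'‖ = 1) (hne : u + u' ≠ 0) (p : Plane) {ε : ℝ} (hε : 0 < ε) :
    IsPreconnected ({x | Side σ u u' (x - p)} ∩ ball p ε) := by
  unfold Side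
  have hn : |σ| = 1 := by rcases hσ with rfl | rfl <;> simp
  split_ifs with h
  · exact isPreconnected_wedge_inter p _ _ ε
  · refine isPreconnected_wedge_union ?_ ?_ ?_ hε
    · rw [norm_smul, norm_rot, hu, Real.norm_eq_abs, hn, one_mul]
    · rw [norm_smul, norm_rot, hu', Real.norm_eq_abs, hn, one_mul]
    · rw [← smul_add, ← rot_add]
      have hσ0 : σ ≠ 0 := by rcases hσ with rfl | rfl <;> norm_num
      exact smul_ne_zero hσ0 (rot_eq_zero.not.2 hne)

/-- Points just beside the incoming ray and just beside the outgoing ray lie on the same side. -/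
theorem side_beside_rays {σ : ℝ} (hσ : σ = 1 ∨ σ = -1) {u u' : Plane} (hu : ‖u‖ = 1)
    (hu' : ‖u'‖ = 1) {s : ℝ} (hs : 0 < s) :
    ∀ᶠ t : ℝ in 𝓝[>] 0, Side σ u u' (-(s • u) + t • σ • rot u) ∧
      Side σ u u' (s • u' + t • σ • rot u') := by
  have hσσ : σ * σ = 1 := by rcases hσ with rfl | rfl <;> norm_num
  have hself : ∀ w : Plane, ‖w‖ = 1 → ⟪rot w, rot w⟫ = 1 := by
    intro w hw; rw [inner_rot_rot, real_inner_self_eq_norm_sq, hw]; norm_num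
  have hswap : ⟪rot u', u⟫ = -⟪rot u, u'⟫ := inner_rot_swap _ _
  have hc : ⟪rot u', rot u⟫ = ⟪u, u'⟫ := by rw [inner_rot_rot, real_inner_comm]
  have hc' : ⟪rot u, rot u'⟫ = ⟪u, u'⟫ := inner_rot_rot _ _
  have e1 : ∀ t : ℝ, ⟪σ • rot u, -(s • u) + t • σ • rot u⟫ = t := by
    intro t
    simp only [inner_smul_left, inner_add_right, inner_neg_right, inner_smul_right,
      inner_rot_self, hself u hu, conj_trivial]
    linear_combination t * hσσ
  have e2 : ∀ t : ℝ, ⟪σ • rot u', -(s • u) + t • σ • rot u⟫ =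
      s * (σ * ⟪rot u, u'⟫) + t * ⟪u, u'⟫ := by
    intro t
    simp only [inner_smul_left, inner_add_right, inner_neg_right, inner_smul_right, hswap, hc,
      conj_trivial]
    linear_combination t * ⟪u, u'⟫ * hσσ
  have e3 : ∀ t : ℝ, ⟪σ • rot u', s • u' + t • σ • rot u'⟫ = t := by
    intro t
    simp only [inner_smul_left, inner_add_right, inner_smul_right,
      inner_rot_self, hself u' hu', conj_trivial]
    linear_combination t * hσσ
  have e4 : ∀ t : ℝ, ⟪σ • rot u, s • u' + t • σ • rot u'⟫ =
      s * (σ * ⟪rot u, u'⟫) + t * ⟪u, u'⟫ := by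
    intro t
    simp only [inner_smul_left, inner_add_right, inner_smul_right, hc', conj_trivial]
    linear_combination t * ⟪u, u'⟫ * hσσ
  unfold Side
  simp only [e1, e2, e3, e4]
  split_ifs with h
  · have hlim : Tendsto (fun t : ℝ => s * (σ * ⟪rot u, u'⟫) + t * ⟪u, u'⟫) (𝓝[>] 0)
        (𝓝 (s * (σ * ⟪rot u, u'⟫) + 0 * ⟪u, u'⟫)) :=
      (Continuous.tendsto (by fun_prop) 0).mono_left nhdsWithin_le_nhds
    filter_upwards [self_mem_nhdsWithin, hlim.eventually (lt_mem_nhds (a := 0) (by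
      rw [zero_mul, add_zero]; positivity))] with t ht h'
    exact ⟨⟨ht, h'⟩, h', ht⟩
  · filter_upwards [self_mem_nhdsWithin] with t ht
    exact ⟨Or.inl ht, Or.inr ht⟩

end Sides

/-! ### The boundary curve near its points -/

section Boundary

variable {n : ℕ}

/-- The unit direction of the `i`-th edge. -/
noncomputable def tangent (P : Polygon Plane n) (i : Fin n) : Plane :=
  ‖P (finRotate n i) - P i‖⁻¹ • (P (finRotate n i) - P i)

theorem edgeSet_eq_segment (P : Polygon Plane n) (i : Fin n) :
    P.edgeSet ℝ i = segment ℝ (P i) (P (finRotate n i)) :=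
  affineSegment_eq_segment ℝ _ _

theorem boundary_eq_iUnion_segment (P : Polygon Plane n) :
    P.boundary ℝ = ⋃ i, segment ℝ (P i) (P (finRotate n i)) :=
  iUnion_congr fun i => edgeSet_eq_segment P i

theorem isClosed_segment (x y : Plane) : IsClosed (segment ℝ x y) := by
  rw [segment_eq_image_lineMap]
  exact (isCompact_Icc.image (by fun_prop)).isClosed

theorem isCompact_polygon_boundary (P : Polygon Plane n) : IsCompact (P.boundary ℝ) := by
  rw [boundary_eq_iUnion_segment]
  refine isCompact_iUnion fun i => ?_
  rw [segment_eq_image_lineMap]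
  exact isCompact_Icc.image (by fun_prop)

namespace IsSimple

variable {P : Polygon Plane n}

theorem length_pos (hP : IsSimple P) (i : Fin n) : 0 < ‖P (finRotate n i) - P i‖ :=
  norm_pos_iff.2 (sub_ne_zero.2 (hP.nondegenerate i).symm)

theorem norm_tangent (hP : IsSimple P) (i : Fin n) : ‖tangent P i‖ = 1 := by
  rw [tangent, norm_smul, norm_inv, norm_norm, inv_mul_cancel₀ (hP.length_pos i).ne']

theorem length_smul_tangent (hP : IsSimple P) (i : Fin n) :
    ‖P (finRotate n i) - P i‖ • tangent P i = P (finRotate n i) - P i := by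
  rw [tangent, smul_inv_smul₀ (hP.length_pos i).ne']

theorem lineMap_eq (hP : IsSimple P) (i : Fin n) (t : ℝ) :
    AffineMap.lineMap (P i) (P (finRotate n i)) t =
      P i + (t * ‖P (finRotate n i) - P i‖) • tangent P i := by
  rw [AffineMap.lineMap_apply_module', mul_smul, hP.length_smul_tangent, add_comm]

theorem mem_segment_iff (hP : IsSimple P) (i : Fin n) (x : Plane) :
    x ∈ segment ℝ (P i) (P (finRotate n i)) ↔
      ∃ s, 0 ≤ s ∧ s ≤ ‖P (finRotate n i) - P i‖ ∧ x = P i + s • tangent P i := by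
  have hpos := hP.length_pos i
  rw [segment_eq_image_lineMap]
  constructor
  · rintro ⟨t, ht, rfl⟩
    exact ⟨_, mul_nonneg ht.1 hpos.le, mul_le_of_le_one_left hpos.le ht.2, hP.lineMap_eq i t⟩
  · rintro ⟨s, hs0, hs1, rfl⟩
    refine ⟨s / ‖P (finRotate n i) - P i‖, ⟨by positivity, (div_le_one hpos).2 hs1⟩, ?_⟩
    rw [hP.lineMap_eq, div_mul_cancel₀ _ hpos.ne']

theorem mem_openSegment_iff (hP : IsSimple P) (i : Fin n) (x : Plane) :
    x ∈ openSegment ℝ (P i) (P (finRotate n i)) ↔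
      ∃ s, 0 < s ∧ s < ‖P (finRotate n i) - P i‖ ∧ x = P i + s • tangent P i := by
  have hpos := hP.length_pos i
  rw [openSegment_eq_image_lineMap]
  constructor
  · rintro ⟨t, ht, rfl⟩
    exact ⟨_, mul_pos ht.1 hpos, mul_lt_of_lt_one_left hpos ht.2, hP.lineMap_eq i t⟩
  · rintro ⟨s, hs0, hs1, rfl⟩
    refine ⟨s / ‖P (finRotate n i) - P i‖, ⟨by positivity, (div_lt_one hpos).2 hs1⟩, ?_⟩
    rw [hP.lineMap_eq, div_mul_cancel₀ _ hpos.ne']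

theorem vertex_eq (hP : IsSimple P) (i : Fin n) :
    P (finRotate n i) = P i + ‖P (finRotate n i) - P i‖ • tangent P i := by
  rw [hP.length_smul_tangent]; abel

theorem notMem_segment_of_mem_openSegment (hP : IsSimple P) {i j : Fin n} (hij : j ≠ i)
    {p : Plane} (hp : p ∈ openSegment ℝ (P i) (P (finRotate n i))) :
    p ∉ segment ℝ (P j) (P (finRotate n j)) := by
  intro hpj
  have hpi := openSegment_subset_segment ℝ _ _ hp
  rw [← edgeSet_eq_segment] at hpi hpj
  by_cases h1 : j = finRotate n i
  · subst h1
    have : p ∈ ({P (finRotate n i)} : Set Plane) := hP.adjacent i ▸ ⟨hpi, hpj⟩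
    rw [mem_singleton_iff] at this
    subst this
    exact hP.nondegenerate i (right_mem_openSegment_iff.1 hp)
  by_cases h2 : i = finRotate n j
  · have : p ∈ ({P (finRotate n j)} : Set Plane) := hP.adjacent j ▸ ⟨hpj, h2 ▸ hpi⟩
    rw [mem_singleton_iff, ← h2] at this
    subst this
    exact hP.nondegenerate i (left_mem_openSegment_iff.1 hp)
  · exact disjoint_left.1 (hP.nonadjacent i j hij.symm h1 h2) hpi hpj

theorem eq_or_eq_of_vertex_mem (hP : IsSimple P) {i j : Fin n}
    (h : P (finRotate n i) ∈ segment ℝ (P j) (P (finRotate n j))) :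
    j = i ∨ j = finRotate n i := by
  by_contra! hcon
  have hi : P (finRotate n i) ∈ P.edgeSet ℝ i := by
    rw [edgeSet_eq_segment]; exact right_mem_segment ℝ _ _
  rw [← edgeSet_eq_segment] at h
  by_cases h2 : i = finRotate n j
  · have : P (finRotate n i) ∈ ({P (finRotate n j)} : Set Plane) :=
      hP.adjacent j ▸ ⟨h, h2 ▸ hi⟩
    rw [mem_singleton_iff, ← h2] at this
    exact hP.nondegenerate i this.symm
  · exact disjoint_left.1 (hP.nonadjacent i j hcon.1.symm hcon.2 h2) hi h

theorem sub_smul_mem_segment (hP : IsSimple P) (i : Fin n) {s : ℝ} (hs : 0 ≤ s)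
    (hs' : s ≤ ‖P (finRotate n i) - P i‖) :
    P (finRotate n i) - s • tangent P i ∈ segment ℝ (P i) (P (finRotate n i)) := by
  rw [hP.mem_segment_iff]
  refine ⟨‖P (finRotate n i) - P i‖ - s, by linarith, by linarith, ?_⟩
  rw [sub_smul, hP.length_smul_tangent]; abel

/-- Opposite directions would make consecutive edges overlap along a segment at their common vertex.
-/
theorem tangent_add_ne_zero (hP : IsSimple P) (i : Fin n) :
    tangent P i + tangent P (finRotate n i) ≠ 0 := by
  intro h
  set i' := finRotate n i with hi'
  set s := min ‖P i' - P i‖ ‖P (finRotate n i') - P i'‖ with hs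
  have hspos : 0 < s := lt_min (hP.length_pos i) (hP.length_pos i')
  have hm1 : P i' - s • tangent P i ∈ P.edgeSet ℝ i := by
    rw [edgeSet_eq_segment]
    exact hP.sub_smul_mem_segment i hspos.le (min_le_left _ _)
  have hm2 : P i' - s • tangent P i ∈ P.edgeSet ℝ i' := by
    rw [edgeSet_eq_segment, hP.mem_segment_iff]
    refine ⟨s, hspos.le, min_le_right _ _, ?_⟩
    rw [eq_neg_of_add_eq_zero_right h, smul_neg, sub_eq_add_neg]
  have : P i' - s • tangent P i ∈ ({P i'} : Set Plane) := hP.adjacent i ▸ ⟨hm1, hm2⟩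
  rw [mem_singleton_iff, sub_eq_self, smul_eq_zero] at this
  rcases this with h0 | h0
  · exact hspos.ne' h0
  · have := hP.norm_tangent i
    rw [h0, norm_zero] at this
    exact zero_ne_one this

end IsSimple

/-- At the boundary point `p`, the polygon arrives in direction `u` and leaves in direction
`u'`. -/
def IsTangent (P : Polygon Plane n) (p u u' : Plane) : Prop :=
  (∃ i, p ∈ openSegment ℝ (P i) (P (finRotate n i)) ∧ u = tangent P i ∧ u' = tangent P i) ∨
    ∃ i, p = P (finRotate n i) ∧ u = tangent P i ∧ u' = tangent P (finRotate n i)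

/-- Within `ball p ε`, the set `B` consists of the rays from `p` in the directions `-u` and
`u'`. -/
def IsLocallyRays (B : Set Plane) (p u u' : Plane) (ε : ℝ) : Prop :=
  ∀ x ∈ ball p ε, x ∈ B ↔ (∃ s ≥ (0 : ℝ), x - p = -(s • u)) ∨ ∃ s ≥ (0 : ℝ), x - p = s • u'

namespace IsSimple

variable {P : Polygon Plane n}

theorem exists_isTangent {p : Plane} (hp : p ∈ P.boundary ℝ) : ∃ u u', IsTangent P p u u' := by
  rw [boundary_eq_iUnion_segment, mem_iUnion] at hp
  obtain ⟨i, hi⟩ := hp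
  rw [← insert_endpoints_openSegment] at hi
  rcases hi with rfl | rfl | hi
  · exact ⟨_, _, Or.inr ⟨(finRotate n).symm i, by rw [Equiv.apply_symm_apply], rfl, rfl⟩⟩
  · exact ⟨_, _, Or.inr ⟨i, rfl, rfl, rfl⟩⟩
  · exact ⟨_, _, Or.inl ⟨i, hi, rfl, rfl⟩⟩

theorem isTangent_unit (hP : IsSimple P) {p u u' : Plane} (h : IsTangent P p u u') :
    ‖u‖ = 1 ∧ ‖u'‖ = 1 ∧ u + u' ≠ 0 := by
  rcases h with ⟨i, -, rfl, rfl⟩ | ⟨i, -, rfl, rfl⟩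
  · refine ⟨hP.norm_tangent i, hP.norm_tangent i, fun h => ?_⟩
    have h2 : (2 : ℝ) • tangent P i = 0 := by rw [two_smul]; exact h
    have := hP.norm_tangent i
    simp_all
  · exact ⟨hP.norm_tangent i, hP.norm_tangent _, hP.tangent_add_ne_zero i⟩

theorem exists_ball_notMem (P : Polygon Plane n) (p : Plane) :
    ∃ δ > 0, ∀ x ∈ ball p δ, ∀ j, p ∉ segment ℝ (P j) (P (finRotate n j)) →
      x ∉ segment ℝ (P j) (P (finRotate n j)) := by
  have : ∀ᶠ x in 𝓝 p, ∀ j, p ∉ segment ℝ (P j) (P (finRotate n j)) →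
      x ∉ segment ℝ (P j) (P (finRotate n j)) := by
    rw [eventually_all]
    intro j
    by_cases hj : p ∈ segment ℝ (P j) (P (finRotate n j))
    · exact Eventually.of_forall fun x h => absurd hj h
    · filter_upwards [(isClosed_segment _ _).isOpen_compl.mem_nhds hj] with x hx _
      exact hx
  obtain ⟨δ, hδ, h⟩ := Metric.eventually_nhds_iff_ball.1 this
  exact ⟨δ, hδ, h⟩

/-- Take the ball so small that it misses every edge not through `p` and does not reach beyond the
far ends of those through `p`. -/
theorem exists_isLocallyRays (hP : IsSimple P) {p u u' : Plane} (h : IsTangent P p u u') :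
    ∃ ε > 0, IsLocallyRays (P.boundary ℝ) p u u' ε := by
  obtain ⟨δ, hδ, hball⟩ := exists_ball_notMem P p
  have hsmall : ∀ (x w : Plane) (s ε : ℝ), ‖w‖ = 1 → 0 ≤ s → x ∈ ball p ε →
      (x - p = s • w ∨ x - p = -(s • w)) → s < ε := by
    intro x w s ε hw hs hx h
    have : ‖x - p‖ = s := by
      rcases h with h | h <;> simp [h, norm_smul, hw, abs_of_nonneg hs]
    rw [mem_ball, dist_eq_norm, this] at hx
    exact hx
  rcases h with ⟨i, hp, rfl, rfl⟩ | ⟨i, rfl, rfl, rfl⟩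
  · obtain ⟨r, hr0, hr1, rfl⟩ := (hP.mem_openSegment_iff i p).1 hp
    refine ⟨min δ (min r (‖P (finRotate n i) - P i‖ - r)),
      lt_min hδ (lt_min hr0 (sub_pos.2 hr1)), fun x hx => ?_⟩
    have hx1 := ball_subset_ball (min_le_left _ _) hx
    have hx2 := ball_subset_ball ((min_le_right _ _).trans (min_le_left _ _)) hx
    have hx3 := ball_subset_ball ((min_le_right _ _).trans (min_le_right _ _)) hx
    rw [boundary_eq_iUnion_segment, mem_iUnion]
    constructor
    · rintro ⟨j, hj⟩
      obtain rfl : j = i := by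
        by_contra hne
        exact hball x hx1 j (hP.notMem_segment_of_mem_openSegment hne hp) hj
      obtain ⟨s, hs0, hs1, rfl⟩ := (hP.mem_segment_iff j x).1 hj
      rcases le_total s r with h | h
      · exact Or.inl ⟨r - s, by linarith, by module⟩
      · exact Or.inr ⟨s - r, by linarith, by module⟩
    · rintro (⟨s, hs, h⟩ | ⟨s, hs, h⟩)
      · have := hsmall x _ s _ (hP.norm_tangent i) hs hx2 (Or.inr h)
        refine ⟨i, (hP.mem_segment_iff i x).2 ⟨r - s, by linarith, by linarith, ?_⟩⟩
        rw [sub_eq_iff_eq_add] at h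
        rw [h]; module
      · have := hsmall x _ s _ (hP.norm_tangent i) hs hx3 (Or.inl h)
        refine ⟨i, (hP.mem_segment_iff i x).2 ⟨r + s, by linarith, by linarith, ?_⟩⟩
        rw [sub_eq_iff_eq_add] at h
        rw [h]; module
  · set i' := finRotate n i with hi'
    refine ⟨min δ (min ‖P i' - P i‖ ‖P (finRotate n i') - P i'‖),
      lt_min hδ (lt_min (hP.length_pos i) (hP.length_pos i')), fun x hx => ?_⟩
    have hx1 := ball_subset_ball (min_le_left _ _) hx
    have hx2 := ball_subset_ball ((min_le_right _ _).trans (min_le_left _ _)) hx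
    have hx3 := ball_subset_ball ((min_le_right _ _).trans (min_le_right _ _)) hx
    rw [boundary_eq_iUnion_segment, mem_iUnion]
    constructor
    · rintro ⟨j, hj⟩
      have hj' : j = i ∨ j = i' := by
        by_contra hne
        exact hball x hx1 j (fun h => hne (hP.eq_or_eq_of_vertex_mem h)) hj
      obtain ⟨s, hs0, hs1, rfl⟩ := (hP.mem_segment_iff j x).1 hj
      rcases hj' with rfl | rfl
      · refine Or.inl ⟨‖P i' - P j‖ - s, by linarith, ?_⟩
        rw [sub_smul, hi', hP.length_smul_tangent]
        abel
      · exact Or.inr ⟨s, hs0, by abel⟩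
    · rintro (⟨s, hs, h⟩ | ⟨s, hs, h⟩)
      · have := hsmall x _ s _ (hP.norm_tangent i) hs hx2 (Or.inr h)
        refine ⟨i, ?_⟩
        have h2 := hP.sub_smul_mem_segment i hs this.le
        rw [sub_eq_iff_eq_add, neg_add_eq_sub] at h
        rwa [h]
      · have := hsmall x _ s _ (hP.norm_tangent i') hs hx3 (Or.inl h)
        refine ⟨i', (hP.mem_segment_iff i' x).2 ⟨s, hs, this.le, ?_⟩⟩
        rw [sub_eq_iff_eq_add'] at h
        exact h

theorem eventually_sub_mem_openSegment (hP : IsSimple P) {p u u' : Plane}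
    (h : IsTangent P p u u') : ∃ i, u = tangent P i ∧
      ∀ᶠ s : ℝ in 𝓝[>] 0, p - s • tangent P i ∈ openSegment ℝ (P i) (P (finRotate n i)) := by
  have key : ∀ i r, 0 < r → r ≤ ‖P (finRotate n i) - P i‖ → p = P i + r • tangent P i →
      ∀ᶠ s : ℝ in 𝓝[>] 0, p - s • tangent P i ∈ openSegment ℝ (P i) (P (finRotate n i)) := by
    intro i r hr hr' hpr
    filter_upwards [Ioo_mem_nhdsGT hr] with s hs
    rw [hP.mem_openSegment_iff]
    exact ⟨r - s, by linarith [hs.2], by linarith [hs.1], by rw [hpr]; module⟩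
  rcases h with ⟨i, hp, rfl, rfl⟩ | ⟨i, rfl, rfl, rfl⟩
  · obtain ⟨r, hr0, hr1, hpr⟩ := (hP.mem_openSegment_iff i p).1 hp
    exact ⟨i, rfl, key i r hr0 hr1.le hpr⟩
  · exact ⟨i, rfl, key i _ (hP.length_pos i) le_rfl (hP.vertex_eq i)⟩

theorem eventually_add_mem_openSegment (hP : IsSimple P) (i : Fin n) :
    ∀ᶠ s : ℝ in 𝓝[>] 0, P i + s • tangent P i ∈ openSegment ℝ (P i) (P (finRotate n i)) := by
  filter_upwards [Ioo_mem_nhdsGT (hP.length_pos i)] with s hs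
  rw [hP.mem_openSegment_iff]
  exact ⟨s, hs.1, hs.2, rfl⟩

theorem inner_rot_tangent_sub (hP : IsSimple P) (i : Fin n) {x : Plane}
    (hx : x ∈ segment ℝ (P i) (P (finRotate n i))) : ⟪rot (tangent P i), x - P i⟫ = 0 := by
  obtain ⟨s, -, -, rfl⟩ := (hP.mem_segment_iff i x).1 hx
  rw [add_sub_cancel_left, inner_smul_right, inner_rot_self, mul_zero]

/-- Thin strips along an open edge contain no boundary points. -/
theorem eventually_strip (hP : IsSimple P) {σ : ℝ} (hσ : σ = 1 ∨ σ = -1) (i : Fin n)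
    {p p' : Plane} (hp : p ∈ openSegment ℝ (P i) (P (finRotate n i)))
    (hp' : p' ∈ openSegment ℝ (P i) (P (finRotate n i))) :
    ∀ᶠ t : ℝ in 𝓝[>] 0, ∀ x ∈ segment ℝ p p',
      x + t • σ • rot (tangent P i) ∉ P.boundary ℝ := by
  have hsub : segment ℝ p p' ⊆ openSegment ℝ (P i) (P (finRotate n i)) :=
    (convex_openSegment _ _).segment_subset hp hp'
  have hcomp : IsCompact (segment ℝ p p') := by
    rw [segment_eq_image_lineMap]
    exact isCompact_Icc.image (by fun_prop)
  have hcl : IsClosed (⋃ j ∈ {j | j ≠ i}, segment ℝ (P j) (P (finRotate n j))) :=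
    (toFinite _).isClosed_biUnion fun j _ => isClosed_segment _ _
  have hdisj : Disjoint (segment ℝ p p') (⋃ j ∈ {j | j ≠ i}, segment ℝ (P j)
      (P (finRotate n j))) := by
    rw [disjoint_left]
    intro x hx hx'
    simp only [mem_iUnion] at hx'
    obtain ⟨j, hj, hxj⟩ := hx'
    exact hP.notMem_segment_of_mem_openSegment hj (hsub hx) hxj
  -- The compact subsegment has positive distance from the other edges; its own edge is avoided
  -- because the shift leaves the line.
  obtain ⟨δ, hδ, hδd⟩ := hdisj.exists_thickenings hcomp hcl
  have hσn : ‖σ • rot (tangent P i)‖ = 1 := by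
    rw [norm_smul, norm_rot, hP.norm_tangent]
    rcases hσ with rfl | rfl <;> simp
  filter_upwards [Ioo_mem_nhdsGT hδ] with t ht x hx hxB
  rw [boundary_eq_iUnion_segment, mem_iUnion] at hxB
  obtain ⟨j, hj⟩ := hxB
  by_cases hji : j = i
  · subst hji
    have h1 := hP.inner_rot_tangent_sub j hj
    have h2 := hP.inner_rot_tangent_sub j (openSegment_subset_segment ℝ _ _ (hsub hx))
    rw [add_sub_right_comm, inner_add_right, h2, inner_smul_right, inner_smul_right,
      real_inner_self_eq_norm_sq, norm_rot, hP.norm_tangent] at h1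
    have := ht.1
    rcases hσ with rfl | rfl <;> linarith
  · refine disjoint_left.1 hδd (mem_thickening_iff.2 ⟨x, hx, ?_⟩)
      (self_subset_thickening hδ _ (mem_biUnion (show j ∈ {j | j ≠ i} from hji) hj))
    rw [dist_self_add_left, norm_smul, hσn, mul_one, Real.norm_eq_abs, abs_of_pos ht.1]
    exact ht.2

theorem side_subset_compl (hP : IsSimple P) {p u u' : Plane} (h : IsTangent P p u u') {ε : ℝ}
    (hr : IsLocallyRays (P.boundary ℝ) p u u' ε) {σ : ℝ} (hσ : σ = 1 ∨ σ = -1) :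
    {x | Side σ u u' (x - p)} ∩ ball p ε ⊆ (P.boundary ℝ)ᶜ := by
  rintro x ⟨hx, hxε⟩ hxB
  obtain ⟨hu, hu', hne⟩ := hP.isTangent_unit h
  have := (ray_iff_not_side hu hu' hne (x - p)).1 ((hr x hxε).1 hxB)
  rcases hσ with rfl | rfl
  · exact this.1 hx
  · exact this.2 hx

/-- One side of the boundary curve belongs to a single component of the complement. -/
theorem exists_side_component (hP : IsSimple P) {σ : ℝ} (hσ : σ = 1 ∨ σ = -1) :
    ∃ z ∉ P.boundary ℝ, ∀ i, ∀ p ∈ openSegment ℝ (P i) (P (finRotate n i)),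
      ∀ᶠ t : ℝ in 𝓝[>] 0, p + t • σ • rot (tangent P i) ∈
        connectedComponentIn (P.boundary ℝ)ᶜ z := by
  -- Along one edge, slide parallel to it inside a thin strip.
  have hedge : ∀ i, ∃ z ∉ P.boundary ℝ, ∀ p ∈ openSegment ℝ (P i) (P (finRotate n i)),
      ∀ᶠ t : ℝ in 𝓝[>] 0, p + t • σ • rot (tangent P i) ∈
        connectedComponentIn (P.boundary ℝ)ᶜ z := by
    intro i
    obtain ⟨p₀, hp₀⟩ : (openSegment ℝ (P i) (P (finRotate n i))).Nonempty :=
      ⟨_, midpoint_mem_openSegment _ _⟩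
    obtain ⟨t₀, ht₀, hstrip⟩ := mem_nhdsGT_iff_exists_Ioo_subset.1
      (hP.eventually_strip hσ i hp₀ hp₀)
    have ht₀ : 0 < t₀ := ht₀
    have hray : ∀ t ∈ Ioo 0 t₀, p₀ + t • σ • rot (tangent P i) ∉ P.boundary ℝ := fun t ht =>
      hstrip ht p₀ (left_mem_segment ℝ _ _)
    have hhalf : t₀ / 2 ∈ Ioo 0 t₀ := ⟨by linarith, by linarith⟩
    refine ⟨p₀ + (t₀ / 2) • σ • rot (tangent P i), hray _ hhalf, fun p hp => ?_⟩
    filter_upwards [Ioo_mem_nhdsGT ht₀, hP.eventually_strip hσ i hp₀ hp] with t ht hs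
    have hpre : IsPreconnected ((fun t : ℝ => p₀ + t • σ • rot (tangent P i)) '' Ioo 0 t₀ ∪
        (fun x => x + t • σ • rot (tangent P i)) '' segment ℝ p₀ p) :=
      IsPreconnected.union (p₀ + t • σ • rot (tangent P i)) ⟨t, ht, rfl⟩
        ⟨p₀, left_mem_segment ℝ _ _, rfl⟩ (isPreconnected_Ioo.image _ (by fun_prop))
        ((convex_segment p₀ p).isPreconnected.image _ (by fun_prop))
    refine hpre.subset_connectedComponentIn (Or.inl ⟨_, hhalf, rfl⟩) ?_
      (Or.inr ⟨p, right_mem_segment ℝ _ _, rfl⟩)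
    rintro _ (⟨s, hs', rfl⟩ | ⟨x, hx, rfl⟩)
    · exact hray s hs'
    · exact hs x hx
  choose z hz hzp using hedge
  -- Around a vertex, pass through the connected local side, which contains points beside both
  -- edges.
  have hstep : ∀ i, connectedComponentIn (P.boundary ℝ)ᶜ (z (finRotate n i)) =
      connectedComponentIn (P.boundary ℝ)ᶜ (z i) := by
    intro i
    set i' := finRotate n i with hi'
    have htan : IsTangent P (P i') (tangent P i) (tangent P i') := Or.inr ⟨i, rfl, rfl, rfl⟩
    obtain ⟨hu, hu', hne⟩ := hP.isTangent_unit htan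
    obtain ⟨ε, hε, hr⟩ := hP.exists_isLocallyRays htan
    have hpre := isPreconnected_side hσ hu hu' hne (P i') hε
    have hsub := hP.side_subset_compl htan hr hσ
    obtain ⟨s, ⟨hs0, hsε⟩, hs1, hs2⟩ := ((eventually_mem_set.2 (Ioo_mem_nhdsGT (half_pos hε))).and
      ((show ∀ᶠ s : ℝ in 𝓝[>] 0, P i' - s • tangent P i ∈
          openSegment ℝ (P i) (P (finRotate n i)) by
        filter_upwards [Ioo_mem_nhdsGT (hP.length_pos i)] with s hs
        rw [hP.mem_openSegment_iff]
        refine ⟨‖P i' - P i‖ - s, by linarith [hs.2], by linarith [hs.1], ?_⟩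
        rw [sub_smul, hi', hP.length_smul_tangent]; abel).and
      (hP.eventually_add_mem_openSegment i'))).exists
    obtain ⟨t, ⟨ht0, htε⟩, ⟨hside1, hside2⟩, hC1, hC2⟩ :=
      ((eventually_mem_set.2 (Ioo_mem_nhdsGT (half_pos hε))).and ((side_beside_rays hσ hu hu' hs0).and ((hzp i _ hs1).and (hzp i' _ hs2)))).exists
    have hσn : ∀ j, ‖t • σ • rot (tangent P j)‖ = t := by
      intro j
      rw [norm_smul, norm_smul, norm_rot, hP.norm_tangent, Real.norm_eq_abs, abs_of_pos ht0]
      rcases hσ with rfl | rfl <;> simp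
    have hsn : ∀ j, ‖s • tangent P j‖ = s := by
      intro j
      rw [norm_smul, hP.norm_tangent, Real.norm_eq_abs, abs_of_pos hs0, mul_one]
    have e1 : P i' - s • tangent P i + t • σ • rot (tangent P i) - P i' =
        -(s • tangent P i) + t • σ • rot (tangent P i) := by abel
    have e2 : P i' + s • tangent P i' + t • σ • rot (tangent P i') - P i' =
        s • tangent P i' + t • σ • rot (tangent P i') := by abel
    have m1 : P i' - s • tangent P i + t • σ • rot (tangent P i) ∈
        {x | Side σ (tangent P i) (tangent P i') (x - P i')} ∩ ball (P i') ε := by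
      refine ⟨by rw [mem_ofPred_eq, e1]; exact hside1, ?_⟩
      rw [mem_ball, dist_eq_norm, e1]
      refine (norm_add_le _ _).trans_lt ?_
      rw [norm_neg, hsn, hσn]
      linarith
    have m2 : P i' + s • tangent P i' + t • σ • rot (tangent P i') ∈
        {x | Side σ (tangent P i) (tangent P i') (x - P i')} ∩ ball (P i') ε := by
      refine ⟨by rw [mem_ofPred_eq, e2]; exact hside2, ?_⟩
      rw [mem_ball, dist_eq_norm, e2]
      refine (norm_add_le _ _).trans_lt ?_
      rw [hsn, hσn]
      linarith
    have h12 := hpre.subset_connectedComponentIn m1 hsub m2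
    rw [connectedComponentIn_eq hC1, connectedComponentIn_eq hC2, connectedComponentIn_eq h12]
  obtain ⟨m, rfl⟩ : ∃ m, n = m + 1 := ⟨n - 1, by have := hP.three_le; omega⟩
  have hconst : ∀ i, connectedComponentIn (P.boundary ℝ)ᶜ (z i) =
      connectedComponentIn (P.boundary ℝ)ᶜ (z 0) := by
    intro i
    induction i using Fin.induction with
    | zero => rfl
    | succ i ih =>
      rw [← ih, ← hstep i.castSucc, finRotate_apply, Fin.coeSucc_eq_succ]
  refine ⟨z 0, hz 0, fun i p hp => ?_⟩
  rw [← hconst i]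
  exact hzp i p hp

end IsSimple

end Boundary

/-! ### The Jordan curve theorem for simple polygons -/

section Jordan

/-- The vertices of a polygon, continued periodically. -/
def vertexSeq {m : ℕ} (P : Polygon Plane (m + 1)) (k : ℕ) : Plane := P (Fin.ofNat (m + 1) k)

theorem vertexSeq_succ {m : ℕ} (P : Polygon Plane (m + 1)) (k : ℕ) :
    vertexSeq P (k + 1) = P (finRotate (m + 1) (Fin.ofNat (m + 1) k)) := by
  rw [vertexSeq, finRotate_apply]
  congr 1
  apply Fin.ext
  simp [Fin.ofNat, Fin.val_add]

theorem segment_vertexSeq_subset {m : ℕ} (P : Polygon Plane (m + 1)) (k : ℕ) :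
    segment ℝ (vertexSeq P k) (vertexSeq P (k + 1)) ⊆ P.boundary ℝ := by
  rw [vertexSeq_succ, boundary_eq_iUnion_segment]
  exact subset_iUnion (fun i => segment ℝ (P i) (P (finRotate (m + 1) i))) _

theorem vertexSeq_val {m : ℕ} (P : Polygon Plane (m + 1)) (i : Fin (m + 1)) :
    vertexSeq P i = P i := by
  rw [vertexSeq, Fin.ofNat_val_eq_self]

theorem segment_eq_segment_vertexSeq {m : ℕ} (P : Polygon Plane (m + 1)) (i : Fin (m + 1)) :
    segment ℝ (P i) (P (finRotate (m + 1) i)) =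
      segment ℝ (vertexSeq P i) (vertexSeq P (i + 1)) := by
  rw [vertexSeq_succ, vertexSeq_val, Fin.ofNat_val_eq_self]

/-- A two-segment crosscut disconnects any open set that misses the boundary of the polygon. -/
theorem not_isPreconnected_crosscut {m : ℕ} (P : Polygon Plane (m + 1)) {Ω : Set Plane}
    (hΩ : IsOpen Ω) (hdisj : Disjoint Ω (P.boundary ℝ)) {c p p' : Plane} (hc : c ∈ Ω)
    (hp : p ∈ P.boundary ℝ) (hp' : p' ∈ P.boundary ℝ) (hcp : openSegment ℝ c p ⊆ Ω)
    (hcp' : openSegment ℝ c p' ⊆ Ω) (hd : Disjoint (openSegment ℝ c p) (openSegment ℝ c p')) :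
    ¬ IsPreconnected (Ω \ (segment ℝ c p ∪ segment ℝ c p')) := by
  have hpB := hp
  have hpB' := hp'
  rw [boundary_eq_iUnion_segment, mem_iUnion] at hp hp'
  obtain ⟨i, hi⟩ := hp
  obtain ⟨j, hj⟩ := hp'
  wlog hij : (i : ℕ) ≤ j generalizing p p' i j
  · rw [union_comm]
    exact this hcp' hcp hd.symm hpB' hpB j hj i hi (le_of_not_ge hij)
  rw [segment_eq_segment_vertexSeq] at hi hj
  obtain ⟨L, hL⟩ := Nat.exists_eq_add_of_le hij
  rw [hL] at hj
  have hpc : p ≠ c := fun h => disjoint_left.1 hdisj hc (h ▸ hpB)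
  intro hpre
  -- The closed polyline from `c` to `p`, along the boundary through the vertices numbered `i + 1`
  -- to `i + L`, on to `p'` and back to `c`. Only its first and last edges enter `Ω`.
  let q : ℕ → Plane := fun k => if k = 0 then c else if k = 1 then p
    else if k ≤ L + 1 then vertexSeq P (i + (k - 1)) else if k = L + 2 then p' else c
  have q0 : q 0 = c := rfl
  have q1 : q 1 = p := rfl
  have q2 : ∀ k, 1 ≤ k → k ≤ L → q (k + 1) = vertexSeq P (i + k) := by
    intro k h1 h2
    simp only [q]
    rw [if_neg (by omega), if_neg (by omega), if_pos (by omega), Nat.add_sub_cancel]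
  have q3 : q (L + 2) = p' := by
    simp only [q]
    rw [if_neg (by omega), if_neg (by omega), if_neg (by omega)]
    simp
  have q4 : q (L + 3) = c := by
    simp only [q]
    rw [if_neg (by omega), if_neg (by omega), if_neg (by omega), if_neg (by omega)]
  have hmid : ∀ k, 1 ≤ k → k ≤ L + 1 → segment ℝ (q k) (q (k + 1)) ⊆ P.boundary ℝ := by
    intro k h1 h2
    have key : ∀ l x y, x ∈ segment ℝ (vertexSeq P l) (vertexSeq P (l + 1)) →
        y ∈ segment ℝ (vertexSeq P l) (vertexSeq P (l + 1)) → segment ℝ x y ⊆ P.boundary ℝ :=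
      fun l x y hx hy => ((convex_segment _ _).segment_subset hx hy).trans
        (segment_vertexSeq_subset P l)
    obtain ⟨k, rfl⟩ : ∃ k', k = k' + 1 := ⟨k - 1, by omega⟩
    have ha : q (k + 1) ∈ segment ℝ (vertexSeq P (i + k)) (vertexSeq P (i + k + 1)) := by
      rcases Nat.eq_zero_or_pos k with rfl | hk
      · rw [zero_add, q1]; exact hi
      · rw [q2 k hk (by omega)]; exact left_mem_segment ℝ _ _
    have hb : q (k + 1 + 1) ∈ segment ℝ (vertexSeq P (i + k)) (vertexSeq P (i + k + 1)) := by
      rcases (show k ≤ L by omega).lt_or_eq with hk | rfl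
      · rw [q2 (k + 1) (by omega) (by omega)]; exact right_mem_segment ℝ _ _
      · rw [q3]; exact hj
    exact key _ _ _ ha hb
  have hnot : ∀ z, z ∈ Ω → z ∉ segment ℝ c p → z ∉ segment ℝ c p' →
      ∀ k < L + 3, z ∉ segment ℝ (q k) (q (k + 1)) := by
    intro z hz h1 h2 k hk hzk
    rcases Nat.eq_zero_or_pos k with rfl | hk0
    · exact h1 hzk
    rcases (show k ≤ L + 2 by omega).lt_or_eq with hk' | rfl
    · exact disjoint_left.1 hdisj hz (hmid k hk0 (by omega) hzk)
    · rw [q3, q4, segment_symm] at hzk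
      exact h2 hzk
  -- Near `w`, which lies on the first edge only, the two sides have different winding numbers and
  -- both lie in the cut domain.
  set w := midpoint ℝ c p with hw
  have hwo : w ∈ openSegment ℝ c p := midpoint_mem_openSegment c p
  have hwΩ : w ∈ Ω := hcp hwo
  have hwp' : w ∉ segment ℝ c p' := by
    intro h
    rw [← insert_endpoints_openSegment] at h
    rcases h with h | h | h
    · rw [h, left_mem_openSegment_iff] at hwo
      exact hpc hwo.symm
    · exact disjoint_left.1 hdisj hwΩ (h ▸ hpB')
    · exact disjoint_left.1 hd hwo h
  have hev := eventually_not_isPreconnected (N := L + 3) (q := q) (by rw [q4, q0]) (k := 0)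
    (by omega) (by rw [q0, zero_add, q1]; exact hpc.symm) (m := w)
    (by rw [q0, zero_add, q1]; exact hwo) (by
      intro k hk hk0 hwk
      rcases (show k ≤ L + 2 by omega).lt_or_eq with hk' | rfl
      · exact disjoint_left.1 hdisj hwΩ (hmid k (by omega) (by omega) hwk)
      · rw [q3, q4, segment_symm] at hwk
        exact hwp' hwk)
  rw [q0, zero_add, q1] at hev
  have hopen : IsOpen (Ω \ segment ℝ c p') := hΩ.sdiff (isClosed_segment _ _)
  have hnhds : Ω \ segment ℝ c p' ∈ 𝓝 w := hopen.mem_nhds ⟨hwΩ, hwp'⟩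
  have hplus := (tendsto_add_smul w (rot (p - c))).eventually hnhds
  have hminus : ∀ᶠ t : ℝ in 𝓝[>] 0, w - t • rot (p - c) ∈ Ω \ segment ℝ c p' := by
    have : Tendsto (fun t : ℝ => w - t • rot (p - c)) (𝓝[>] 0) (𝓝 w) := by
      simpa only [smul_neg, ← sub_eq_add_neg] using tendsto_add_smul w (-rot (p - c))
    exact this.eventually hnhds
  obtain ⟨t, ht, ht0, ⟨a1, a2⟩, b1, b2⟩ :=
    (hev.and ((eventually_mem_nhdsWithin).and (hplus.and hminus))).exists
  have ht0 : 0 < t := ht0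
  have hinner : ∀ x ∈ segment ℝ c p, ⟪rot (p - c), x - c⟫ = 0 := by
    intro x hx
    rw [segment_eq_image_lineMap] at hx
    obtain ⟨s, -, rfl⟩ := hx
    rw [AffineMap.lineMap_apply_module', add_sub_cancel_right, inner_smul_right, inner_rot_self,
      mul_zero]
  have hpos : 0 < ⟪rot (p - c), rot (p - c)⟫ := by
    rw [inner_rot_rot]; exact real_inner_self_pos.2 (sub_ne_zero.2 hpc)
  have hw0 := hinner w (openSegment_subset_segment ℝ _ _ hwo)
  have a3 : w + t • rot (p - c) ∉ segment ℝ c p := by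
    intro h
    have := hinner _ h
    rw [add_sub_right_comm, inner_add_right, hw0, inner_smul_right] at this
    have := mul_pos ht0 hpos
    linarith
  have b3 : w - t • rot (p - c) ∉ segment ℝ c p := by
    intro h
    have := hinner _ h
    rw [sub_right_comm, inner_sub_right, hw0, inner_smul_right] at this
    have := mul_pos ht0 hpos
    linarith
  refine ht _ hpre (fun z hz => hnot z hz.1 (fun h => hz.2 (Or.inl h)) fun h => hz.2 (Or.inr h))
    ⟨a1, fun h => h.elim a3 a2⟩ ⟨b1, fun h => h.elim b3 b2⟩

/-- Pushing every point outwards by `R` maps the connected punctured plane onto the outside of the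
disk. -/
theorem isPreconnected_compl_closedBall {R : ℝ} (hR : 0 ≤ R) :
    IsPreconnected (closedBall (0 : Plane) R)ᶜ := by
  have h0 : IsConnected ({0}ᶜ : Set Plane) :=
    isConnected_compl_singleton_of_one_lt_rank (Module.lt_rank_of_lt_finrank (by simp)) 0
  have himg : (fun x : Plane => (1 + R / ‖x‖) • x) '' {0}ᶜ = (closedBall (0 : Plane) R)ᶜ := by
    apply subset_antisymm
    · rintro _ ⟨x, hx, rfl⟩
      have hpos : 0 < ‖x‖ := norm_pos_iff.2 hx
      rw [mem_compl_iff, mem_closedBall, dist_zero_right, norm_smul, Real.norm_eq_abs,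
        abs_of_nonneg (by positivity), add_mul, div_mul_cancel₀ _ hpos.ne']
      linarith
    · intro y hy
      rw [mem_compl_iff, mem_closedBall, dist_zero_right, not_le] at hy
      have hpos : 0 < ‖y‖ := hR.trans_lt hy
      have hsub : 0 < ‖y‖ - R := sub_pos.2 hy
      have hn : ‖(1 - R / ‖y‖) • y‖ = ‖y‖ - R := by
        rw [norm_smul, Real.norm_eq_abs, abs_of_nonneg (by
          rw [sub_nonneg, div_le_one hpos]; exact hy.le), sub_mul, div_mul_cancel₀ _ hpos.ne',
          one_mul]
      refine ⟨(1 - R / ‖y‖) • y, ?_, ?_⟩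
      · rw [mem_compl_singleton_iff, ← norm_pos_iff, hn]
        exact hsub
      · simp only [hn, smul_smul]
        have : (1 + R / (‖y‖ - R)) * (1 - R / ‖y‖) = 1 := by
          field_simp
          ring
        rw [this, one_smul]
  rw [← himg]
  refine h0.isPreconnected.image _ ?_
  intro x hx
  have : ‖x‖ ≠ 0 := norm_ne_zero_iff.2 hx
  exact ContinuousAt.continuousWithinAt (by fun_prop (disch := assumption))

namespace IsSimple

theorem side_subset_component {n : ℕ} {P : Polygon Plane n} (hP : IsSimple P) {σ : ℝ}
    (hσ : σ = 1 ∨ σ = -1) {z : Plane}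
    (hz : ∀ i, ∀ p ∈ openSegment ℝ (P i) (P (finRotate n i)), ∀ᶠ t : ℝ in 𝓝[>] 0,
      p + t • σ • rot (tangent P i) ∈ connectedComponentIn (P.boundary ℝ)ᶜ z)
    {p u u' : Plane} (h : IsTangent P p u u') {ε : ℝ} (hε : 0 < ε)
    (hr : IsLocallyRays (P.boundary ℝ) p u u' ε) :
    {x | Side σ u u' (x - p)} ∩ ball p ε ⊆ connectedComponentIn (P.boundary ℝ)ᶜ z := by
  obtain ⟨hu, hu', hne⟩ := hP.isTangent_unit h
  obtain ⟨i, rfl, hi⟩ := hP.eventually_sub_mem_openSegment h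
  obtain ⟨s, ⟨hs0, hsε⟩, hs⟩ :=
    ((eventually_mem_set.2 (Ioo_mem_nhdsGT (half_pos hε))).and hi).exists
  obtain ⟨t, ⟨ht0, htε⟩, ⟨hside, -⟩, hC⟩ :=
    ((eventually_mem_set.2 (Ioo_mem_nhdsGT (half_pos hε))).and
      ((side_beside_rays hσ hu hu' hs0).and (hz i _ hs))).exists
  have e : p - s • tangent P i + t • σ • rot (tangent P i) - p =
      -(s • tangent P i) + t • σ • rot (tangent P i) := by abel
  rw [connectedComponentIn_eq hC]
  refine (isPreconnected_side hσ hu hu' hne p hε).subset_connectedComponentIn ?_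
    (hP.side_subset_compl h hr hσ)
  refine ⟨by rw [mem_ofPred_eq, e]; exact hside, ?_⟩
  rw [mem_ball, dist_eq_norm, e]
  refine (norm_add_le _ _).trans_lt ?_
  rw [norm_neg, norm_smul, norm_smul, norm_smul, norm_rot, hu, Real.norm_eq_abs, Real.norm_eq_abs,
    abs_of_pos hs0, abs_of_pos ht0]
  have : ‖σ‖ = 1 := by rcases hσ with rfl | rfl <;> simp
  rw [this]
  linarith

/-- The winding number of the polygon jumps across the midpoint of an edge, so the two sides cannot
share a component. -/
theorem component_ne {n : ℕ} {P : Polygon Plane n} (hP : IsSimple P) {z z' : Plane}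
    (hz : ∀ i, ∀ p ∈ openSegment ℝ (P i) (P (finRotate n i)), ∀ᶠ t : ℝ in 𝓝[>] 0,
      p + t • (1 : ℝ) • rot (tangent P i) ∈ connectedComponentIn (P.boundary ℝ)ᶜ z)
    (hz' : ∀ i, ∀ p ∈ openSegment ℝ (P i) (P (finRotate n i)), ∀ᶠ t : ℝ in 𝓝[>] 0,
      p + t • (-1 : ℝ) • rot (tangent P i) ∈ connectedComponentIn (P.boundary ℝ)ᶜ z') :
    connectedComponentIn (P.boundary ℝ)ᶜ z ≠ connectedComponentIn (P.boundary ℝ)ᶜ z' := by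
  obtain ⟨m, rfl⟩ : ∃ m, n = m + 1 := ⟨n - 1, by have := hP.three_le; omega⟩
  intro heq
  set w := midpoint ℝ (P 0) (P (finRotate (m + 1) 0)) with hw
  have hwo : w ∈ openSegment ℝ (P 0) (P (finRotate (m + 1) 0)) := midpoint_mem_openSegment _ _
  have e0 : vertexSeq P 0 = P 0 := vertexSeq_val P 0
  have e1 : vertexSeq P (0 + 1) = P (finRotate (m + 1) 0) := vertexSeq_succ P 0
  have hev := eventually_not_isPreconnected (N := m + 1) (q := vertexSeq P)
    (by rw [vertexSeq, vertexSeq]; congr 1; apply Fin.ext; simp [Fin.ofNat]) (k := 0)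
    (Nat.succ_pos m) (by rw [e0, e1]; exact hP.nondegenerate 0) (m := w)
    (by rw [e0, e1]; exact hwo) (by
      intro j hj hj0
      have h := hP.notMem_segment_of_mem_openSegment (i := 0) (j := ⟨j, hj⟩)
        (fun h => hj0 (by simpa using congrArg Fin.val h)) hwo
      rwa [segment_eq_segment_vertexSeq] at h)
  rw [e0, e1, ← hP.length_smul_tangent 0, rot_smul] at hev
  set l := ‖P (finRotate (m + 1) 0) - P 0‖ with hl
  have hlpos : 0 < l := hP.length_pos 0
  have hmul : Tendsto (fun t : ℝ => t * l) (𝓝[>] 0) (𝓝[>] 0) := by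
    refine tendsto_nhdsWithin_iff.2 ⟨?_, ?_⟩
    · have : Tendsto (fun t : ℝ => t * l) (𝓝 0) (𝓝 (0 * l)) := Continuous.tendsto (by fun_prop) 0
      rw [zero_mul] at this
      exact this.mono_left nhdsWithin_le_nhds
    · filter_upwards [self_mem_nhdsWithin] with t ht
      exact mul_pos ht hlpos
  obtain ⟨t, ht, h1, h2⟩ := (hev.and ((hmul.eventually (hz 0 w hwo)).and
    (hmul.eventually (hz' 0 w hwo)))).exists
  rw [← heq] at h2
  refine ht _ isPreconnected_connectedComponentIn (fun y hy j hj hyj => ?_)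
    (by rw [smul_smul]; rwa [one_smul] at h1)
    (by rw [smul_smul]; rwa [neg_one_smul, smul_neg, ← sub_eq_add_neg] at h2)
  exact connectedComponentIn_subset _ _ hy (segment_vertexSeq_subset P j hyj)

/-- The Jordan curve theorem for simple polygons, with a description of both sides near the
boundary. -/
theorem exists_interior_exterior {n : ℕ} {P : Polygon Plane n} (hP : IsSimple P) :
    ∃ (σ : ℝ) (Ω Ω' : Set Plane), (σ = 1 ∨ σ = -1) ∧ IsOpen Ω ∧ IsOpen Ω' ∧ Ω.Nonempty ∧
      IsPreconnected Ω ∧ Disjoint Ω Ω' ∧ Ω ∪ Ω' = (P.boundary ℝ)ᶜ ∧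
      Bornology.IsBounded Ω ∧ region P = Ω ∪ P.boundary ℝ ∧
      ∀ p u u', IsTangent P p u u' → ∃ ε > 0, IsLocallyRays (P.boundary ℝ) p u u' ε ∧
        {x | Side σ u u' (x - p)} ∩ ball p ε ⊆ Ω ∧
        {x | Side (-σ) u u' (x - p)} ∩ ball p ε ⊆ Ω' := by
  have hBc := isCompact_polygon_boundary P
  have hBo : IsOpen (P.boundary ℝ)ᶜ := hBc.isClosed.isOpen_compl
  obtain ⟨z₁, hz₁B, hz₁⟩ := hP.exists_side_component (Or.inl rfl : (1 : ℝ) = 1 ∨ (1 : ℝ) = -1)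
  obtain ⟨z₂, hz₂B, hz₂⟩ := hP.exists_side_component (Or.inr rfl : (-1 : ℝ) = 1 ∨ (-1 : ℝ) = -1)
  have hne := hP.component_ne hz₁ hz₂
  set C₁ := connectedComponentIn (P.boundary ℝ)ᶜ z₁ with hC₁
  set C₂ := connectedComponentIn (P.boundary ℝ)ᶜ z₂ with hC₂
  have hdisj : Disjoint C₁ C₂ := by
    rw [disjoint_left]
    intro x h1 h2
    exact hne ((connectedComponentIn_eq h1).trans (connectedComponentIn_eq h2).symm)
  have hlocal : ∀ p u u', IsTangent P p u u' → ∃ ε > 0, IsLocallyRays (P.boundary ℝ) p u u' ε ∧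
      {x | Side 1 u u' (x - p)} ∩ ball p ε ⊆ C₁ ∧
      {x | Side (-1) u u' (x - p)} ∩ ball p ε ⊆ C₂ := by
    intro p u u' h
    obtain ⟨ε, hε, hr⟩ := hP.exists_isLocallyRays h
    exact ⟨ε, hε, hr, hP.side_subset_component (Or.inl rfl) hz₁ h hε hr,
      hP.side_subset_component (Or.inr rfl) hz₂ h hε hr⟩
  have hBne : (P.boundary ℝ).Nonempty := by
    have h3 := hP.three_le
    rw [boundary_eq_iUnion_segment]
    exact ⟨P ⟨0, by omega⟩, mem_iUnion.2 ⟨⟨0, by omega⟩, left_mem_segment ℝ _ _⟩⟩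
  -- Go straight from `z` to a nearest boundary point; just before reaching it one is on one of its
  -- two local sides.
  have hcover : ∀ z ∉ P.boundary ℝ, z ∈ C₁ ∨ z ∈ C₂ := by
    intro z hz
    obtain ⟨p, hp, hpz⟩ := hBc.exists_infDist_eq_dist hBne z
    obtain ⟨u, u', htan⟩ := exists_isTangent hp
    obtain ⟨ε, hε, hr, h1, h2⟩ := hlocal p u u' htan
    obtain ⟨hu, hu', hnn⟩ := hP.isTangent_unit htan
    have hzp : z ≠ p := fun h => hz (h ▸ hp)
    have hsub : segment ℝ z p \ {p} ⊆ (P.boundary ℝ)ᶜ := by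
      rintro x ⟨hx, hxp⟩ hxB
      have e1 := dist_add_dist_of_mem_segment hx
      have e2 : infDist z (P.boundary ℝ) ≤ dist z x := infDist_le_dist_of_mem hxB
      have e3 := dist_pos.2 hxp
      linarith
    have heq : segment ℝ z p \ {p} = AffineMap.lineMap z p '' Ico (0 : ℝ) 1 := by
      rw [segment_eq_image_lineMap]
      apply subset_antisymm
      · rintro _ ⟨⟨t, ht, rfl⟩, hne⟩
        exact ⟨t, ⟨ht.1, lt_of_le_of_ne ht.2 fun h => hne (by simp [h])⟩, rfl⟩
      · rintro _ ⟨t, ht, rfl⟩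
        refine ⟨⟨t, Ico_subset_Icc_self ht, rfl⟩, fun h => ?_⟩
        have : t = 1 ∨ z = p := by simpa [AffineMap.lineMap_eq_right_iff, or_comm] using h
        exact this.elim ht.2.ne hzp
    have hpre : IsPreconnected (segment ℝ z p \ {p}) := by
      rw [heq]; exact isPreconnected_Ico.image _ (by fun_prop)
    have hlim : Tendsto (fun t : ℝ => AffineMap.lineMap z p t) (𝓝[<] 1) (𝓝 p) := by
      have : Tendsto (fun t : ℝ => AffineMap.lineMap z p t) (𝓝 1)
          (𝓝 (AffineMap.lineMap z p (1 : ℝ))) := Continuous.tendsto (by fun_prop) 1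
      rw [AffineMap.lineMap_apply_one] at this
      exact this.mono_left nhdsWithin_le_nhds
    obtain ⟨t, htb, ht⟩ := ((hlim.eventually (ball_mem_nhds p hε)).and
      (Ico_mem_nhdsLT (show (0 : ℝ) < 1 by norm_num))).exists
    have hmem : AffineMap.lineMap z p t ∈ segment ℝ z p \ {p} := by
      rw [heq]; exact ⟨t, ht, rfl⟩
    have hzmem : z ∈ segment ℝ z p \ {p} := ⟨left_mem_segment ℝ _ _, hzp⟩
    have hcon := hpre.subset_connectedComponentIn hmem hsub hzmem
    have hns := (hr _ htb).not.1 (hsub hmem)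
    rw [ray_iff_not_side hu hu' hnn, not_and_or, not_not, not_not] at hns
    rcases hns with h | h
    · left; rw [hC₁, connectedComponentIn_eq (h1 ⟨h, htb⟩)]; exact hcon
    · right; rw [hC₂, connectedComponentIn_eq (h2 ⟨h, htb⟩)]; exact hcon
  have hunion : C₁ ∪ C₂ = (P.boundary ℝ)ᶜ :=
    subset_antisymm (union_subset (connectedComponentIn_subset _ _)
      (connectedComponentIn_subset _ _)) hcover
  obtain ⟨R, hR0, hR⟩ : ∃ R : ℝ, 0 ≤ R ∧ P.boundary ℝ ⊆ closedBall 0 R := by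
    obtain ⟨R, hR⟩ := hBc.isBounded.subset_closedBall 0
    exact ⟨max R 0, le_max_right _ _, hR.trans (closedBall_subset_closedBall (le_max_left _ _))⟩
  have hextpre := isPreconnected_compl_closedBall hR0
  have hextsub : (closedBall (0 : Plane) R)ᶜ ⊆ (P.boundary ℝ)ᶜ := compl_subset_compl.2 hR
  have hunb : ¬ Bornology.IsBounded (closedBall (0 : Plane) R)ᶜ := by
    intro h
    have := h.union (isBounded_closedBall (x := (0 : Plane)) (r := R))
    rw [compl_union_self] at this
    exact NormedSpace.unbounded_univ ℝ Plane this
  obtain ⟨y, hy⟩ : (closedBall (0 : Plane) R)ᶜ.Nonempty := by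
    rw [nonempty_iff_ne_empty]
    intro h
    rw [h] at hunb
    exact hunb Bornology.isBounded_empty
  -- the side that does not contain the outside of a large disk is the interior
  have hfinish : ∀ (σ : ℝ) (z z' : Plane), (σ = 1 ∨ σ = -1) → z ∉ P.boundary ℝ →
      y ∈ connectedComponentIn (P.boundary ℝ)ᶜ z' →
      Disjoint (connectedComponentIn (P.boundary ℝ)ᶜ z) (connectedComponentIn (P.boundary ℝ)ᶜ z') →
      connectedComponentIn (P.boundary ℝ)ᶜ z ∪ connectedComponentIn (P.boundary ℝ)ᶜ z' =
        (P.boundary ℝ)ᶜ →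
      (∀ p u u', IsTangent P p u u' → ∃ ε > 0, IsLocallyRays (P.boundary ℝ) p u u' ε ∧
        {x | Side σ u u' (x - p)} ∩ ball p ε ⊆ connectedComponentIn (P.boundary ℝ)ᶜ z ∧
        {x | Side (-σ) u u' (x - p)} ∩ ball p ε ⊆ connectedComponentIn (P.boundary ℝ)ᶜ z') →
      ∃ (σ : ℝ) (Ω Ω' : Set Plane), (σ = 1 ∨ σ = -1) ∧ IsOpen Ω ∧ IsOpen Ω' ∧ Ω.Nonempty ∧
        IsPreconnected Ω ∧ Disjoint Ω Ω' ∧ Ω ∪ Ω' = (P.boundary ℝ)ᶜ ∧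
        Bornology.IsBounded Ω ∧ region P = Ω ∪ P.boundary ℝ ∧
        ∀ p u u', IsTangent P p u u' → ∃ ε > 0, IsLocallyRays (P.boundary ℝ) p u u' ε ∧
          {x | Side σ u u' (x - p)} ∩ ball p ε ⊆ Ω ∧
          {x | Side (-σ) u u' (x - p)} ∩ ball p ε ⊆ Ω' := by
    intro σ z z' hσ hz hyz' hd hu hl
    have hext : (closedBall (0 : Plane) R)ᶜ ⊆ connectedComponentIn (P.boundary ℝ)ᶜ z' := by
      rw [connectedComponentIn_eq hyz']
      exact hextpre.subset_connectedComponentIn hy hextsub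
    have hbd : Bornology.IsBounded (connectedComponentIn (P.boundary ℝ)ᶜ z) := by
      refine (isBounded_closedBall (x := (0 : Plane)) (r := R)).subset fun x hx => ?_
      by_contra hxR
      exact disjoint_left.1 hd hx (hext hxR)
    refine ⟨σ, _, _, hσ, hBo.connectedComponentIn, hBo.connectedComponentIn,
      ⟨z, mem_connectedComponentIn hz⟩, isPreconnected_connectedComponentIn, hd, hu, hbd, ?_, hl⟩
    rw [region, union_comm]
    congr 1
    ext x
    constructor
    · rintro ⟨hxB, hxb⟩
      have hx : x ∈ connectedComponentIn (P.boundary ℝ)ᶜ z ∪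
        connectedComponentIn (P.boundary ℝ)ᶜ z' := hu.superset hxB
      refine hx.resolve_right fun h => ?_
      rw [← connectedComponentIn_eq h] at hxb
      exact hunb (hxb.subset hext)
    · intro hx
      refine ⟨connectedComponentIn_subset _ _ hx, ?_⟩
      rw [← connectedComponentIn_eq hx]
      exact hbd
  rcases hcover y (hextsub hy) with h | h
  · refine hfinish (-1) z₂ z₁ (Or.inr rfl) hz₂B h hdisj.symm (by rw [union_comm]; exact hunion) ?_
    intro p u u' ht
    obtain ⟨ε, hε, hr, h1, h2⟩ := hlocal p u u' ht
    exact ⟨ε, hε, hr, h2, by rwa [neg_neg]⟩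
  · exact hfinish 1 z₁ z₂ (Or.inl rfl) hz₁B h hdisj hunion hlocal

/-- The inward normals are the tangents turned towards the interior side σ. A corner is convex or
reflex according to which branch of `Side` applies. -/
theorem exists_isPolygonInterior {n : ℕ} {P : Polygon Plane n} (hP : IsSimple P) :
    ∃ (Ω : Set Plane) (ν : Fin n → Plane), region P = Ω ∪ P.boundary ℝ ∧
      IsPolygonInterior Ω (P.boundary ℝ) P.vertices ν := by
  obtain ⟨σ, Ω, Ω', hσ, hΩ, hΩ', hne, hpre, hd, hu, hbd, hreg, hloc⟩ := hP.exists_interior_exterior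
  have hBc := isCompact_polygon_boundary P
  have hσ0 : σ ≠ 0 := by rcases hσ with rfl | rfl <;> norm_num
  have hσn : |σ| = 1 := by rcases hσ with rfl | rfl <;> simp
  have hdB : Disjoint Ω (P.boundary ℝ) := by
    rw [← subset_compl_iff_disjoint_right, ← hu]; exact subset_union_left
  have hdB' : Disjoint Ω' (P.boundary ℝ) := by
    rw [← subset_compl_iff_disjoint_right, ← hu]; exact subset_union_right
  -- The region is the complement of the open exterior, hence closed.
  have hK : Ω ∪ P.boundary ℝ = Ω'ᶜ := by
    ext x
    constructor
    · rintro (h | h) h'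
      · exact disjoint_left.1 hd h h'
      · exact disjoint_left.1 hdB' h' h
    · intro hx
      by_cases hB : x ∈ P.boundary ℝ
      · exact Or.inr hB
      · have : x ∈ Ω ∪ Ω' := hu ▸ hB
        exact Or.inl (this.resolve_right hx)
  have hcompact : IsCompact (Ω ∪ P.boundary ℝ) :=
    isCompact_of_isClosed_isBounded (hK ▸ hΩ'.isClosed_compl) (hbd.union hBc.isBounded)
  have hshape : ∀ p u u', IsTangent P p u u' → ∃ ε > 0, ∀ x ∈ ball p ε,
      (x ∈ Ω ↔ Side σ u u' (x - p)) ∧ (x ∈ Ω ∪ P.boundary ℝ ↔ ¬ Side (-σ) u u' (x - p)) := by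
    intro p u u' ht
    obtain ⟨hun, hun', hnn⟩ := hP.isTangent_unit ht
    obtain ⟨ε, hε, hr, h1, h2⟩ := hloc p u u' ht
    refine ⟨ε, hε, fun x hx => ?_⟩
    have hray := ray_iff_not_side hun hun' hnn (x - p)
    have hB : x ∈ P.boundary ℝ ↔ ¬ Side σ u u' (x - p) ∧ ¬ Side (-σ) u u' (x - p) := by
      rw [hr x hx, hray]
      rcases hσ with rfl | rfl
      · rfl
      · rw [neg_neg]; exact and_comm
    have hex : Side σ u u' (x - p) → ¬ Side (-σ) u u' (x - p) := not_side_and_side hσ hun hun' hnn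
    have hneg : Side (-σ) u u' (x - p) → x ∉ Ω := fun h hxΩ =>
      disjoint_left.1 hd hxΩ (h2 ⟨h, hx⟩)
    have hiff : x ∈ Ω ↔ Side σ u u' (x - p) := by
      refine ⟨fun hxΩ => ?_, fun h => h1 ⟨h, hx⟩⟩
      by_contra hcon
      exact disjoint_left.1 hdB hxΩ (hB.2 ⟨hcon, fun h => hneg h hxΩ⟩)
    refine ⟨hiff, ?_⟩
    rw [mem_union, hiff, hB]
    exact ⟨fun h => h.elim hex And.right,
      fun h => (em (Side σ u u' (x - p))).imp_right fun h' => ⟨h', h⟩⟩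
  have hmodel : ∀ p u u', IsTangent P p u u' →
      (σ • rot u ≠ σ • rot u' ∧ ConvexAt Ω (P.boundary ℝ) p (σ • rot u) (σ • rot u')) ∨
        ReflexAt Ω (P.boundary ℝ) p (σ • rot u) (σ • rot u') := by
    intro p u u' ht
    obtain ⟨hun, hun', hnn⟩ := hP.isTangent_unit ht
    obtain ⟨ε, hε, h⟩ := hshape p u u' ht
    by_cases hpos : 0 < σ * ⟪rot u, u'⟫
    · refine Or.inl ⟨fun heq => ?_, ε, hε, fun x hx => ?_⟩
      · have h1 := smul_right_injective _ hσ0 heq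
        have : u = u' := by
          have h2 : rot (u - u') = 0 := by
            have e : rot u = rot u' := h1
            rw [sub_eq_add_neg, rot_add, e, ← neg_one_smul ℝ u', rot_smul, neg_one_smul,
              add_neg_cancel]
          exact sub_eq_zero.1 (rot_eq_zero.1 h2)
        rw [this, inner_rot_self, mul_zero] at hpos
        exact lt_irrefl _ hpos
      · obtain ⟨h1, h2⟩ := h x hx
        rw [not_side_neg_iff hσ hun hun' hnn, if_pos hpos] at h2
        rw [Side, if_pos hpos] at h1
        exact ⟨h1, h2⟩
    · refine Or.inr ⟨ε, hε, fun x hx => ?_⟩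
      obtain ⟨h1, h2⟩ := h x hx
      rw [not_side_neg_iff hσ hun hun' hnn, if_neg hpos] at h2
      rw [Side, if_neg hpos] at h1
      exact ⟨h1, h2⟩
  refine ⟨Ω, fun i => σ • rot (tangent P i), hreg, ?_⟩
  refine
    { isOpen := hΩ
      nonempty := hne
      isPreconnected := hpre
      disjoint := hdB
      isCompact := hcompact
      boundary_eq := boundary_eq_iUnion_segment P
      boundary_nonempty := ?_
      norm_normal := fun i => by
        rw [norm_smul, norm_rot, hP.norm_tangent, Real.norm_eq_abs, hσn, one_mul]
      vertex_ne := hP.nondegenerate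
      edge := fun i p hp => (hmodel p _ _ (Or.inl ⟨i, hp, rfl, rfl⟩)).resolve_left
        fun h => h.1 rfl
      normal_add := fun i => by
        rw [← smul_add, ← rot_add]
        exact smul_ne_zero hσ0 (rot_eq_zero.not.2 (hP.tangent_add_ne_zero i))
      vertex := fun i => hmodel _ _ _ (Or.inr ⟨i, rfl, rfl, rfl⟩)
      crosscut := ?_ }
  · have h3 := hP.three_le
    rw [boundary_eq_iUnion_segment]
    exact ⟨P ⟨0, by omega⟩, mem_iUnion.2 ⟨⟨0, by omega⟩, left_mem_segment ℝ _ _⟩⟩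
  · obtain ⟨m, rfl⟩ : ∃ m, n = m + 1 := ⟨n - 1, by have := hP.three_le; omega⟩
    exact fun c hc p hp p' hp' h1 h2 h3 =>
      not_isPreconnected_crosscut P hΩ hdB hc hp hp' h1 h2 h3

end IsSimple

end Jordan

/-! ### Maximal empty circles and the theorem -/

section MaximalEmptyCircles

variable {n : ℕ} {P : Polygon Plane n} {Ω : Set Plane} {ν : Fin n → Plane}

/-- Comparison with the largest disk about the same centre fixes the radius; what remains is
maximality in the disk order. -/
theorem isMEC_iff (hR : region P = Ω ∪ P.boundary ℝ)
    (D : IsPolygonInterior Ω (P.boundary ℝ) P.vertices ν) {x : Plane} {r : ℝ} :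
    IsMEC P x r ↔ x ∈ axis Ω (P.boundary ℝ) ∧ r = infDist x (P.boundary ℝ) := by
  unfold IsMEC
  rw [hR]
  constructor
  · rintro ⟨hr, hsub, hmax⟩
    obtain ⟨hx, hrx⟩ := (D.closedBall_subset_iff hr).1 hsub
    have hreq : r = infDist x (P.boundary ℝ) :=
      (hmax x _ infDist_nonneg ((D.closedBall_subset_iff infDist_nonneg).2 ⟨hx, le_rfl⟩)
        (closedBall_subset_closedBall hrx)).2.symm
    refine ⟨⟨hx, fun y hy hxy => ?_⟩, hreq⟩
    refine (hmax y _ infDist_nonneg ((D.closedBall_subset_iff infDist_nonneg).2 ⟨hy, le_rfl⟩)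
      ((closedBall_subset_closedBall_iff hr).2 ?_)).1
    rwa [hreq]
  · rintro ⟨⟨hx, hax⟩, rfl⟩
    refine ⟨infDist_nonneg, (D.closedBall_subset_iff infDist_nonneg).2 ⟨hx, le_rfl⟩,
      fun y s hs hys hsub => ?_⟩
    obtain ⟨hy, hsy⟩ := (D.closedBall_subset_iff hs).1 hys
    have hd := (closedBall_subset_closedBall_iff infDist_nonneg).1 hsub
    obtain rfl := hax y hy (hd.trans hsy)
    rw [dist_self, zero_add] at hd
    exact ⟨rfl, hsy.antisymm hd⟩

theorem medialAxis_eq_axis (hR : region P = Ω ∪ P.boundary ℝ)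
    (D : IsPolygonInterior Ω (P.boundary ℝ) P.vertices ν) :
    medialAxis P = axis Ω (P.boundary ℝ) := by
  ext x
  simp [medialAxis, isMEC_iff hR D]

theorem enclosingCentres_eq (hR : region P = Ω ∪ P.boundary ℝ)
    (D : IsPolygonInterior Ω (P.boundary ℝ) P.vertices ν) (q : Plane) :
    enclosingCentres P q =
      {x ∈ axis Ω (P.boundary ℝ) | dist q x ≤ infDist x (P.boundary ℝ)} := by
  ext x
  simp [enclosingCentres, isMEC_iff hR D, mem_closedBall]

theorem isMEC_iff_sphere_nontrivial (hR : region P = Ω ∪ P.boundary ℝ)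
    (D : IsPolygonInterior Ω (P.boundary ℝ) P.vertices ν) {x : Plane} {r : ℝ} (hr : 0 < r) :
    IsMEC P x r ↔ closedBall x r ⊆ region P ∧ (sphere x r ∩ P.boundary ℝ).Nontrivial := by
  constructor
  · intro h
    refine ⟨h.2.1, ?_⟩
    obtain ⟨hx, rfl⟩ := (isMEC_iff hR D).1 h
    obtain ⟨p, hp, q, hq, hpq, hxp, hxq⟩ :=
      D.exists_two_nearest hx (IsPolygonInterior.mem_of_infDist_pos hx.1 hr)
    exact ⟨p, ⟨by rwa [mem_sphere'], hp⟩, q, ⟨by rwa [mem_sphere'], hq⟩, hpq⟩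
  · rintro ⟨hsub, p, ⟨hxp, hp⟩, q, ⟨hxq, hq⟩, hpq⟩
    rw [mem_sphere'] at hxp hxq
    rw [hR] at hsub
    obtain ⟨hx, hrx⟩ := (D.closedBall_subset_iff hr.le).1 hsub
    have hreq : r = infDist x (P.boundary ℝ) :=
      hrx.antisymm ((infDist_le_dist_of_mem hp).trans_eq hxp)
    exact (isMEC_iff hR D).2 ⟨IsPolygonInterior.mem_axis_of_two_nearest hx hp hq hpq
      (hxp.trans hreq) (hxq.trans hreq), hreq⟩

/-- A maximal disk containing the disk of `q` itself shows that the set is nonempty, and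
arc-convexity is claim (3). -/
theorem isTree_enclosingCentres (hR : region P = Ω ∪ P.boundary ℝ)
    (D : IsPolygonInterior Ω (P.boundary ℝ) P.vertices ν) {q : Plane} (hq : q ∈ region P) :
    IsTree (enclosingCentres P q) := by
  rw [enclosingCentres_eq hR D]
  refine D.isTree_axis.of_arcConvex (sep_subset _ _) ?_ ?_ ?_
  · rw [hR] at hq
    obtain ⟨y, hy, hqy⟩ := D.exists_mem_axis hq
    exact ⟨y, hy, (le_add_of_nonneg_right infDist_nonneg).trans hqy⟩
  · exact D.isClosed_axis.inter
      (isClosed_le (continuous_const.dist continuous_id) (continuous_infDist_pt _))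
  · exact fun u hu v hv A hA h x hx => ⟨hA hx, D.dist_le_of_mem_arc hA h hu.2 hv.2 hx⟩

end MaximalEmptyCircles

end MedialAxis

theorem lemmal1 {n : ℕ} (P : Polygon MedialAxis.Plane n) (hP : MedialAxis.IsSimple P) :
    -- circles of positive radius: maximal empty iff inside `P` and touching the boundary twice
    (∀ (x : MedialAxis.Plane) (r : ℝ), 0 < r →
      (MedialAxis.IsMEC P x r ↔ Metric.closedBall x r ⊆ MedialAxis.region P ∧
        (Metric.sphere x r ∩ P.boundary ℝ).Nontrivial)) ∧
    -- the medial axis is a tree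
    MedialAxis.IsTree (MedialAxis.medialAxis P) ∧
    -- `M^q` is a connected subtree of the medial axis
    (∀ q ∈ MedialAxis.region P,
      IsConnected (MedialAxis.enclosingCentres P q) ∧
      MedialAxis.IsSubtree (MedialAxis.enclosingCentres P q) (MedialAxis.medialAxis P)) ∧
    -- deleting a point whose circle misses `q` leaves `M^q` in one of the remaining subtrees
    (∀ q ∈ MedialAxis.region P, ∀ (v : MedialAxis.Plane) (r : ℝ), MedialAxis.IsMEC P v r →
      q ∉ Metric.closedBall v r →
      ∃ w ∈ MedialAxis.medialAxis P \ {v}, MedialAxis.enclosingCentres P q ⊆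
        connectedComponentIn (MedialAxis.medialAxis P \ {v}) w) ∧
    -- a point of two maximal empty circles lies in all those centred on the path between them
    (∀ (u v : MedialAxis.Plane) (r s : ℝ), MedialAxis.IsMEC P u r → MedialAxis.IsMEC P v s →
      ∀ a ∈ Metric.closedBall u r ∩ Metric.closedBall v s,
      ∀ A ⊆ MedialAxis.medialAxis P, MedialAxis.IsArc A v u →
      ∀ x ∈ A, ∀ t : ℝ, MedialAxis.IsMEC P x t → a ∈ Metric.closedBall x t) := by
  obtain ⟨Ω, ν, hR, D⟩ := hP.exists_isPolygonInterior
  have hconn : ∀ q ∈ MedialAxis.region P, IsConnected (MedialAxis.enclosingCentres P q) :=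
    fun q hq => (MedialAxis.isTree_enclosingCentres hR D hq).isConnected
  have hsub : ∀ q, MedialAxis.enclosingCentres P q ⊆ MedialAxis.medialAxis P :=
    fun q x ⟨r, hr, _⟩ => ⟨r, hr⟩
  have htree : MedialAxis.IsTree (MedialAxis.medialAxis P) := by
    rw [MedialAxis.medialAxis_eq_axis hR D]
    exact D.isTree_axis
  refine ⟨fun x r hr => MedialAxis.isMEC_iff_sphere_nontrivial hR D hr, htree,
    fun q hq => ⟨hconn q hq, hsub q, htree, MedialAxis.isTree_enclosingCentres hR D hq⟩, ?_, ?_⟩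
  · intro q hq v r hv hqv
    -- The centre determines the radius of its circle, so `v` is not in M^q; being connected, M^q
    -- stays in one component.
    have hss : MedialAxis.enclosingCentres P q ⊆ MedialAxis.medialAxis P \ {v} := by
      refine fun x hx => ⟨hsub q hx, ?_⟩
      rintro rfl
      obtain ⟨s, hs, hqs⟩ := hx
      rw [((MedialAxis.isMEC_iff hR D).1 hs).2, ← ((MedialAxis.isMEC_iff hR D).1 hv).2] at hqs
      exact hqv hqs
    obtain ⟨w, hw⟩ := (hconn q hq).nonempty
    exact ⟨w, hss hw, (hconn q hq).isPreconnected.subset_connectedComponentIn hw hss⟩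
  · intro u v r s hu hv a ha A hA h x hx t ht
    rw [MedialAxis.medialAxis_eq_axis hR D] at hA
    obtain ⟨-, rfl⟩ := (MedialAxis.isMEC_iff hR D).1 hu
    obtain ⟨-, rfl⟩ := (MedialAxis.isMEC_iff hR D).1 hv
    obtain ⟨-, rfl⟩ := (MedialAxis.isMEC_iff hR D).1 ht
    exact D.dist_le_of_mem_arc hA h ha.2 ha.1 hx
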